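/- All graphs are finite. The gem $F_4$ is the path on four vertices together with an additional vertex adjacent to all of them. A graph $H$ is a topological minor of $G$ if $G$ has a subgraph that is a subdivision of $H$. A graph is $k$-connected if it has more than $k$ vertices and $|A\cap B|\ge k$ for all vertex sets $A,B$ that cover the vertex set, neither of which contains the other, and such that there is no edge between $A\setminus B$ and $B\setminus A$. A $2$-connected component of $G$ is a maximal $2$-connected subgraph of $G$. An SPQR tree of a $2$-connected simple graph $C$ is a finite tree $T$ in which every node $t$ is labelled with a multigraph $G_t$ (its torso) with $V(G_t)\subseteq V(C)$, and every edge $st$ of $T$ is mapped to one edge of $G_s$ and one edge of $G_t$, called virtual edges, such that: - every node $t$ is an $\mathsf S$-node ($G_t$ is a simple cycle with at least three vertices), a $\mathsf P$-node ($G_t$ consists of two vertices joined by at least three parallel edges), or an $\mathsf R$-node ($G_t$ is a simple $3$-connected graph); - every edge of $G_t$ is the image of at most one edge of $T$; the edges of $G_t$ that are not virtual are edges of $C$ with the same ends, and every edge of $C$ occurs in this way in exactly one $G_t$; - for every edge $st$ of $T$, the two virtual edges to which it is mapped have the same two ends $x,y$, and $V(G_s)\cap V(G_t)=\{x,y\}$;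 - for every vertex $x$ of $C$, the nodes $t$ with $x\in V(G_t)$ induce a nonempty subtree of $T$; - no two $\mathsf S$-nodes are adjacent and no two $\mathsf P$-nodes are adjacent in $T$. **Theorem.** A simple graph $G$ does not contain $F_4$ as a topological minor if and only if every $2$-connected component $C$ of $G$ has an SPQR tree $T$ with the following properties: 1. for every $\mathsf R$-node $t$ of $T$, the graph $G_t$ has maximum degree at most $3$; 2. for every vertex $u$ of $C$, there are no two distinct nodes $s,t$ of $T$, each of which is a $\mathsf P$-node or an $\mathsf R$-node, such that $u$ is a vertex of both $G_s$ and $G_t$. -/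

import Mathlib

namespace GemSPQR

open scoped Graph

universe u v

/-! ### Fans and topological minors -/

/-- The `k`-fan: the path on `k` vertices (the vertices `some i`) together with an additional
universal vertex `none`. The gem is `fan 4`. -/
def fan (k : ℕ) : SimpleGraph (Option (Fin k)) where
  Adj a b :=
    match a, b with
    | none, none => False
    | none, some _ => True
    | some _, none => True
    | some i, some j => (SimpleGraph.pathGraph k).Adj i j
  symm := ⟨by
    rintro (_ | i) (_ | j) h
    · exact h
    · trivial
    · trivial
    · exact SimpleGraph.Adj.symm h⟩
  loopless := ⟨by
    rintro (_ | i) h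
    · exact h
    · exact SimpleGraph.irrefl _ h⟩

/-- A topological minor model of `H` in `G`: an injective choice of branch vertices, and for every
edge `ab` of `H` a path of `G` joining the branch vertices of `a` and `b`, such that the inner
vertices of these paths are not branch vertices and lie on no other of these paths. In other words,
a subgraph of `G` that is a subdivision of `H`. -/
structure TopologicalMinorModel {W : Type u} {V : Type v}
    (H : SimpleGraph W) (G : SimpleGraph V) where
  /-- the branch vertices -/
  branch : W → V
  branch_injective : Function.Injective branch
  /-- the path associated with an edge of `H`, in each of the two directions -/
  path : ∀ a b : W, H.Adj a b → G.Walk (branch a) (branch b)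
  path_isPath : ∀ (a b : W) (h : H.Adj a b), (path a b h).IsPath
  /-- the two directions of an edge give the same path -/
  path_symm : ∀ (a b : W) (h : H.Adj a b), path b a h.symm = (path a b h).reverse
  /-- inner vertices of the paths are not branch vertices -/
  branch_mem_path : ∀ (a b : W) (h : H.Adj a b) (c : W),
    branch c ∈ (path a b h).support → c = a ∨ c = b
  /-- the paths of two different edges share no vertex except branch vertices -/
  path_disjoint : ∀ (a b : W) (h : H.Adj a b) (a' b' : W) (h' : H.Adj a' b'),
    s(a, b) ≠ s(a', b') →
      ∀ x, x ∈ (path a b h).support → x ∈ (path a' b' h').support → x ∈ Set.range branch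

/-- `H` is a topological minor of `G`. -/
def IsTopologicalMinor {W : Type u} {V : Type v} (H : SimpleGraph W) (G : SimpleGraph V) : Prop :=
  Nonempty (TopologicalMinorModel H G)

/-! ### Connectivity -/

/-- A separation of `G`: two vertex sets that cover `V(G)`, with no edge between `A \ B` and
`B \ A`. -/
def IsSeparation {V : Type u} (G : SimpleGraph V) (A B : Set V) : Prop :=
  A ∪ B = Set.univ ∧ ∀ x ∈ A \ B, ∀ y ∈ B \ A, ¬ G.Adj x y

/-- `G` is `k`-connected: it has more than `k` vertices, and every nontrivial separation `(A, B)`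
(one where neither side contains the other) has order `|A ∩ B|` at least `k`. -/
def IsKConnected {V : Type u} (k : ℕ) (G : SimpleGraph V) : Prop :=
  (k : ℕ∞) < ENat.card V ∧
    ∀ A B : Set V, IsSeparation G A B → ¬ A ⊆ B → ¬ B ⊆ A → (k : ℕ∞) ≤ (A ∩ B).encard

/-- A `2`-connected component of `G`: a maximal `2`-connected subgraph. -/
def IsTwoConnectedComponent {V : Type u} (G : SimpleGraph V) (C : G.Subgraph) : Prop :=
  Maximal (fun D : G.Subgraph => IsKConnected 2 D.coe) C

/-! ### SPQR trees

The nodes of an SPQR tree are labelled with multigraphs (`Graph` is Mathlib's type of multigraphs).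
-/

/-- The label of an `S`-node: a simple cycle of size at least three. -/
def IsCycleLabel {V : Type u} {E : Type v} (M : Graph V E) : Prop :=
  M.Simple ∧ ∃ n : ℕ, 3 ≤ n ∧ Nonempty (M.toSimpleGraph ≃g SimpleGraph.cycleGraph n)

/-- The label of a `P`-node: a dipole, that is two vertices joined by at least three parallel
edges. -/
def IsDipoleLabel {V : Type u} {E : Type v} (M : Graph V E) : Prop :=
  ∃ (x y : V) (F : Set E), x ≠ y ∧ 3 ≤ F.encard ∧ M = Graph.banana x y F

/-- The label of an `R`-node: a simple `3`-connected graph. -/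
def IsThreeConnectedLabel {V : Type u} {E : Type v} (M : Graph V E) : Prop :=
  M.Simple ∧ IsKConnected 3 M.toSimpleGraph

/-- A (canonical) SPQR tree of a graph `G`.

An edge of a label is either *real*, `Sum.inl e`, an edge `e` of `G`, or *virtual*, `Sum.inr s`,
the virtual edge mapped to the tree edge that leads to the neighbouring node `s`. Thus a tree edge
`st` is mapped to the edge `Sum.inr t` of the label of `s` and to the edge `Sum.inr s` of the label
of `t`, and `G` is obtained by gluing the labels along these pairs of virtual edges and then
deleting the virtual edges. -/
structure SPQRTree {V : Type u} (G : SimpleGraph V) where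
  /-- the nodes -/
  Node : Type
  finite_node : Finite Node
  /-- the tree on the nodes -/
  tree : SimpleGraph Node
  isTree : tree.IsTree
  /-- the multigraph that labels a node -/
  label : Node → Graph V (Sym2 V ⊕ Node)
  /-- every node is an `S`-, `P`-, `R`- or `Q`-node; the label of a `Q`-node is a single edge,
  an edge of `G` -/
  label_type : ∀ t, IsCycleLabel (label t) ∨ IsDipoleLabel (label t) ∨
    IsThreeConnectedLabel (label t) ∨
    ∃ x y : V, x ≠ y ∧ label t = Graph.banana x y {Sum.inl s(x, y)}
  /-- real edges are edges of `G` ... -/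
  real_mem : ∀ (t : Node) (e : Sym2 V), Sum.inl e ∈ E(label t) → e ∈ G.edgeSet
  /-- ... with the same ends ... -/
  real_ends : ∀ (t : Node) (e : Sym2 V) (x y : V), (label t).IsLink (Sum.inl e) x y → e = s(x, y)
  /-- ... and every edge of `G` is a real edge of exactly one label. -/
  real_unique : ∀ e ∈ G.edgeSet, ∃! t : Node, Sum.inl e ∈ E(label t)
  /-- the virtual edges of the label of a node correspond to its incident tree edges -/
  virtual_mem : ∀ s t : Node, Sum.inr t ∈ E(label s) ↔ tree.Adj s t
  /-- the two virtual edges mapped to a tree edge have the same ends ... -/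
  virtual_ends : ∀ (s t : Node) (x y : V),
    (label s).IsLink (Sum.inr t) x y → (label t).IsLink (Sum.inr s) x y
  /-- ... and these ends are the only common vertices of the two labels -/
  adhesion : ∀ (s t : Node) (x y : V),
    (label s).IsLink (Sum.inr t) x y → V(label s) ∩ V(label t) = {x, y}
  /-- the nodes whose label contains a given vertex of `G` induce a nonempty subtree -/
  vertex_subtree : ∀ x : V, (tree.induce {t | x ∈ V(label t)}).Connected
  /-- no two `S`-nodes are adjacent -/
  not_adj_S : ∀ s t, tree.Adj s t → ¬ (IsCycleLabel (label s) ∧ IsCycleLabel (label t))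
  /-- no two `P`-nodes are adjacent -/
  not_adj_P : ∀ s t, tree.Adj s t → ¬ (IsDipoleLabel (label s) ∧ IsDipoleLabel (label t))

namespace SPQRTree

variable {V : Type u} {G : SimpleGraph V}

/-- `t` is a `P`-node. -/
def IsPNode (T : SPQRTree G) (t : T.Node) : Prop := IsDipoleLabel (T.label t)

/-- `t` is an `R`-node. -/
def IsRNode (T : SPQRTree G) (t : T.Node) : Prop := IsThreeConnectedLabel (T.label t)

end SPQRTree

end GemSPQR

/-! Both directions pass through butterflies: a vertex `h` with two disjoint connected sets (wings)
that avoid `h` and contain two neighbours of `h` each. Cutting the rim of a subdivided gem in the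
middle gives a butterfly at the hub, inside a 2-connected component
(`TopologicalMinorModel.exists_butterfly`). Conversely, in a 2-connected graph the wings of a
butterfly can be joined in `G - h`, which completes a subdivided gem
(`Bicon.isTopologicalMinor_of_butterfly`). What remains is that a 2-connected graph has no butterfly
if and only if it has an SPQR tree with the two properties.

Given such a tree, a vertex `h` lies in a single S-node, and then has degree two, or it lies in
exactly one P- or R-node `t` and otherwise only in S-nodes adjacent to `t`, each with at most one
real edge at `h`. So the edges of `G` at `h` inject into the edges of the label of `t` at `h`. If
`t` is an R-node, there are at most three of them. If `t` is a P-node with ends `h` and `y`, one of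
two wings avoids `y`; it is confined to one branch at `t` and cannot contain two neighbours of `h`
(`SPQRTree.not_butterfly`).

Now let there be no butterfly. Menger's theorem for two paths in `G - h` gives every vertex `h` of
degree at least four a partner `y`: each component of `G - h - y` contains at most one neighbour of
`h` (`Bicon.hasPartners`). This condition, unlike the absence of butterflies, is easily seen to
survive two reductions: suppressing a vertex of degree two with nonadjacent neighbours, and
contracting one side of an edge cut of size two. From it alone the tree is built by induction on the
number of vertices (`Bicon.hasGoodTree`).

A partner `y` of `h` also has degree at least four, and its partner is `h`; hence each component of
`G - h - y` sends a single edge to each of `h` and `y` (`Bicon.exists_dipoleAt`). So around vertices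
of high degree the graph falls apart along edge cuts of size two. When every vertex of degree two
lies in a triangle, a minimal side of such a cut, or the whole graph if there is none, is a
triangle, an edge `xy` with common neighbours of degree two, or a part all of whose vertices have
degree three (`MinimalSide.shape`). In the last case the side, with its two cut ends joined by an
edge, is 3-connected, since a small vertex separator of a cubic graph yields a small edge cut
(`cubicThreeConn_of_cut`).

The graph with the side contracted is decomposed by induction. The side is first put back as a mere
edge `xy` whose ends have degree two. Every vertex of a P- or R-node has degree at least three, so
this edge belongs to an S-node, and a P- or R-node for the side can be glued on there. Thus P- and
R-nodes remain pairwise disjoint and alternate with S-nodes. -/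

namespace GemSPQR
open Set

universe u

variable {V : Type u} {G H : SimpleGraph V} {S X Y Y' Z A B : Set V} {a b c d h p q u v w x y z : V}

/-! ### Connected vertex sets -/

/-- `Y` induces a connected (possibly empty) subgraph of `G`: a subset of `Y` that has an element
and is closed under adjacency within `Y` is everything. -/
def Conn (G : SimpleGraph V) (Y : Set V) : Prop :=
  ∀ Z : Set V, (∃ u ∈ Y, u ∈ Z) → (∀ u ∈ Y, u ∈ Z → ∀ w ∈ Y, G.Adj u w → w ∈ Z) → Y ⊆ Z

theorem Conn.mono (hY : Conn G Y) (hGH : ∀ u ∈ Y, ∀ w ∈ Y, G.Adj u w → H.Adj u w) : Conn H Y :=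
  fun Z hne hcl => hY Z hne fun u hu huZ w hw huw => hcl u hu huZ w hw (hGH u hu w hw huw)

theorem conn_singleton (G : SimpleGraph V) (x : V) : Conn G {x} := by
  rintro Z ⟨u, rfl, hu⟩ _ w rfl
  exact hu

theorem Conn.union (hY : Conn G Y) (hY' : Conn G Y') (hx : x ∈ Y) (hx' : x ∈ Y') :
    Conn G (Y ∪ Y') := by
  rintro Z ⟨u, hu, huZ⟩ hcl
  have h1 : ∀ u ∈ Y, u ∈ Z → Y ⊆ Z := fun u hu huZ =>
    hY Z ⟨u, hu, huZ⟩ fun a ha haZ b hb => hcl a (.inl ha) haZ b (.inl hb)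
  have h2 : ∀ u ∈ Y', u ∈ Z → Y' ⊆ Z := fun u hu huZ =>
    hY' Z ⟨u, hu, huZ⟩ fun a ha haZ b hb => hcl a (.inr ha) haZ b (.inr hb)
  have hxZ : x ∈ Z := hu.elim (fun hu => h1 u hu huZ hx) (fun hu => h2 u hu huZ hx')
  exact union_subset (h1 x hx hxZ) (h2 x hx' hxZ)

theorem Conn.union_adj (hY : Conn G Y) (hY' : Conn G Y') (hx : x ∈ Y) (hx' : y ∈ Y')
    (hxy : G.Adj x y) : Conn G (Y ∪ Y') := by
  have hp : Conn G {x, y} := by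
    rintro Z ⟨u, hu, huZ⟩ hcl
    have hxZ : x ∈ Z ∧ y ∈ Z := by
      rcases hu with rfl | rfl
      · exact ⟨huZ, hcl _ (.inl rfl) huZ _ (.inr rfl) hxy⟩
      · exact ⟨hcl _ (.inr rfl) huZ _ (.inl rfl) hxy.symm, huZ⟩
    rintro w (rfl | rfl)
    exacts [hxZ.1, hxZ.2]
  have := (hY.union hp hx (.inl rfl)).union hY' (.inr (.inr rfl)) hx'
  convert this using 1
  ext z
  simp only [mem_union, mem_insert_iff, mem_singleton_iff]
  constructor
  · tauto
  · rintro ((h | rfl | rfl) | h) <;> tauto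

theorem Conn.subset_or_disjoint (hY : Conn G Y)
    (hcl : ∀ u ∈ Y, u ∈ Z → ∀ w ∈ Y, G.Adj u w → w ∈ Z) : Y ⊆ Z ∨ ∀ u ∈ Y, u ∉ Z := by
  by_cases hne : ∃ u ∈ Y, u ∈ Z
  · exact .inl (hY Z hne hcl)
  · exact .inr fun u hu huZ => hne ⟨u, hu, huZ⟩

/-- In a connected set, an edge leads from any nonempty proper part to the rest. -/
theorem Conn.exists_adj (hY : Conn G Y) (hu : u ∈ Y) (huZ : u ∈ Z) (hw : w ∈ Y) (hwZ : w ∉ Z) :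
    ∃ a b, a ∈ Y ∧ a ∈ Z ∧ b ∈ Y ∧ b ∉ Z ∧ G.Adj a b := by
  by_contra hcon
  push Not at hcon
  exact hwZ (hY Z ⟨u, hu, huZ⟩ (fun a ha haZ b hb hab => by
    by_contra hbZ
    exact hcon a b ha haZ hb hbZ hab) hw)

theorem conn_iff_induce_preconnected : Conn G Y ↔ (G.induce Y).Preconnected := by
  constructor
  · rintro hY ⟨a, ha⟩ ⟨b, hb⟩
    have := hY {u | ∃ hu : u ∈ Y, (G.induce Y).Reachable ⟨a, ha⟩ ⟨u, hu⟩} ⟨a, ha, ha, .rfl⟩ (by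
      rintro u hu ⟨_, hau⟩ w hw huw
      exact ⟨hw, hau.trans (SimpleGraph.Adj.reachable (by simpa using huw))⟩) hb
    exact this.2
  · rintro hpre Z ⟨u, hu, huZ⟩ hcl w hw
    obtain ⟨W⟩ := hpre ⟨u, hu⟩ ⟨w, hw⟩
    have key : ∀ (a b : Y), (G.induce Y).Walk a b → a.1 ∈ Z → b.1 ∈ Z := by
      intro a b W
      induction W with
      | nil => exact id
      | cons hadj _ ih => exact fun ha => ih (hcl _ (Subtype.prop _) ha _ (Subtype.prop _) hadj)
    exact key _ _ W huZ

theorem Conn.exists_isPath (hY : Conn G Y) (hu : u ∈ Y) (hw : w ∈ Y) :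
    ∃ W : G.Walk u w, W.IsPath ∧ ∀ z ∈ W.support, z ∈ Y := by
  have key : ∀ a b : Y, (G.induce Y).Walk a b →
      ∃ W : G.Walk a.1 b.1, ∀ z ∈ W.support, z ∈ Y := by
    intro a b W
    induction W with
    | @nil a => exact ⟨.nil, by simp⟩
    | @cons a b c hab _ ih =>
      obtain ⟨W, hW⟩ := ih
      have hab' : G.Adj a.1 b.1 := hab
      refine ⟨.cons hab' W, fun z hz => ?_⟩
      rw [SimpleGraph.Walk.support_cons, List.mem_cons] at hz
      rcases hz with rfl | hz
      exacts [a.2, hW z hz]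
  classical
  obtain ⟨W⟩ := conn_iff_induce_preconnected.1 hY ⟨u, hu⟩ ⟨w, hw⟩
  obtain ⟨W', hW'⟩ := key _ _ W
  exact ⟨W'.bypass, W'.bypass_isPath, fun z hz => hW' z (W'.support_bypass_subset_support hz)⟩

theorem conn_walk_support (W : G.Walk u w) : Conn G {z | z ∈ W.support} := by
  induction W with
  | nil => simpa using conn_singleton G _
  | @cons a b c hab W ih =>
    have := (conn_singleton G a).union_adj ih rfl (W.start_mem_support) hab
    convert this using 1
    ext z
    simp

/-! ### Sets that are closed up to a separator -/

/-- `Z` avoids `S` and all edges leaving `Z` end in `S`. -/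
def ClosedUpTo (G : SimpleGraph V) (S Z : Set V) : Prop :=
  (∀ u ∈ Z, u ∉ S) ∧ ∀ u ∈ Z, ∀ w, G.Adj u w → w ∈ Z ∨ w ∈ S

theorem ClosedUpTo.compl (hZ : ClosedUpTo G S Z) : ClosedUpTo G S {u | u ∉ Z ∧ u ∉ S} := by
  refine ⟨fun u hu => hu.2, fun u hu w huw => ?_⟩
  by_cases hwS : w ∈ S
  · exact .inr hwS
  · exact .inl ⟨fun hw => (hZ.2 w hw u huw.symm).elim hu.1 hu.2, hwS⟩

theorem closedUpTo_compl (G : SimpleGraph V) (S : Set V) : ClosedUpTo G S Sᶜ :=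
  ⟨fun _ hu => hu, fun _ _ w _ => (em (w ∈ S)).symm⟩

/-- The component of `p` in `G - S`. -/
def comp (G : SimpleGraph V) (S : Set V) (p : V) : Set V :=
  {u | ∀ Z, ClosedUpTo G S Z → p ∈ Z → u ∈ Z}

theorem mem_comp_self : p ∈ comp G S p := fun _ _ h => h

theorem comp_subset (hZ : ClosedUpTo G S Z) (hp : p ∈ Z) : comp G S p ⊆ Z :=
  fun _ hu => hu Z hZ hp

theorem closedUpTo_comp (hp : p ∉ S) : ClosedUpTo G S (comp G S p) := by
  refine ⟨fun u hu => hu _ (closedUpTo_compl G S) hp, fun u hu w huw => ?_⟩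
  by_cases hw : w ∈ S
  · exact .inr hw
  · exact .inl fun Z hZ hpZ => (hZ.2 u (hu Z hZ hpZ) w huw).resolve_right hw

theorem conn_comp (hp : p ∉ S) : Conn G (comp G S p) := by
  have hcl := closedUpTo_comp (G := G) hp
  have key : ∀ Z : Set V, (∀ u ∈ comp G S p, u ∈ Z → ∀ w ∈ comp G S p, G.Adj u w → w ∈ Z) →
      p ∈ Z → comp G S p ⊆ Z := by
    intro Z hZ hpZ
    have : ClosedUpTo G S (comp G S p ∩ Z) := by
      refine ⟨fun u hu => hcl.1 u hu.1, fun u hu w huw => ?_⟩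
      rcases hcl.2 u hu.1 w huw with hw | hw
      · exact .inl ⟨hw, hZ u hu.1 hu.2 w hw huw⟩
      · exact .inr hw
    exact fun u hu => (hu _ this ⟨mem_comp_self, hpZ⟩).2
  rintro Z ⟨u, hu, huZ⟩ hZ
  by_cases hpZ : p ∈ Z
  · exact key Z hZ hpZ
  -- If `p` is missing from `Z`, the complement of `Z` is closed as well and contains `p`, hence
  -- contains the whole component, including `u`.
  · exact absurd huZ (key Zᶜ (fun a ha haZ b hb hab hbZ => haZ (hZ b hb hbZ a ha hab.symm)) hpZ hu)

theorem comp_eq_of_mem (hp : p ∉ S) (hq : q ∈ comp G S p) : comp G S q = comp G S p := by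
  have hqS := (closedUpTo_comp (G := G) hp).1 q hq
  refine (comp_subset (closedUpTo_comp hp) hq).antisymm ?_
  refine comp_subset (closedUpTo_comp hqS) ?_
  -- Otherwise the complement of the component of `q` is closed and contains `p`, hence also `q`.
  by_contra hpq
  have := comp_subset (closedUpTo_comp (G := G) hqS).compl ⟨hpq, hp⟩ hq
  exact this.1 mem_comp_self

/-! ### Two disjoint connections, or a separating vertex -/

/-- There are two disjoint connected sets each of which meets both `A` and `B`. -/
def TwoLinked (G : SimpleGraph V) (A B : Set V) : Prop :=
  ∃ P Q : Set V, Conn G P ∧ Conn G Q ∧ Disjoint P Q ∧ (P ∩ A).Nonempty ∧ (P ∩ B).Nonempty ∧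
    (Q ∩ A).Nonempty ∧ (Q ∩ B).Nonempty

/-- The vertex `y` separates `A` from `B`. -/
def OneSeparated (G : SimpleGraph V) (A B : Set V) : Prop :=
  ∃ (y : V) (Z : Set V), y ∉ Z ∧ A ⊆ insert y Z ∧ (∀ b ∈ B, b ∉ Z) ∧
    ∀ u ∈ Z, ∀ w, G.Adj u w → w ∈ Z ∨ w = y

theorem TwoLinked.mono (h : TwoLinked G A B) (hle : G ≤ H) : TwoLinked H A B := by
  obtain ⟨P, Q, hP, hQ, hrest⟩ := h
  exact ⟨P, Q, hP.mono fun _ _ _ _ h => hle h, hQ.mono fun _ _ _ _ h => hle h, hrest⟩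

/-- The subgraph of `G` on all vertices with the edges that have both ends in `Y`. -/
def within (G : SimpleGraph V) (Y : Set V) : SimpleGraph V where
  Adj a b := G.Adj a b ∧ a ∈ Y ∧ b ∈ Y
  symm := ⟨fun _ _ h => ⟨h.1.symm, h.2.2, h.2.1⟩⟩
  loopless := ⟨fun _ h => G.irrefl h.1⟩

theorem within_le : within G Y ≤ G := fun _ _ h => h.1

theorem Conn.subset_of_within (hP : Conn (within G Y) X) (hx : x ∈ X) (hxY : x ∈ Y) : X ⊆ Y :=
  hP Y ⟨x, hx, hxY⟩ fun _ _ _ _ _ h => h.2.2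

theorem TwoLinked.exists_pair (h : TwoLinked G A {x, y}) : ∃ P Q : Set V,
    Conn G P ∧ Conn G Q ∧ Disjoint P Q ∧ (P ∩ A).Nonempty ∧ x ∈ P ∧ (Q ∩ A).Nonempty ∧ y ∈ Q := by
  obtain ⟨P, Q, hP, hQ, hd, hPA, ⟨s, hs, hs'⟩, hQA, ⟨t, ht, ht'⟩⟩ := h
  have hst : s ≠ t := by
    rintro rfl
    exact disjoint_left.1 hd hs ht
  rcases hs' with rfl | rfl <;> rcases ht' with rfl | rfl
  · exact absurd rfl hst
  · exact ⟨P, Q, hP, hQ, hd, hPA, hs, hQA, ht⟩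
  · exact ⟨Q, P, hQ, hP, hd.symm, hQA, ht, hPA, hs⟩
  · exact absurd rfl hst

theorem TwoLinked.symm (h : TwoLinked G A B) : TwoLinked G B A := by
  obtain ⟨P, Q, hP, hQ, hd, h1, h2, h3, h4⟩ := h
  exact ⟨P, Q, hP, hQ, hd, h2, h1, h4, h3⟩

/-- The induction step of Menger's theorem: `y` separates `A` from `B` in `G - uw`, and `uw` leaves
`Z`. Connections from `A` to `{y, u}` inside `Z ∪ {y}` and from `{y, w}` to `B` outside `Z` fit
together at `y` and along `uw`. A vertex that separates in one of the two halves separates `A` from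
`B` in all of `G`. -/
theorem twoLinked_or_oneSeparated_of_edge
    (hAZ : A ⊆ insert y Z) (hyZ : y ∉ Z) (hBZ : ∀ b ∈ B, b ∉ Z) (huw : G.Adj u w) (hu : u ∈ Z)
    (hw : w ∉ Z) (hwy : w ≠ y)
    (hcl : ∀ p ∈ Z, ∀ q, G.Adj p q → q ∈ Z ∨ q = y ∨ (p = u ∧ q = w))
    (h1 : TwoLinked (within G (insert y Z)) A {y, u} ∨
      OneSeparated (within G (insert y Z)) A {y, u})
    (h2 : TwoLinked (within G Zᶜ) {y, w} B ∨ OneSeparated (within G Zᶜ) {y, w} B) :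
    TwoLinked G A B ∨ OneSeparated G A B := by
  rcases h1 with h1 | ⟨y₁, Z₁, hy₁, hA₁, hB₁, hcl₁⟩
  swap
  · have hyZ₁ : y ∉ Z₁ := hB₁ y (.inl rfl)
    have huZ₁ : u ∉ Z₁ := hB₁ u (.inr rfl)
    refine .inr ⟨y₁, Z₁ ∩ Z, fun h => hy₁ h.1, ?_, fun b hb hbZ => hBZ b hb hbZ.2, ?_⟩
    · intro a ha
      rcases hA₁ ha with rfl | h
      · exact .inl rfl
      · rcases hAZ ha with rfl | h'
        · exact absurd h hyZ₁
        · exact .inr ⟨h, h'⟩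
    · rintro p ⟨hp₁, hp⟩ q hpq
      have hq : q ∈ insert y Z := by
        rcases hcl p hp q hpq with h | h | ⟨rfl, rfl⟩
        · exact .inr h
        · exact .inl h
        · exact absurd hp₁ huZ₁
      rcases hcl₁ p hp₁ q ⟨hpq, .inr hp, hq⟩ with h | h
      · rcases hq with rfl | hq
        · exact absurd h hyZ₁
        · exact .inl ⟨h, hq⟩
      · exact .inr h
  rcases h2 with h2 | ⟨y₂, Z₂, hy₂, hA₂, hB₂, hcl₂⟩
  swap
  · refine .inr ⟨y₂, (Z ∪ Z₂) \ {y₂}, fun h => h.2 rfl, ?_, ?_, ?_⟩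
    · intro a ha
      by_cases hay : a = y₂
      · exact .inl hay
      rcases hAZ ha with rfl | h
      · exact .inr ⟨.inr ((hA₂ (.inl rfl)).resolve_left hay), hay⟩
      · exact .inr ⟨.inl h, hay⟩
    · rintro b hb ⟨h | h, _⟩
      · exact hBZ b hb h
      · exact hB₂ b hb h
    · rintro p ⟨hp, hpy⟩ q hpq
      by_cases hqy : q = y₂
      · exact .inr hqy
      refine .inl ⟨?_, hqy⟩
      by_cases hqZ : q ∈ Z
      · exact .inl hqZ
      by_cases hpZ : p ∈ Z
      · rcases hcl p hpZ q hpq with h | rfl | ⟨rfl, rfl⟩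
        · exact .inl h
        · exact .inr ((hA₂ (.inl rfl)).resolve_left hqy)
        · exact .inr ((hA₂ (.inr rfl)).resolve_left hqy)
      · have hp₂ := hp.resolve_left hpZ
        exact .inr ((hcl₂ p hp₂ q ⟨hpq, hpZ, hqZ⟩).resolve_right hqy)
  left
  obtain ⟨P₁, Q₁, hP₁, hQ₁, hd₁, hPA, hyP₁, hQA, huQ₁⟩ := h1.exists_pair
  obtain ⟨P₂, Q₂, hP₂, hQ₂, hd₂, hPB, hyP₂, hQB, hwQ₂⟩ := h2.symm.exists_pair
  have sP₁ := hP₁.subset_of_within hyP₁ (.inl rfl)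
  have sQ₁ := hQ₁.subset_of_within huQ₁ (.inr hu)
  have sP₂ := hP₂.subset_of_within hyP₂ hyZ
  have sQ₂ := hQ₂.subset_of_within hwQ₂ hw
  have lift : ∀ {Y P : Set V}, Conn (within G Y) P → Conn G P :=
    fun h => h.mono fun _ _ _ _ h => h.1
  refine ⟨P₁ ∪ P₂, Q₁ ∪ Q₂, (lift hP₁).union (lift hP₂) hyP₁ hyP₂,
    (lift hQ₁).union_adj (lift hQ₂) huQ₁ hwQ₂ huw, ?_, ?_, ?_, ?_, ?_⟩
  · rw [disjoint_left] at hd₁ hd₂ ⊢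
    rintro t (ht | ht) (ht' | ht')
    · exact hd₁ ht ht'
    · rcases sP₁ ht with rfl | h
      · exact hd₂ hyP₂ ht'
      · exact sQ₂ ht' h
    · rcases sQ₁ ht' with rfl | h
      · exact hd₁ hyP₁ ht'
      · exact sP₂ ht h
    · exact hd₂ ht ht'
  · exact hPA.mono (inter_subset_inter_left _ subset_union_left)
  · exact hPB.mono (inter_subset_inter_left _ subset_union_right)
  · exact hQA.mono (inter_subset_inter_left _ subset_union_left)
  · exact hQB.mono (inter_subset_inter_left _ subset_union_right)

/-- Menger's theorem for two paths between sets. -/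
theorem twoLinked_or_oneSeparated [Finite V] [Nonempty V] (G : SimpleGraph V) (A B : Set V) :
    TwoLinked G A B ∨ OneSeparated G A B := by
  induction hn : G.edgeSet.ncard using Nat.strong_induction_on generalizing G A B with
  | _ n ih =>
  subst hn
  have lt : ∀ {H : SimpleGraph V}, H < G → H.edgeSet.ncard < G.edgeSet.ncard := fun hlt =>
    ncard_lt_ncard (SimpleGraph.edgeSet_ssubset_edgeSet.2 hlt) (toFinite _)
  by_cases hE : ∃ u w, G.Adj u w
  · obtain ⟨u, w, huw⟩ := hE
    have hdel : G.deleteEdges {s(u, w)} < G := by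
      refine lt_of_le_of_ne (SimpleGraph.deleteEdges_le _) fun h => ?_
      rw [← h] at huw
      simp at huw
    rcases ih _ (lt hdel) (G.deleteEdges {s(u, w)}) A B rfl with h | ⟨y, Z, hyZ, hAZ, hBZ, hcl⟩
    · exact .inl (h.mono (SimpleGraph.deleteEdges_le _))
    have hcl' : ∀ p ∈ Z, ∀ q, G.Adj p q → q ∈ Z ∨ q = y ∨ s(p, q) = s(u, w) := by
      intro p hp q hpq
      by_cases he : s(p, q) = s(u, w)
      · exact .inr (.inr he)
      · have := hcl p hp q (by simpa [SimpleGraph.deleteEdges_adj, hpq] using he)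
        tauto
    -- If the separator of `G - uw` fails in `G`, then `uw` leads out of `Z` in one of its
    -- directions. Neither half contains `uw`, so both have fewer edges and induction applies to
    -- them.
    have main : ∀ u w, G.Adj u w → u ∈ Z → w ∉ Z → w ≠ y →
        (∀ p ∈ Z, ∀ q, G.Adj p q → q ∈ Z ∨ q = y ∨ s(p, q) = s(u, w)) →
        TwoLinked G A B ∨ OneSeparated G A B := by
      intro u w huw hu hw hwy hcl
      refine twoLinked_or_oneSeparated_of_edge hAZ hyZ hBZ huw hu hw hwy ?_
        (ih _ (lt ?_) _ _ _ rfl) (ih _ (lt ?_) _ _ _ rfl)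
      · intro p hp q hpq
        rcases hcl p hp q hpq with h | h | h
        · exact .inl h
        · exact .inr (.inl h)
        · rcases Sym2.eq_iff.1 h with h | ⟨rfl, rfl⟩
          · exact .inr (.inr h)
          · exact absurd hp hw
      · refine lt_of_le_of_ne within_le fun h => ?_
        rw [← h] at huw
        rcases huw.2.2 with h | h
        · exact hwy h
        · exact hw h
      · refine lt_of_le_of_ne within_le fun h => ?_
        rw [← h] at huw
        exact huw.2.1 hu
    by_cases h1 : u ∈ Z ∧ w ∉ Z ∧ w ≠ y
    · exact main u w huw h1.1 h1.2.1 h1.2.2 hcl'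
    by_cases h2 : w ∈ Z ∧ u ∉ Z ∧ u ≠ y
    · exact main w u huw.symm h2.1 h2.2.1 h2.2.2 (by simpa [Sym2.eq_swap] using hcl')
    refine .inr ⟨y, Z, hyZ, hAZ, hBZ, fun p hp q hpq => ?_⟩
    rcases hcl' p hp q hpq with h | h | h
    · exact .inl h
    · exact .inr h
    · rcases Sym2.eq_iff.1 h with ⟨rfl, rfl⟩ | ⟨rfl, rfl⟩ <;> tauto
  · push Not at hE
    by_cases hAB : (A ∩ B).Subsingleton
    · right
      have hy : ∃ y, A ∩ B ⊆ {y} := by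
        rcases hAB.eq_empty_or_singleton with h | ⟨y, h⟩
        -- Even if `A` and `B` are disjoint a separating vertex has to be named; any vertex serves.
        · exact ⟨Classical.arbitrary V, by simp [h]⟩
        · exact ⟨y, h.subset⟩
      obtain ⟨y, hy⟩ := hy
      refine ⟨y, A \ {y}, fun h => h.2 rfl, fun a ha => ?_, fun b hb h => h.2 (hy ⟨h.1, hb⟩),
        fun u _ w huw => absurd huw (hE u w)⟩
      by_cases h : a = y
      · exact .inl h
      · exact .inr ⟨ha, h⟩
    · left
      rw [not_subsingleton_iff] at hAB
      obtain ⟨s, hs, t, ht, hst⟩ := hAB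
      exact ⟨{s}, {t}, conn_singleton G s, conn_singleton G t, by simpa using hst,
        ⟨s, rfl, hs.1⟩, ⟨s, rfl, hs.2⟩, ⟨t, rfl, ht.1⟩, ⟨t, rfl, ht.2⟩⟩

/-! ### 2-connected vertex sets, butterflies and partners -/

/-- `G` is a `2`-connected graph with vertex set `X` (up to isolated vertices outside `X`). -/
structure Bicon (G : SimpleGraph V) (X : Set V) : Prop where
  three_le : 3 ≤ X.ncard
  mem_left : ∀ {u w}, G.Adj u w → u ∈ X
  conn_diff : ∀ c, Conn G (X \ {c})

theorem Bicon.mem_right (hG : Bicon G X) (h : G.Adj u w) : w ∈ X := hG.mem_left h.symm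

/-- There are two disjoint connected sets avoiding `h`, each with two neighbours of `h`. -/
def Butterfly (G : SimpleGraph V) (h : V) : Prop :=
  ∃ P Q : Set V, Conn G P ∧ Conn G Q ∧ Disjoint P Q ∧ h ∉ P ∧ h ∉ Q ∧
    (∃ a ∈ P, ∃ b ∈ P, a ≠ b ∧ G.Adj h a ∧ G.Adj h b) ∧
    (∃ c ∈ Q, ∃ d ∈ Q, c ≠ d ∧ G.Adj h c ∧ G.Adj h d)

/-- Every component of `G - h - y` contains at most one neighbour of `h`. -/
def Partner (G : SimpleGraph V) (h y : V) : Prop :=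
  ∀ p q, G.Adj h p → G.Adj h q → p ≠ q → p ≠ y → q ≠ y →
    ∃ Z, ClosedUpTo G {h, y} Z ∧ p ∈ Z ∧ q ∉ Z

/-- Every vertex of degree at least four has a partner. -/
def HasPartners (G : SimpleGraph V) : Prop :=
  ∀ h, 4 ≤ (G.neighborSet h).ncard → ∃ y, y ≠ h ∧ Partner G h y

theorem exists_four_of_ncard (h : 4 ≤ S.ncard) : ∃ a ∈ S, ∃ b ∈ S, ∃ c ∈ S, ∃ d ∈ S,
    a ≠ b ∧ a ≠ c ∧ a ≠ d ∧ b ≠ c ∧ b ≠ d ∧ c ≠ d := by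
  obtain ⟨T, hTS, hT⟩ := exists_subset_card_eq h
  obtain ⟨a, b, c, d, hab, hac, had, hbc, hbd, hcd, rfl⟩ := Set.ncard_eq_four.1 hT
  refine ⟨a, hTS ?_, b, hTS ?_, c, hTS ?_, d, hTS ?_, hab, hac, had, hbc, hbd, hcd⟩ <;> simp

/-- In `G - h` the component of `p` can be left only towards `y`. A part of the rest that is closed
and misses `y` would therefore be closed in the connected graph `G - h`; so a closed part and its
complement would both contain `y`. -/
theorem Bicon.conn_diff_comp (hG : Bicon G X) (hyX : y ∈ X) (hyh : y ≠ h) (hp : p ∈ X)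
    (hph : p ≠ h) (hpy : p ≠ y) : Conn G ((X \ {h}) \ comp G {h, y} p) := by
  set D := comp G {h, y} p with hD
  have hpS : p ∉ ({h, y} : Set V) := by simp [hph, hpy]
  have hDcl : ClosedUpTo G {h, y} D := closedUpTo_comp hpS
  have key : ∀ Z : Set V, (∃ u ∈ (X \ {h}) \ D, u ∈ Z) →
      (∀ u ∈ (X \ {h}) \ D, u ∈ Z → ∀ w ∈ (X \ {h}) \ D, G.Adj u w → w ∈ Z) → y ∈ Z := by
    rintro Z ⟨u, hu, huZ⟩ hcl
    by_contra hyZ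
    have := hG.conn_diff h (((X \ {h}) \ D) ∩ Z) ⟨u, hu.1, hu, huZ⟩ ?_ ⟨hp, hph⟩
    · exact this.1.2 mem_comp_self
    · rintro a ha ⟨ha', haZ⟩ b hb hab
      have hbD : b ∉ D := by
        intro hbD
        rcases hDcl.2 b hbD a hab.symm with h | rfl | rfl
        · exact ha'.2 h
        · exact ha.2 rfl
        · exact hyZ haZ
      exact ⟨⟨hb, hbD⟩, hcl a ha' haZ b ⟨hb, hbD⟩ hab⟩
  intro Z hne hcl w hw
  by_contra hwZ
  exact key Zᶜ ⟨w, hw, hwZ⟩ (fun a ha haZ b hb hab hbZ => haZ (hcl b hb hbZ a ha hab.symm))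
    (key Z hne hcl)

/-- A `2`-connected graph without butterflies has partners. -/
theorem Bicon.hasPartners [Finite V] (hG : Bicon G X) (hb : ∀ h, ¬ Butterfly G h) :
    HasPartners G := by
  intro h hdeg
  obtain ⟨a, ha, b, hb', c, hc, d, hd, hab, hac, had, hbc, hbd, hcd⟩ := exists_four_of_ncard hdeg
  simp only [SimpleGraph.mem_neighborSet] at ha hb' hc hd
  have : Nonempty V := ⟨h⟩
  -- Two disjoint connections in `G - h` form a butterfly, as each contains one neighbour of `h`
  -- from either pair. Hence one vertex separates the pairs.
  rcases twoLinked_or_oneSeparated (within G {h}ᶜ) {a, b} {c, d} with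
    ⟨P, Q, hP, hQ, hPQ, ⟨p, hp, hp'⟩, ⟨p', hp₁, hp₁'⟩, ⟨q, hq, hq'⟩, ⟨q', hq₁, hq₁'⟩⟩ |
    ⟨y, Z, hyZ, hA, hB, hcl⟩
  · exfalso
    have adj : ∀ z, z ∈ ({a, b} : Set V) ∨ z ∈ ({c, d} : Set V) → G.Adj h z := by
      rintro z ((rfl | rfl) | (rfl | rfl)) <;> assumption
    have ne : ∀ z ∈ ({a, b} : Set V), ∀ w ∈ ({c, d} : Set V), z ≠ w := by
      rintro z (rfl | rfl) w (rfl | rfl) <;> assumption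
    have notMem : ∀ {R : Set V} {z}, Conn (within G {h}ᶜ) R → z ∈ R → G.Adj h z → h ∉ R :=
      fun hR hz hhz hh => hR.subset_of_within hz hhz.ne' hh rfl
    exact hb h ⟨P, Q, hP.mono fun _ _ _ _ h => h.1, hQ.mono fun _ _ _ _ h => h.1, hPQ,
      notMem hP hp (adj p (.inl hp')), notMem hQ hq (adj q (.inl hq')),
      ⟨p, hp, p', hp₁, ne p hp' p' hp₁', adj p (.inl hp'), adj p' (.inr hp₁')⟩,
      ⟨q, hq, q', hq₁, ne q hq' q' hq₁', adj q (.inl hq'), adj q' (.inr hq₁')⟩⟩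
  have hcl' : ∀ u ∈ Z, ∀ w, G.Adj u w → u ≠ h → w ≠ h → w ∈ Z ∨ w = y :=
    fun u hu w huw huh hwh => hcl u hu w ⟨huw, huh, hwh⟩
  have haZ : a ∈ Z ∨ a = y := (hA (.inl rfl)).symm
  have hbZ : b ∈ Z ∨ b = y := (hA (.inr rfl)).symm
  have hcZ : c ∉ Z := hB c (.inl rfl)
  have hdZ : d ∉ Z := hB d (.inr rfl)
  -- If the separator were `h` itself, or a vertex outside `X`, then `Z` would be closed in `G - h`,
  -- which is connected.
  have hyh : y ≠ h := by
    rintro rfl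
    refine hcZ (hG.conn_diff y Z ⟨a, ⟨hG.mem_right ha, ha.ne'⟩, haZ.resolve_right ha.ne'⟩ ?_
      ⟨hG.mem_right hc, hc.ne'⟩)
    intro u hu huZ w hw huw
    exact (hcl' u huZ w huw hu.2 hw.2).resolve_right hw.2
  have hyX : y ∈ X := by
    by_contra hyX
    refine hcZ (hG.conn_diff h Z ⟨a, ⟨hG.mem_right ha, ha.ne'⟩, haZ.resolve_right ?_⟩ ?_
      ⟨hG.mem_right hc, hc.ne'⟩)
    · rintro rfl
      exact hyX (hG.mem_right ha)
    · intro u hu huZ w hw huw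
      refine (hcl' u huZ w huw hu.2 hw.2).resolve_right ?_
      rintro rfl
      exact hyX hw.1
  refine ⟨y, hyh, fun p q hhp hhq hpq hpy hqy => ?_⟩
  by_contra hcon
  push Not at hcon
  set D := comp G {h, y} p with hD
  have hpS : p ∉ ({h, y} : Set V) := by simp [hhp.ne', hpy]
  have hDcl : ClosedUpTo G {h, y} D := closedUpTo_comp hpS
  have hDconn : Conn G D := conn_comp hpS
  have hqD : q ∈ D := fun Z hZ hpZ => hcon Z hZ hpZ
  have hhD : h ∉ D := fun hh => hDcl.1 h hh (.inl rfl)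
  have hyD : y ∉ D := fun hh => hDcl.1 y hh (.inr rfl)
  have hQ := hG.conn_diff_comp hyX hyh (hG.mem_right hhp) hhp.ne' hpy
  -- With `p` and `q` in the same component `D`, the sets `D` and `X \ {h} \ D` are the wings of a
  -- butterfly as soon as two neighbours of `h` lie outside `D`.
  have fin : ∀ r s, G.Adj h r → G.Adj h s → r ≠ s → r ∉ D → s ∉ D → False := by
    intro r s hr hs hrs hrD hsD
    exact hb h ⟨D, _, hDconn, hQ, disjoint_sdiff_right, hhD, fun hh => hh.1.2 rfl,
      ⟨p, mem_comp_self, q, hqD, hpq, hhp, hhq⟩,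
      ⟨r, ⟨⟨hG.mem_right hr, hr.ne'⟩, hrD⟩, s, ⟨⟨hG.mem_right hs, hs.ne'⟩, hsD⟩, hrs, hr, hs⟩⟩
  -- `D` avoids the separator, so it lies on one side of it and misses one of the pairs `{a, b}` and
  -- `{c, d}`.
  have hDZ := hDconn.subset_or_disjoint (Z := Z) (by
    intro u hu huZ w hw huw
    refine (hcl' u huZ w huw ?_ ?_).resolve_right ?_
    · rintro rfl; exact hhD hu
    · rintro rfl; exact hhD hw
    · rintro rfl; exact hyD hw)
  rcases hDZ with hsub | hdis
  · exact fin c d hc hd hcd (fun h => hcZ (hsub h)) (fun h => hdZ (hsub h))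
  · refine fin a b ha hb' hab ?_ ?_
    · intro h
      rcases haZ with h' | rfl
      · exact hdis a h h'
      · exact hyD h
    · intro h
      rcases hbZ with h' | rfl
      · exact hdis b h h'
      · exact hyD h

end GemSPQR

namespace GemSPQR
open Set

universe u

variable {V : Type u} {G H : SimpleGraph V} {S X Y Y' Z A B : Set V} {a b c d h p q u v w x y z : V}

/-! ### Suppressing a vertex of degree two -/

/-- The graph obtained by deleting `v` and adding the edge `ab`. -/
def suppress (G : SimpleGraph V) (v a b : V) : SimpleGraph V where
  Adj p q := (G.Adj p q ∧ p ≠ v ∧ q ≠ v) ∨ (a ≠ b ∧ ((p = a ∧ q = b) ∨ (p = b ∧ q = a)))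
  symm := ⟨by
    rintro p q (h | h)
    · exact .inl ⟨h.1.symm, h.2.2, h.2.1⟩
    · exact .inr (by tauto)⟩
  loopless := ⟨by
    rintro p (h | ⟨h, ⟨rfl, h'⟩ | ⟨rfl, h'⟩⟩)
    · exact G.irrefl h.1
    · exact h h'
    · exact h h'.symm⟩

/-- With a single neighbour, `v` would be cut off from a third vertex by deleting that neighbour. -/
theorem Bicon.ne_of_adj_iff (hG : Bicon G X) (hv : v ∈ X) (hN : ∀ w, G.Adj v w ↔ w = a ∨ w = b) :
    a ≠ b := by
  rintro rfl
  have hav : G.Adj v a := (hN a).2 (.inl rfl)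
  obtain ⟨w, hw, hw'⟩ : ∃ w ∈ X, w ∉ ({v, a} : Set V) := by
    refine exists_mem_notMem_of_ncard_lt_ncard ?_ ?_
    · have := hG.three_le
      have := ncard_pair hav.ne
      omega
    · exact toFinite _
  have := hG.conn_diff a {v} ⟨v, ⟨hv, hav.ne⟩, rfl⟩ (by
    rintro u hu rfl z hz huz
    have := (hN z).1 huz
    exact absurd (by tauto) hz.2) (show w ∈ X \ {a} from ⟨hw, fun h => hw' (.inr h)⟩)
  exact hw' (.inl this)

/-- Nonadjacency of `a` and `b` guarantees that three vertices remain: were `X = {v, a, b}`, the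
graph `G - v` would be disconnected. Connectivity is pulled back by letting `v` follow its
neighbours. -/
theorem bicon_suppress [Finite V] (hG : Bicon G X) (hv : v ∈ X)
    (hN : ∀ w, G.Adj v w ↔ w = a ∨ w = b) (hab : ¬ G.Adj a b) :
    Bicon (suppress G v a b) (X \ {v}) := by
  have hne := hG.ne_of_adj_iff hv hN
  have hva : G.Adj v a := (hN a).2 (.inl rfl)
  have hvb : G.Adj v b := (hN b).2 (.inr rfl)
  have haX := hG.mem_right hva
  have hbX := hG.mem_right hvb
  refine ⟨?_, ?_, ?_⟩
  · by_contra hcard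
    have h2 : (X \ {v}) ⊆ {a, b} := by
      have hs : ({a, b} : Set V) ⊆ X \ {v} := by
        rintro z (rfl | rfl)
        exacts [⟨haX, hva.ne'⟩, ⟨hbX, hvb.ne'⟩]
      refine (Set.eq_of_subset_of_ncard_le hs ?_ (toFinite _)).symm.subset
      rw [ncard_pair hne]
      omega
    have := hG.conn_diff v {a} ⟨a, ⟨haX, hva.ne'⟩, rfl⟩ (by
      rintro u hu rfl w hw huw
      rcases h2 hw with rfl | rfl
      · rfl
      · exact absurd huw hab) (show b ∈ X \ {v} from ⟨hbX, hvb.ne'⟩)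
    exact hne.symm this
  · rintro u w (h | ⟨_, ⟨rfl, rfl⟩ | ⟨rfl, rfl⟩⟩)
    · exact ⟨hG.mem_left h.1, h.2.1⟩
    · exact ⟨haX, hva.ne'⟩
    · exact ⟨hbX, hvb.ne'⟩
  · intro c Z hne' hcl
    have hnb : (suppress G v a b).Adj a b := .inr ⟨hne, .inl ⟨rfl, rfl⟩⟩
    have haa : a ≠ c → a ∈ ((X \ {v}) \ {c} : Set V) := fun h => ⟨⟨haX, hva.ne'⟩, h⟩
    have hbb : b ≠ c → b ∈ ((X \ {v}) \ {c} : Set V) := fun h => ⟨⟨hbX, hvb.ne'⟩, h⟩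
    have hiff : a ≠ c → b ≠ c → (a ∈ Z ↔ b ∈ Z) := fun h h' =>
      ⟨fun hz => hcl a (haa h) hz b (hbb h') hnb, fun hz => hcl b (hbb h') hz a (haa h) hnb.symm⟩
    obtain ⟨u, hu, huZ⟩ := hne'
    -- `v` is put on the side of any neighbour that survives the deletion of `c`; if both survive
    -- they are on the same side because of the new edge `ab`.
    have := hG.conn_diff c {z | (z ≠ v ∧ z ∈ Z) ∨ (z = v ∧ ((a ∈ Z ∧ a ≠ c) ∨ (b ∈ Z ∧ b ≠ c)))}
      ⟨u, ⟨hu.1.1, hu.2⟩, .inl ⟨hu.1.2, huZ⟩⟩ ?_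
    · intro z hz
      rcases this ⟨hz.1.1, hz.2⟩ with h | h
      · exact h.2
      · exact absurd h.1 hz.1.2
    · rintro z ⟨hz, hzc⟩ hzZ w ⟨hw, hwc⟩ hzw
      simp only [mem_ofPred_eq, mem_singleton_iff] at hzZ hzc hwc ⊢
      by_cases hwv : w = v
      · subst hwv
        refine .inr ⟨rfl, ?_⟩
        rcases hzZ with h | h
        · rcases (hN z).1 hzw.symm with rfl | rfl
          · exact .inl ⟨h.2, hzc⟩
          · exact .inr ⟨h.2, hzc⟩
        · exact h.2
      · refine .inl ⟨hwv, ?_⟩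
        rcases hzZ with h | ⟨rfl, h⟩
        · exact hcl z ⟨⟨hz, h.1⟩, hzc⟩ h.2 w ⟨⟨hw, hwv⟩, hwc⟩ (.inl ⟨hzw, h.1, hwv⟩)
        · rcases (hN w).1 hzw with rfl | rfl
          · rcases h with h | h
            · exact h.1
            · exact (hiff hwc h.2).2 h.1
          · rcases h with h | h
            · exact (hiff h.2 hwc).1 h.1
            · exact h.1

theorem ncard_neighborSet_le_of_injOn [Finite V] (f : V → V)
    (hf : ∀ z, G.Adj h z → H.Adj x (f z))
    (hinj : ∀ z, G.Adj h z → ∀ z', G.Adj h z' → f z = f z' → z = z') :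
    (G.neighborSet h).ncard ≤ (H.neighborSet x).ncard := by
  refine ncard_le_ncard_of_injOn f (fun z hz => hf z hz) ?_ (toFinite _)
  intro z hz z' hz' e
  exact hinj z hz z' hz' e

/-- At `a` the neighbour `v` is traded for `b`, and at `b` for `a`. No two neighbours are merged,
since `ab` is not an edge of `G`. -/
theorem ncard_neighborSet_suppress [Finite V] (hN : ∀ w, G.Adj v w ↔ w = a ∨ w = b)
    (hne : a ≠ b) (hab : ¬ G.Adj a b) (hhv : h ≠ v) :
    ((suppress G v a b).neighborSet h).ncard = (G.neighborSet h).ncard := by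
  classical
  have hva : G.Adj v a := (hN a).2 (.inl rfl)
  have hvb : G.Adj v b := (hN b).2 (.inr rfl)
  have hvv : ∀ z, G.Adj h z → z = v → h = a ∨ h = b := fun z hz hzv => (hN h).1 (hzv ▸ hz.symm)
  have hba : ¬ G.Adj b a := fun h => hab h.symm
  refine le_antisymm ?_ ?_
  · refine ncard_neighborSet_le_of_injOn
      (fun z => if (h = a ∧ z = b) ∨ (h = b ∧ z = a) then v else z) ?_ ?_
    · rintro z (hz | ⟨_, ⟨rfl, rfl⟩ | ⟨rfl, rfl⟩⟩)
      · rw [if_neg]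
        · exact hz.1
        · rintro (⟨rfl, rfl⟩ | ⟨rfl, rfl⟩)
          exacts [hab hz.1, hba hz.1]
      · simpa using hva.symm
      · simpa using hvb.symm
    · rintro z hz z' hz'
      have key : ∀ z, (suppress G v a b).Adj h z → z ≠ v := by
        rintro z (hz | ⟨_, ⟨rfl, rfl⟩ | ⟨rfl, rfl⟩⟩)
        exacts [hz.2.2, hvb.ne', hva.ne']
      have h1 := key z hz
      have h2 := key z' hz'
      split_ifs <;> grind
  · refine ncard_neighborSet_le_of_injOn
      (fun z => if z = v then (if h = a then b else a) else z) ?_ ?_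
    · intro z hz
      by_cases hzv : z = v
      · rcases hvv z hz hzv with rfl | rfl
        · simp only [hzv, if_true]
          exact .inr ⟨hne, .inl ⟨rfl, rfl⟩⟩
        · simp only [hzv, if_true, if_neg hne.symm]
          exact .inr ⟨hne, .inr ⟨rfl, rfl⟩⟩
      · simp only [hzv, if_false]
        exact .inl ⟨hz, hhv, hzv⟩
    · intro z hz z' hz'
      have := hvv z hz
      have := hvv z' hz'
      split_ifs <;> grind [SimpleGraph.irrefl]

/-- A partner of `h` other than `v` remains a partner: a neighbour gained through `v` lies on the
same side as `v`. If the partner is `v`, a neighbour of `v` different from `h` takes over, namely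
`b` if `h = a`, and `a` otherwise. -/
theorem hasPartners_suppress [Finite V] (hG : HasPartners G)
    (hN : ∀ w, G.Adj v w ↔ w = a ∨ w = b) (hne : a ≠ b) (hab : ¬ G.Adj a b) :
    HasPartners (suppress G v a b) := by
  have hva : G.Adj v a := (hN a).2 (.inl rfl)
  have hvb : G.Adj v b := (hN b).2 (.inr rfl)
  intro h hdeg
  have hhv : h ≠ v := by
    rintro rfl
    have : (suppress G h a b).neighborSet h = ∅ := by
      ext z
      simp only [SimpleGraph.mem_neighborSet, mem_empty_iff_false, iff_false]
      rintro (h | ⟨_, ⟨h, _⟩ | ⟨h, _⟩⟩)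
      · exact h.2.1 rfl
      · exact hva.ne h
      · exact hvb.ne h
    rw [this, ncard_empty] at hdeg
    omega
  rw [ncard_neighborSet_suppress hN hne hab hhv] at hdeg
  obtain ⟨y, hyh, hy⟩ := hG h hdeg
  by_cases hyv : y = v
  · subst hyv
    by_cases hha : h = a
    · subst hha
      refine ⟨b, hne.symm, fun p q hp hq hpq hpb hqb => ?_⟩
      have hp' : G.Adj h p ∧ p ≠ y := by
        rcases hp with hp | ⟨_, ⟨_, e⟩ | ⟨e, _⟩⟩
        exacts [⟨hp.1, hp.2.2⟩, absurd e hpb, absurd e hne]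
      have hq' : G.Adj h q ∧ q ≠ y := by
        rcases hq with hq | ⟨_, ⟨_, e⟩ | ⟨e, _⟩⟩
        exacts [⟨hq.1, hq.2.2⟩, absurd e hqb, absurd e hne]
      obtain ⟨Z, hZ, hpZ, hqZ⟩ := hy p q hp'.1 hq'.1 hpq hp'.2 hq'.2
      refine ⟨Z \ {b}, ⟨?_, ?_⟩, ⟨hpZ, hpb⟩, fun h => hqZ h.1⟩
      · rintro u hu (rfl | rfl)
        · exact hZ.1 u hu.1 (.inl rfl)
        · exact hu.2 rfl
      · rintro u hu w (⟨huw, _, hw⟩ | ⟨_, ⟨_, rfl⟩ | ⟨rfl, rfl⟩⟩)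
        · by_cases hwb : w = b
          · exact .inr (.inr hwb)
          · rcases hZ.2 u hu.1 w huw with h | rfl | rfl
            · exact .inl ⟨h, hwb⟩
            · exact .inr (.inl rfl)
            · exact absurd rfl hw
        · exact .inr (.inr rfl)
        · exact .inr (.inl rfl)
    · refine ⟨a, Ne.symm hha, fun p q hp hq hpq hpa hqa => ?_⟩
      have aux : ∀ p, (suppress G y a b).Adj h p → p ≠ a → G.Adj h p ∧ p ≠ y := by
        rintro p (hp | ⟨_, ⟨e, _⟩ | ⟨_, e⟩⟩) hpa
        exacts [⟨hp.1, hp.2.2⟩, absurd e hha, absurd e hpa]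
      obtain ⟨hp1, hp2⟩ := aux p hp hpa
      obtain ⟨hq1, hq2⟩ := aux q hq hqa
      obtain ⟨Z, hZ, hpZ, hqZ⟩ := hy p q hp1 hq1 hpq hp2 hq2
      refine ⟨Z \ {a}, ⟨?_, ?_⟩, ⟨hpZ, hpa⟩, fun h => hqZ h.1⟩
      · rintro u hu (rfl | rfl)
        · exact hZ.1 u hu.1 (.inl rfl)
        · exact hu.2 rfl
      · rintro u hu w (⟨huw, _, hw⟩ | ⟨_, ⟨rfl, rfl⟩ | ⟨rfl, rfl⟩⟩)
        · by_cases hwa : w = a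
          · exact .inr (.inr hwa)
          · rcases hZ.2 u hu.1 w huw with h | rfl | rfl
            · exact .inl ⟨h, hwa⟩
            · exact .inr (.inl rfl)
            · exact absurd rfl hw
        · exact absurd rfl hu.2
        · exact .inr (.inr rfl)
  · refine ⟨y, hyh, fun p q hp hq hpq hpy hqy => ?_⟩
    have lift : ∀ p, (suppress G v a b).Adj h p → (G.Adj h p ∧ p ≠ v) ∨
        (G.Adj h v ∧ G.Adj v p) := by
      rintro p (hp | ⟨_, ⟨rfl, rfl⟩ | ⟨rfl, rfl⟩⟩)
      · exact .inl ⟨hp.1, hp.2.2⟩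
      · exact .inr ⟨hva.symm, hvb⟩
      · exact .inr ⟨hvb.symm, hva⟩
    have hph : p ≠ h := hp.ne'
    have hqh : q ≠ h := hq.ne'
    have pv : ∀ p, (suppress G v a b).Adj h p → p ≠ v := by
      rintro p (hp | ⟨_, ⟨rfl, rfl⟩ | ⟨rfl, rfl⟩⟩)
      exacts [hp.2.2, hvb.ne', hva.ne']
    have sep : ∃ Z, ClosedUpTo G {h, y} Z ∧ p ∈ Z ∧ q ∉ Z := by
      rcases lift p hp with hp' | hp'
      · rcases lift q hq with hq' | hq'
        · exact hy p q hp'.1 hq'.1 hpq hpy hqy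
        · obtain ⟨Z, hZ, hpZ, hvZ⟩ := hy p v hp'.1 hq'.1 hp'.2 hpy (Ne.symm hyv)
          refine ⟨Z, hZ, hpZ, fun hqZ => ?_⟩
          rcases hZ.2 q hqZ v hq'.2.symm with h | rfl | rfl
          exacts [hvZ h, hhv rfl, hyv rfl]
      · rcases lift q hq with hq' | hq'
        · obtain ⟨Z, hZ, hvZ, hqZ⟩ := hy v q hp'.1 hq'.1 hq'.2.symm (Ne.symm hyv) hqy
          refine ⟨Z, hZ, ?_, hqZ⟩
          rcases hZ.2 v hvZ p hp'.2 with h | rfl | rfl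
          exacts [h, absurd rfl hph, absurd rfl hpy]
        · exfalso
          rcases hp with h1 | ⟨_, ⟨rfl, rfl⟩ | ⟨rfl, rfl⟩⟩
          · rcases (hN p).1 hp'.2 with rfl | rfl <;> rcases (hN h).1 hp'.1.symm with rfl | rfl
            exacts [hph rfl, hab h1.1.symm, hab h1.1, hph rfl]
          · rcases (hN q).1 hq'.2 with rfl | rfl
            exacts [hqh rfl, hpq rfl]
          · rcases (hN q).1 hq'.2 with rfl | rfl
            exacts [hpq rfl, hqh rfl]
    obtain ⟨Z, hZ, hpZ, hqZ⟩ := sep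
    refine ⟨Z \ {v}, ⟨fun u hu => hZ.1 u hu.1, ?_⟩, ⟨hpZ, pv p hp⟩, fun h => hqZ h.1⟩
    have through : ∀ u w, u ∈ Z → G.Adj u v → G.Adj v w → w ∈ Z ∨ w ∈ ({h, y} : Set V) := by
      intro u w hu huv hvw
      rcases hZ.2 u hu v huv with h | rfl | rfl
      exacts [hZ.2 v h w hvw, absurd rfl hhv, absurd rfl hyv]
    rintro u hu w (⟨huw, _, hw⟩ | ⟨_, ⟨rfl, rfl⟩ | ⟨rfl, rfl⟩⟩)
    · rcases hZ.2 u hu.1 w huw with h | h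
      exacts [.inl ⟨h, hw⟩, .inr h]
    · rcases through u w hu.1 hva.symm hvb with h | h
      exacts [.inl ⟨h, hvb.ne'⟩, .inr h]
    · rcases through u w hu.1 hvb.symm hva with h | h
      exacts [.inl ⟨h, hva.ne'⟩, .inr h]

end GemSPQR

namespace GemSPQR
open Set

universe u

variable {V : Type u} {G H : SimpleGraph V} {S X Y Y' Z A B : Set V}
  {a b c d h p q u v w x y z x' y' : V}

/-! ### Contracting one side of an edge cut of size two -/

/-- The edges from `A` to its complement are `xx'` and `yy'`, and these are disjoint. -/
structure TwoCut (G : SimpleGraph V) (A : Set V) (x y x' y' : V) : Prop where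
  ne : x ≠ y
  ne' : x' ≠ y'
  x_mem : x ∈ A
  y_mem : y ∈ A
  x'_notMem : x' ∉ A
  y'_notMem : y' ∉ A
  adj_x : G.Adj x x'
  adj_y : G.Adj y y'
  eq_or : ∀ u ∈ A, ∀ w, w ∉ A → G.Adj u w → (u = x ∧ w = x') ∨ (u = y ∧ w = y')

/-- The edges from `A` to its complement. -/
def cutEdges (G : SimpleGraph V) (A : Set V) : Set (V × V) :=
  {e | e.1 ∈ A ∧ e.2 ∉ A ∧ G.Adj e.1 e.2}

theorem TwoCut.swap (h : TwoCut G A x y x' y') : TwoCut G A y x y' x' :=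
  ⟨h.ne.symm, h.ne'.symm, h.y_mem, h.x_mem, h.y'_notMem, h.x'_notMem, h.adj_y, h.adj_x,
    fun u hu w hw huw => (h.eq_or u hu w hw huw).symm⟩

/-- No vertex meets all edges of the cut, since deleting it would separate the remaining vertices of
the two sides. Hence there are exactly two edges, and they are disjoint. -/
theorem Bicon.exists_twoCut [Finite V] (hG : Bicon G X) (hA : A ⊆ X) (hA2 : 2 ≤ A.ncard)
    (hB2 : 2 ≤ (X \ A).ncard) (hcut : (cutEdges G A).ncard ≤ 2) :
    ∃ x y x' y', TwoCut G A x y x' y' := by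
  obtain ⟨s, hs, t, ht, hst⟩ := (one_lt_ncard (toFinite A)).1 hA2
  obtain ⟨s', hs', t', ht', hst'⟩ := (one_lt_ncard (toFinite (X \ A))).1 hB2
  have leave : ∀ c, ∃ x x', x ≠ c ∧ x' ≠ c ∧ x ∈ A ∧ x' ∉ A ∧ G.Adj x x' := by
    intro c
    obtain ⟨r, hr, hrc⟩ : ∃ r ∈ A, r ≠ c := by
      by_cases h : s = c
      · exact ⟨t, ht, fun h' => hst (h.trans h'.symm)⟩
      · exact ⟨s, hs, h⟩
    obtain ⟨r', hr', hrc'⟩ : ∃ r ∈ X \ A, r ≠ c := by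
      by_cases h : s' = c
      · exact ⟨t', ht', fun h' => hst' (h.trans h'.symm)⟩
      · exact ⟨s', hs', h⟩
    obtain ⟨a, b, ha, haA, hb, hbA, hab⟩ := (hG.conn_diff c).exists_adj ⟨hA hr, hrc⟩ hr
      ⟨hr'.1, hrc'⟩ hr'.2
    exact ⟨a, b, ha.2, hb.2, haA, hbA, hab⟩
  obtain ⟨x, x', -, -, hx, hx', hxx⟩ := leave s
  obtain ⟨y, y', hyx, -, hy, hy', hyy⟩ := leave x
  -- There is no room for a third edge, so the crossing edge that avoids `x'` is `yy'`.
  obtain ⟨z, z', -, hzx, hz, hz', hzz⟩ := leave x'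
  have hsub : {(x, x'), (y, y')} ⊆ cutEdges G A := by
    rintro e (rfl | rfl)
    exacts [⟨hx, hx', hxx⟩, ⟨hy, hy', hyy⟩]
  have heq : {(x, x'), (y, y')} = cutEdges G A := by
    refine eq_of_subset_of_ncard_le hsub ?_ (toFinite _)
    rw [ncard_pair]
    · exact hcut
    · intro h
      exact hyx (congrArg Prod.fst h).symm
  have heq_or : ∀ u ∈ A, ∀ w, w ∉ A → G.Adj u w → (u = x ∧ w = x') ∨ (u = y ∧ w = y') := by
    intro u hu w hw huw
    have : (u, w) ∈ cutEdges G A := ⟨hu, hw, huw⟩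
    rw [← heq] at this
    simpa using this
  refine ⟨x, y, x', y', hyx.symm, ?_, hx, hy, hx', hy', hxx, hyy, heq_or⟩
  rcases heq_or z hz z' hz' hzz with ⟨_, h⟩ | ⟨_, h⟩
  · exact absurd h hzx
  · exact fun h' => hzx (h.trans h'.symm)

/-- A closed part of `A` that misses `x` or `y` has at most one edge out of `A`; deleting the outer
end of that edge would separate it in `G`. Of a closed part and its complement, one misses `x` or
`y`. -/
theorem TwoCut.conn (hc : TwoCut G A x y x' y') (hG : Bicon G X) (hA : A ⊆ X) : Conn G A := by
  have key : ∀ Z : Set V, (∃ u ∈ A, u ∈ Z) → (∀ u ∈ A, u ∈ Z → ∀ w ∈ A, G.Adj u w → w ∈ Z) →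
      ¬ (x ∈ Z ∧ y ∈ Z) → A ⊆ Z := by
    rintro Z ⟨r, hr, hrZ⟩ hcl hxy
    obtain ⟨c, hcA, hcx, hcy⟩ : ∃ c, c ∉ A ∧ (x ∈ Z → x' = c) ∧ (y ∈ Z → y' = c) := by
      by_cases hx : x ∈ Z
      · exact ⟨x', hc.x'_notMem, fun _ => rfl, fun hy => absurd ⟨hx, hy⟩ hxy⟩
      · exact ⟨y', hc.y'_notMem, fun h => absurd h hx, fun _ => rfl⟩
    have := hG.conn_diff c (A ∩ Z) ⟨r, ⟨hA hr, fun h => hcA (h ▸ hr)⟩, hr, hrZ⟩ (by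
      rintro s hs ⟨hsA, hsZ⟩ w hw hsw
      by_cases hwA : w ∈ A
      · exact ⟨hwA, hcl s hsA hsZ w hwA hsw⟩
      · rcases hc.eq_or s hsA w hwA hsw with ⟨rfl, rfl⟩ | ⟨rfl, rfl⟩
        · exact absurd (hcx hsZ) hw.2
        · exact absurd (hcy hsZ) hw.2)
    exact fun s hs => (this ⟨hA hs, fun h => hcA (h ▸ hs)⟩).2
  intro Z hne hcl w hw
  by_contra hwZ
  have hxy : x ∈ Z ∧ y ∈ Z := by
    by_contra h
    exact hwZ (key Z hne hcl h hw)
  exact key Zᶜ ⟨w, hw, hwZ⟩ (fun a ha haZ b hb hab hbZ => haZ (hcl b hb hbZ a ha hab.symm))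
    (fun h => h.1 hxy.1) hc.x_mem hxy.1

theorem TwoCut.conn_compl (hc : TwoCut G A x y x' y') (hG : Bicon G X) (hA : A ⊆ X) :
    Conn G (X \ A) := by
  have hx'X : x' ∈ X \ A := ⟨hG.mem_right hc.adj_x, hc.x'_notMem⟩
  have hy'X : y' ∈ X \ A := ⟨hG.mem_right hc.adj_y, hc.y'_notMem⟩
  have hxB : x ∉ X \ A := fun h => h.2 hc.x_mem
  have h2 : TwoCut (within G X) (X \ A) x' y' x y :=
    ⟨hc.ne', hc.ne, hx'X, hy'X, hxB, fun h => h.2 hc.y_mem,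
      ⟨hc.adj_x.symm, hx'X.1, hA hc.x_mem⟩, ⟨hc.adj_y.symm, hy'X.1, hA hc.y_mem⟩,
      fun u hu w hw huw => by
        have hwA : w ∈ A := by
          by_contra h
          exact hw ⟨huw.2.2, h⟩
        have := hc.eq_or w hwA u hu.2 huw.1.symm
        tauto⟩
  have hw : within G X = G := by
    ext p q
    exact ⟨fun h => h.1, fun h => ⟨h, hG.mem_left h, hG.mem_right h⟩⟩
  rw [hw] at h2
  exact h2.conn hG sdiff_subset

/-- The graph obtained by deleting `A \ {x}` and joining `x` to exactly `x'` and `y'`. -/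
def contractSide (G : SimpleGraph V) (A : Set V) (x x' y' : V) : SimpleGraph V where
  Adj p q := p ≠ q ∧ ((G.Adj p q ∧ p ∉ A ∧ q ∉ A) ∨ (p = x ∧ (q = x' ∨ q = y')) ∨
    (q = x ∧ (p = x' ∨ p = y')))
  symm := ⟨fun p q h => ⟨h.1.symm, by
    rcases h.2 with h | h | h
    exacts [.inl ⟨h.1.symm, h.2.2, h.2.1⟩, .inr (.inr h), .inr (.inl h)]⟩⟩
  loopless := ⟨fun p h => h.1 rfl⟩

theorem contractSide_adj (h : (contractSide G A x x' y').Adj p q) :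
    (G.Adj p q ∧ p ∉ A ∧ q ∉ A) ∨ (p = x ∧ q = x') ∨ (p = x ∧ q = y') ∨
      (q = x ∧ p = x') ∨ (q = x ∧ p = y') := by
  have := h.2
  tauto

section contract

variable (hc : TwoCut G A x y x' y')

include hc

theorem TwoCut.adj_of_notMem (hp : p ∉ A) (hq : q ∉ A) :
    (contractSide G A x x' y').Adj p q ↔ G.Adj p q := by
  have h1 : p ≠ x := fun h => hp (h ▸ hc.x_mem)
  have h2 : q ≠ x := fun h => hq (h ▸ hc.x_mem)
  constructor
  · rintro ⟨_, h | h | h⟩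
    exacts [h.1, absurd h.1 h1, absurd h.1 h2]
  · exact fun h => ⟨h.ne, .inl ⟨h, hp, hq⟩⟩

theorem TwoCut.contract_adj_x : (contractSide G A x x' y').Adj x w ↔ w = x' ∨ w = y' := by
  constructor
  · rintro ⟨_, h | h | ⟨rfl, h⟩⟩
    · exact absurd hc.x_mem h.2.1
    · exact h.2
    · exact h
  · intro h
    refine ⟨?_, .inr (.inl ⟨rfl, h⟩)⟩
    rintro rfl
    rcases h with rfl | rfl
    exacts [hc.x'_notMem hc.x_mem, hc.y'_notMem hc.x_mem]

/-- If a vertex outside `A` is deleted, a closed set of the new graph pulls back to `G` by putting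
all of `A` on the side of `x`. If `x` is deleted, the other side of the cut is left, which is
connected by `TwoCut.conn_compl`. -/
theorem TwoCut.bicon_contractSide [Finite V] (hG : Bicon G X) (hA : A ⊆ X)
    (hB2 : 2 ≤ (X \ A).ncard) : Bicon (contractSide G A x x' y') (insert x (X \ A)) := by
  have hx'X : x' ∈ X \ A := ⟨hG.mem_right hc.adj_x, hc.x'_notMem⟩
  have hy'X : y' ∈ X \ A := ⟨hG.mem_right hc.adj_y, hc.y'_notMem⟩
  have hxB : x ∉ X \ A := fun h => h.2 hc.x_mem
  have hcB : Conn G (X \ A) := hc.conn_compl hG hA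
  refine ⟨?_, ?_, ?_⟩
  · rw [ncard_insert_of_notMem hxB (toFinite _)]
    omega
  · intro u w huw
    rcases contractSide_adj huw with h | h | h | h | h
    · exact .inr ⟨hG.mem_left h.1, h.2.1⟩
    · exact .inl h.1
    · exact .inl h.1
    · exact .inr (h.2 ▸ hx'X)
    · exact .inr (h.2 ▸ hy'X)
  · intro c
    by_cases hcx : c = x
    · subst hcx
      rw [insert_sdiff_of_mem _ (mem_singleton _), sdiff_singleton_eq_self hxB]
      exact hcB.mono fun u hu w hw h => (hc.adj_of_notMem hu.2 hw.2).2 h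
    · have hxY : x ∈ insert x (X \ A) \ {c} := ⟨.inl rfl, Ne.symm hcx⟩
      have mem : ∀ z, z ≠ c → z ∈ X \ A → z ∈ insert x (X \ A) \ {c} := fun z h h' => ⟨.inr h', h⟩
      rintro Z ⟨u, hu, huZ⟩ hcl
      by_cases hcA : c ∈ A
      · -- the deleted vertex does not lie in the new graph
        have h2 : Conn (contractSide G A x x' y') (X \ A ∪ {x}) := by
          refine Conn.union_adj (hcB.mono ?_) (conn_singleton _ x) hx'X rfl
            ((hc.contract_adj_x).2 (.inl rfl)).symm
          exact fun u hu w hw h => (hc.adj_of_notMem hu.2 hw.2).2 h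
        have h3 : insert x (X \ A) \ {c} = X \ A ∪ {x} := by
          ext z
          simp only [mem_sdiff, mem_insert_iff, mem_singleton_iff, mem_union]
          constructor
          · tauto
          · rintro (h | h)
            · exact ⟨.inr h, fun e => h.2 (e ▸ hcA)⟩
            · exact ⟨.inl h, fun e => hcx (e.symm.trans h)⟩
        rw [h3] at hu hcl ⊢
        exact h2 Z ⟨u, hu, huZ⟩ hcl
      · have := hG.conn_diff c {z | (z ∈ A ∧ x ∈ Z) ∨ (z ∉ A ∧ z ∈ Z)} ?_ ?_
        · rintro w ⟨rfl | hw, hwc⟩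
          · rcases this ⟨hA hc.x_mem, hwc⟩ with h | h
            exacts [h.2, h.2]
          · rcases this ⟨hw.1, hwc⟩ with h | h
            exacts [absurd h.1 hw.2, h.2]
        · rcases hu with ⟨rfl | hu, huc⟩
          · exact ⟨u, ⟨hA hc.x_mem, huc⟩, .inl ⟨hc.x_mem, huZ⟩⟩
          · exact ⟨u, ⟨hu.1, huc⟩, .inr ⟨hu.2, huZ⟩⟩
        · rintro s ⟨hs, hsc⟩ hsZ w ⟨hw, hwc⟩ hsw
          rcases hsZ with ⟨hsA, hxZ⟩ | ⟨hsA, hsZ⟩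
          · by_cases hwA : w ∈ A
            · exact .inl ⟨hwA, hxZ⟩
            · refine .inr ⟨hwA, hcl x hxY hxZ w (mem w hwc ⟨hw, hwA⟩) (hc.contract_adj_x.2 ?_)⟩
              have := hc.eq_or s hsA w hwA hsw
              tauto
          · by_cases hwA : w ∈ A
            · refine .inl ⟨hwA, hcl s (mem s hsc ⟨hs, hsA⟩) hsZ x hxY (hc.contract_adj_x.2 ?_).symm⟩
              have := hc.eq_or w hwA s hsA hsw.symm
              tauto
            · exact .inr ⟨hwA, hcl s (mem s hsc ⟨hs, hsA⟩) hsZ w (mem w hwc ⟨hw, hwA⟩)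
                ((hc.adj_of_notMem hsA hwA).2 hsw)⟩

theorem TwoCut.contract_adj_right :
    (contractSide G A x x' y').Adj p x ↔ p = x' ∨ p = y' := by
  rw [SimpleGraph.adj_comm, hc.contract_adj_x]

/-- Only `x'` and `y'` have neighbours in `A`, one each because the cut edges are disjoint. At `y'`
the neighbour `y` is renamed `x`. -/
theorem TwoCut.ncard_neighborSet_contractSide [Finite V] (hh : h ∉ A) :
    ((contractSide G A x x' y').neighborSet h).ncard = (G.neighborSet h).ncard := by
  classical
  have hcross : ∀ z ∈ A, G.Adj h z → (z = x ∧ h = x') ∨ (z = y ∧ h = y') :=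
    fun z hz hhz => hc.eq_or z hz h hh hhz.symm
  have hx := hc.x_mem
  have hy := hc.y_mem
  have hne := hc.ne'
  refine le_antisymm ?_ ?_
  · refine ncard_neighborSet_le_of_injOn (fun z => if z = x ∧ h = y' then y else z) ?_ ?_
    · intro z hz
      rcases contractSide_adj hz with h1 | h1 | h1 | ⟨rfl, rfl⟩ | ⟨rfl, rfl⟩
      · rw [if_neg (by rintro ⟨rfl, _⟩; exact h1.2.2 hx)]
        exact h1.1
      · exact absurd (h1.1 ▸ hx) hh
      · exact absurd (h1.1 ▸ hx) hh
      · simpa [hne] using hc.adj_x.symm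
      · simpa using hc.adj_y.symm
    · intro z hz z' hz'
      have key : ∀ z, (contractSide G A x x' y').Adj h z → z ∉ A ∨ z = x := by
        intro z hz
        rcases contractSide_adj hz with h1 | h1 | h1 | h1 | h1
        exacts [.inl h1.2.2, absurd (h1.1 ▸ hx) hh, absurd (h1.1 ▸ hx) hh, .inr h1.1, .inr h1.1]
      have h1 := key z hz
      have h2 := key z' hz'
      split_ifs <;> grind
  · refine ncard_neighborSet_le_of_injOn (fun z => if z ∈ A then x else z) ?_ ?_
    · intro z hz
      by_cases hzA : z ∈ A
      · simp only [hzA, if_true]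
        rw [hc.contract_adj_right]
        have := hcross z hzA hz
        tauto
      · simp only [hzA, if_false]
        exact (hc.adj_of_notMem hh hzA).2 hz
    · intro z hz z' hz'
      have h1 := hcross z
      have h2 := hcross z'
      split_ifs <;> grind

/-- A partner inside `A` is replaced by `x`. A partner outside `A` is kept: as `A` is connected and
avoids `h` and the partner, no separating set splits it. -/
theorem TwoCut.hasPartners_contractSide [Finite V] (hG : Bicon G X) (hA : A ⊆ X)
    (hp : HasPartners G) : HasPartners (contractSide G A x x' y') := by
  intro h hdeg
  have hhx : h ≠ x := by
    rintro rfl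
    have : (contractSide G A h x' y').neighborSet h ⊆ {x', y'} := fun w hw =>
      hc.contract_adj_x.1 hw
    have := (ncard_le_ncard this (toFinite _)).trans (ncard_insert_le _ _)
    rw [ncard_singleton] at this
    omega
  have hhA : h ∉ A := by
    intro hhA
    have : (contractSide G A x x' y').neighborSet h = ∅ := by
      ext z
      simp only [SimpleGraph.mem_neighborSet, mem_empty_iff_false, iff_false]
      intro hz
      rcases contractSide_adj hz with h1 | h1 | h1 | h1 | h1
      exacts [h1.2.1 hhA, hhx h1.1, hhx h1.1, hc.x'_notMem (h1.2 ▸ hhA), hc.y'_notMem (h1.2 ▸ hhA)]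
    rw [this, ncard_empty] at hdeg
    omega
  rw [hc.ncard_neighborSet_contractSide hhA] at hdeg
  obtain ⟨y₀, hy₀h, hy₀⟩ := hp h hdeg
  by_cases hyA : y₀ ∈ A
  · refine ⟨x, hhx.symm, fun p q hp hq hpq hpx hqx => ?_⟩
    have aux : ∀ p, (contractSide G A x x' y').Adj h p → p ≠ x → G.Adj h p ∧ p ∉ A := by
      intro p hp hpx
      rcases contractSide_adj hp with h1 | h1 | h1 | h1 | h1
      exacts [⟨h1.1, h1.2.2⟩, absurd h1.1 hhx, absurd h1.1 hhx, absurd h1.1 hpx, absurd h1.1 hpx]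
    obtain ⟨hp, hpA⟩ := aux p hp hpx
    obtain ⟨hq, hqA⟩ := aux q hq hqx
    obtain ⟨Z, hZ, hpZ, hqZ⟩ := hy₀ p q hp hq hpq (fun h => hpA (h ▸ hyA)) (fun h => hqA (h ▸ hyA))
    refine ⟨Z \ A, ⟨?_, ?_⟩, ⟨hpZ, hpA⟩, fun h => hqZ h.1⟩
    · rintro u hu (rfl | rfl)
      exacts [hZ.1 u hu.1 (.inl rfl), hu.2 hc.x_mem]
    · intro u hu w huw
      rcases contractSide_adj huw with h1 | h1 | h1 | h1 | h1
      · rcases hZ.2 u hu.1 w h1.1 with h2 | rfl | rfl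
        exacts [.inl ⟨h2, h1.2.2⟩, .inr (.inl rfl), absurd hyA h1.2.2]
      · exact absurd (h1.1 ▸ hc.x_mem) hu.2
      · exact absurd (h1.1 ▸ hc.x_mem) hu.2
      · exact .inr (.inr h1.1)
      · exact .inr (.inr h1.1)
  · refine ⟨y₀, hy₀h, fun p q hp hq hpq hpy hqy => ?_⟩
    have notS : ∀ u ∈ A, u ∉ ({h, y₀} : Set V) := by
      rintro u hu (rfl | rfl)
      exacts [hhA hu, hyA hu]
    -- A set closed up to `{h, y₀}` contains all of `A` or none of it.
    have allA : ∀ Z, ClosedUpTo G {h, y₀} Z → ∀ s ∈ A, s ∈ Z → A ⊆ Z := fun Z hZ s hs hsZ =>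
      hc.conn hG hA Z ⟨s, hs, hsZ⟩ fun u _ huZ w hw huw =>
        (hZ.2 u huZ w huw).resolve_right (notS w hw)
    have lift : ∀ p, (contractSide G A x x' y').Adj h p → p ≠ y₀ → (p ∉ A ∧ G.Adj h p) ∨
        (p = x ∧ ∃ s ∈ A, G.Adj h s) := by
      intro p hp _
      rcases contractSide_adj hp with h1 | h1 | h1 | ⟨h1, rfl⟩ | ⟨h1, rfl⟩
      exacts [.inl ⟨h1.2.2, h1.1⟩, absurd h1.1 hhx, absurd h1.1 hhx,
        .inr ⟨h1, x, hc.x_mem, hc.adj_x.symm⟩, .inr ⟨h1, y, hc.y_mem, hc.adj_y.symm⟩]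
    have sep : ∃ Z, ClosedUpTo G {h, y₀} Z ∧ p ∈ Z ∧ q ∉ Z := by
      have ne_y : ∀ s ∈ A, s ≠ y₀ := fun s hs h => hyA (h ▸ hs)
      rcases lift p hp hpy with ⟨hpA, hp'⟩ | ⟨rfl, s, hs, hhs⟩
      · rcases lift q hq hqy with ⟨hqA, hq'⟩ | ⟨rfl, s, hs, hhs⟩
        · exact hy₀ p q hp' hq' hpq hpy hqy
        · obtain ⟨Z, hZ, hpZ, hsZ⟩ := hy₀ p s hp' hhs (fun h => hpA (h ▸ hs)) hpy (ne_y s hs)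
          exact ⟨Z, hZ, hpZ, fun h => hsZ (allA Z hZ _ hc.x_mem h hs)⟩
      · rcases lift q hq hqy with ⟨hqA, hq'⟩ | ⟨rfl, s, hs, hhs⟩
        · obtain ⟨Z, hZ, hsZ, hqZ⟩ := hy₀ s q hhs hq' (fun h => hqA (h ▸ hs)) (ne_y s hs) hqy
          exact ⟨Z, hZ, allA Z hZ s hs hsZ hc.x_mem, hqZ⟩
        · exact absurd rfl hpq
    obtain ⟨Z, hZ, hpZ, hqZ⟩ := sep
    refine ⟨Z, ⟨hZ.1, fun u hu w huw => ?_⟩, hpZ, hqZ⟩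
    have step : ∀ u w, G.Adj u w → u ∈ Z → w ∈ A → A ⊆ Z := fun u w huw hu hw =>
      allA Z hZ w hw ((hZ.2 u hu w huw).resolve_right (notS w hw))
    rcases contractSide_adj huw with h1 | ⟨rfl, rfl⟩ | ⟨rfl, rfl⟩ | ⟨rfl, rfl⟩ | ⟨rfl, rfl⟩
    · exact hZ.2 u hu w h1.1
    · exact hZ.2 u hu w hc.adj_x
    · exact hZ.2 y (allA Z hZ u hc.x_mem hu hc.y_mem) w hc.adj_y
    · exact .inl (step u w hc.adj_x.symm hu hc.x_mem hc.x_mem)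
    · exact .inl (step u y hc.adj_y.symm hu hc.y_mem hc.x_mem)

end contract

end GemSPQR

namespace GemSPQR
open Set

universe u

variable {V : Type u} {G H : SimpleGraph V} {S X Y Y' Z A B : Set V}
  {a b c d h p q u v w x y z x' y' : V}

/-! ### Degrees -/

theorem Bicon.exists_adj_ne [Finite V] (hG : Bicon G X) (hv : v ∈ X) (hcv : c ≠ v) :
    ∃ w, w ≠ c ∧ G.Adj v w := by
  obtain ⟨w, hw, hw'⟩ : ∃ w ∈ X, w ∉ ({v, c} : Set V) := by
    refine exists_mem_notMem_of_ncard_lt_ncard ?_ (toFinite _)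
    have := hG.three_le
    have := ncard_pair hcv.symm
    omega
  simp only [mem_insert_iff, mem_singleton_iff, not_or] at hw'
  obtain ⟨s, t, hs, rfl, ht, -, hst⟩ := (hG.conn_diff c).exists_adj (Z := {v})
    ⟨hv, Ne.symm hcv⟩ rfl ⟨hw, hw'.2⟩ hw'.1
  exact ⟨t, ht.2, hst⟩

theorem Bicon.two_le_degree [Finite V] (hG : Bicon G X) (hv : v ∈ X) :
    2 ≤ (G.neighborSet v).ncard := by
  obtain ⟨c, hc⟩ : ∃ c, c ≠ v := by
    by_contra h
    push Not at h
    have := hG.three_le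
    have h1 : X ⊆ {v} := fun z _ => h z
    have := ncard_le_ncard h1
    rw [ncard_singleton] at this
    omega
  obtain ⟨a, -, ha⟩ := hG.exists_adj_ne hv hc
  obtain ⟨b, hb, hvb⟩ := hG.exists_adj_ne hv ha.ne'
  exact (one_lt_ncard (toFinite _)).2 ⟨a, ha, b, hvb, hb.symm⟩

theorem exists_adj_iff_of_ncard_two (hv : (G.neighborSet v).ncard = 2) :
    ∃ a b, a ≠ b ∧ ∀ w, G.Adj v w ↔ w = a ∨ w = b := by
  obtain ⟨a, b, hab, h⟩ := ncard_eq_two.1 hv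
  exact ⟨a, b, hab, fun w => by simpa using Set.ext_iff.1 h w⟩

theorem ncard_neighborSet_of_adj_iff (hab : a ≠ b) (hN : ∀ w, G.Adj v w ↔ w = a ∨ w = b) :
    (G.neighborSet v).ncard = 2 := by
  have : G.neighborSet v = {a, b} := by
    ext w
    simpa using hN w
  rw [this, ncard_pair hab]

theorem exists_third_of_ncard_three (hv : (G.neighborSet v).ncard = 3) (ha : G.Adj v a)
    (hb : G.Adj v b) (hab : a ≠ b) :
    ∃ c, c ≠ a ∧ c ≠ b ∧ ∀ w, G.Adj v w ↔ w = a ∨ w = b ∨ w = c := by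
  have hfin : (G.neighborSet v).Finite := finite_of_ncard_ne_zero (by omega)
  obtain ⟨c, hc, hc'⟩ : ∃ c ∈ G.neighborSet v, c ∉ ({a, b} : Set V) := by
    refine exists_mem_notMem_of_ncard_lt_ncard ?_ (toFinite _)
    rw [ncard_pair hab]
    omega
  simp only [mem_insert_iff, mem_singleton_iff, not_or] at hc'
  refine ⟨c, hc'.1, hc'.2, ?_⟩
  have : ({a, b, c} : Set V) = G.neighborSet v := by
    refine eq_of_subset_of_ncard_le ?_ ?_ hfin
    · rintro w (rfl | rfl | rfl) <;> assumption
    · rw [hv, ncard_eq_three.2 ⟨a, b, c, hab, Ne.symm hc'.1, Ne.symm hc'.2, rfl⟩]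
  intro w
  rw [← SimpleGraph.mem_neighborSet, ← this]
  simp

theorem ncard_cutEdges_le_two (e f : V × V)
    (h : ∀ u ∈ A, ∀ w, w ∉ A → G.Adj u w → (u, w) = e ∨ (u, w) = f) :
    (cutEdges G A).ncard ≤ 2 := by
  refine (ncard_le_ncard (t := {e, f}) ?_ (toFinite _)).trans
    (ncard_insert_le _ _ |>.trans (by simp))
  rintro ⟨u, w⟩ ⟨hu, hw, huw⟩
  exact h u hu w hw huw

/-! ### Vertices of degree at least four -/

theorem exists_three_adj_ne (hh : 4 ≤ (G.neighborSet h).ncard) (y : V) :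
    ∃ p₁ p₂ p₃, G.Adj h p₁ ∧ G.Adj h p₂ ∧ G.Adj h p₃ ∧
      p₁ ≠ y ∧ p₂ ≠ y ∧ p₃ ≠ y ∧ p₁ ≠ p₂ ∧ p₁ ≠ p₃ ∧ p₂ ≠ p₃ := by
  obtain ⟨n₀, hn₀, n₁, hn₁, n₂, hn₂, n₃, hn₃, h01, h02, h03, h12, h13, h23⟩ :=
    exists_four_of_ncard hh
  simp only [SimpleGraph.mem_neighborSet] at hn₀ hn₁ hn₂ hn₃
  by_cases e1 : n₁ = y
  · exact ⟨n₀, n₂, n₃, hn₀, hn₂, hn₃, by grind, by grind, by grind, h02, h03, h23⟩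
  by_cases e2 : n₂ = y
  · exact ⟨n₀, n₁, n₃, hn₀, hn₁, hn₃, by grind, by grind, by grind, h01, h03, h13⟩
  by_cases e3 : n₃ = y
  · exact ⟨n₀, n₁, n₂, hn₀, hn₁, hn₂, by grind, by grind, by grind, h01, h02, h12⟩
  exact ⟨n₁, n₂, n₃, hn₁, hn₂, hn₃, e1, e2, e3, h12, h13, h23⟩

/-- The structure around a vertex `h` of degree at least four: for some `y`, each component of
`G - h - y` is attached to each of `h` and `y` by a single edge. -/
structure DipoleAt (G : SimpleGraph V) (X : Set V) (h y : V) (r : V → V) : Prop where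
  ne : y ≠ h
  y_mem : y ∈ X
  r_mem : ∀ p, G.Adj h p → p ≠ y → r p ∈ comp G {h, y} p
  adj_r : ∀ p, G.Adj h p → p ≠ y → G.Adj y (r p)
  leave : ∀ p, G.Adj h p → p ≠ y → ∀ u ∈ comp G {h, y} p, ∀ w, w ∉ comp G {h, y} p → G.Adj u w →
    (u = p ∧ w = h) ∨ (u = r p ∧ w = y)
  cover : ∀ u ∈ X, u ≠ h → u ≠ y → ∃ p, G.Adj h p ∧ p ≠ y ∧ u ∈ comp G {h, y} p
  disj : ∀ p q, G.Adj h p → p ≠ y → G.Adj h q → q ≠ y → p ≠ q →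
    Disjoint (comp G {h, y} p) (comp G {h, y} q)

/-- Let `y` be a partner of `h`. Each component of `G - h - y` that contains a neighbour of `h` also
has an edge to `y`, as otherwise `h` would be a cut vertex. So `y` has degree at least four and a
partner, which turns out to be `h`. By symmetry each component has one edge to `y` as well as one to
`h`. -/
theorem Bicon.exists_dipoleAt [Finite V] (hG : Bicon G X) (hP : HasPartners G)
    (hh : 4 ≤ (G.neighborSet h).ncard) : ∃ y r, DipoleAt G X h y r := by
  obtain ⟨y, hyh, hy⟩ := hP h hh
  have hS : ∀ p, G.Adj h p → p ≠ y → p ∉ ({h, y} : Set V) := fun p hp hpy => by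
    simp [hp.ne', hpy]
  have hcl := fun p hp hpy => closedUpTo_comp (G := G) (hS p hp hpy)
  have hone : ∀ p, G.Adj h p → p ≠ y → ∀ q ∈ comp G {h, y} p, G.Adj h q → q = p := by
    intro p hp hpy q hq hhq
    by_contra hqp
    have hqy : q ≠ y := fun e => (hcl p hp hpy).1 q hq (.inr e)
    obtain ⟨Z, hZ, hpZ, hqZ⟩ := hy p q hp hhq (Ne.symm hqp) hpy hqy
    exact hqZ (hq Z hZ hpZ)
  have hdisj : ∀ p q, G.Adj h p → p ≠ y → G.Adj h q → q ≠ y → p ≠ q →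
      Disjoint (comp G {h, y} p) (comp G {h, y} q) := by
    intro p q hp hpy hq hqy hpq
    rw [disjoint_left]
    intro s hsp hsq
    have e := (comp_eq_of_mem (hS p hp hpy) hsp).symm.trans (comp_eq_of_mem (hS q hq hqy) hsq)
    exact hpq (hone q hq hqy p (e ▸ mem_comp_self) hp)
  obtain ⟨p₁, p₂, p₃, hp₁, hp₂, hp₃, hp₁y, hp₂y, hp₃y, h12, h13, h23⟩ := exists_three_adj_ne hh y
  have hhX := hG.mem_left hp₁
  have hex : ∀ p, G.Adj h p → p ≠ y → ∀ q, G.Adj h q → q ≠ y → p ≠ q →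
      ∃ r ∈ comp G {h, y} p, G.Adj y r := by
    intro p hp hpy q hq hqy hpq
    by_contra hcon
    push Not at hcon
    have hqp : q ∉ comp G {h, y} p := fun hm => hpq (hone p hp hpy q hm hq).symm
    refine hqp (hG.conn_diff h _ ⟨p, ⟨hG.mem_right hp, hp.ne'⟩, mem_comp_self⟩ ?_
      ⟨hG.mem_right hq, hq.ne'⟩)
    intro u hu huD w hw huw
    rcases (hcl p hp hpy).2 u huD w huw with e | rfl | rfl
    · exact e
    · exact absurd rfl hw.2
    · exact absurd huw.symm (hcon u huD)
  have hex' : ∀ p, G.Adj h p → p ≠ y → ∃ r ∈ comp G {h, y} p, G.Adj y r := by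
    intro p hp hpy
    by_cases e : p = p₁
    · exact hex p hp hpy p₂ hp₂ hp₂y (e ▸ h12)
    · exact hex p hp hpy p₁ hp₁ hp₁y e
  have hyX : y ∈ X := by
    obtain ⟨r, -, hr⟩ := hex' p₁ hp₁ hp₁y
    exact hG.mem_left hr
  choose! r hrD hyr using hex'
  -- `y` has degree at least four, too
  have hdegy : 4 ≤ (G.neighborSet y).ncard := by
    classical
    -- A neighbour of `h` is sent to a neighbour of `y` in its own component; `y`, if adjacent to
    -- `h`, is sent to `h`.
    refine hh.trans (ncard_neighborSet_le_of_injOn (fun p => if p = y then h else r p) ?_ ?_)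
    · intro p hp
      by_cases e : p = y
      · simpa [e] using (e ▸ hp).symm
      · simpa [e] using hyr p hp e
    · intro p hp q hq
      have hne : ∀ p, G.Adj h p → p ≠ y → r p ≠ h := fun p hp hpy e =>
        (hcl p hp hpy).1 _ (hrD p hp hpy) (.inl e)
      have hinj : p ≠ y → q ≠ y → r p = r q → p = q := by
        intro hpy hqy e
        by_contra hpq
        exact disjoint_left.1 (hdisj p q hp hpy hq hqy hpq) (hrD p hp hpy) (e ▸ hrD q hq hqy)
      by_cases hpy : p = y <;> by_cases hqy : q = y
      · simp [hpy, hqy]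
      · simpa [hpy, hqy] using fun e => absurd e.symm (hne q hq hqy)
      · simpa [hpy, hqy] using fun e => absurd e (hne p hp hpy)
      · simpa [hpy, hqy] using hinj hpy hqy
  obtain ⟨y₂, hy₂y, hy₂⟩ := hP y hdegy
  -- Otherwise, of three components at least two avoid `y₂`. They are linked through `h` in `G - y -
  -- y₂`, and both contain a neighbour of `y`, which contradicts the choice of `y₂` as a partner of
  -- `y`.
  have hy₂h : y₂ = h := by
    by_contra hne
    have two : ∃ p q, G.Adj h p ∧ G.Adj h q ∧ p ≠ y ∧ q ≠ y ∧ p ≠ q ∧ y₂ ∉ comp G {h, y} p ∧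
        y₂ ∉ comp G {h, y} q := by
      have d12 : y₂ ∈ comp G {h, y} p₁ → y₂ ∉ comp G {h, y} p₂ :=
        fun e => disjoint_left.1 (hdisj p₁ p₂ hp₁ hp₁y hp₂ hp₂y h12) e
      have d13 : y₂ ∈ comp G {h, y} p₁ → y₂ ∉ comp G {h, y} p₃ :=
        fun e => disjoint_left.1 (hdisj p₁ p₃ hp₁ hp₁y hp₃ hp₃y h13) e
      have d23 : y₂ ∈ comp G {h, y} p₂ → y₂ ∉ comp G {h, y} p₃ :=
        fun e => disjoint_left.1 (hdisj p₂ p₃ hp₂ hp₂y hp₃ hp₃y h23) e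
      by_cases e1 : y₂ ∈ comp G {h, y} p₁
      · exact ⟨p₂, p₃, hp₂, hp₃, hp₂y, hp₃y, h23, d12 e1, d13 e1⟩
      by_cases e2 : y₂ ∈ comp G {h, y} p₂
      · exact ⟨p₁, p₃, hp₁, hp₃, hp₁y, hp₃y, h13, e1, d23 e2⟩
      exact ⟨p₁, p₂, hp₁, hp₂, hp₁y, hp₂y, h12, e1, e2⟩
    obtain ⟨p, q, hp, hq, hpy, hqy, hpq, hp2, hq2⟩ := two
    have hrpq : r p ≠ r q := fun e =>
      disjoint_left.1 (hdisj p q hp hpy hq hqy hpq) (hrD p hp hpy) (e ▸ hrD q hq hqy)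
    obtain ⟨Z, hZ, hpZ, hqZ⟩ := hy₂ (r p) (r q) (hyr p hp hpy) (hyr q hq hqy) hrpq
      (fun e => hp2 (e ▸ hrD p hp hpy)) (fun e => hq2 (e ▸ hrD q hq hqy))
    have closed : ∀ p, G.Adj h p → p ≠ y → y₂ ∉ comp G {h, y} p → ∀ u ∈ comp G {h, y} p, u ∈ Z →
        comp G {h, y} p ⊆ Z := by
      intro p hp hpy hp2 u hu huZ
      refine conn_comp (hS p hp hpy) Z ⟨u, hu, huZ⟩ fun s hs hsZ t ht hst => ?_
      rcases hZ.2 s hsZ t hst with e | rfl | rfl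
      · exact e
      · exact ((hcl p hp hpy).1 t ht (.inr rfl)).elim
      · exact absurd ht hp2
    have h1 : p ∈ Z := closed p hp hpy hp2 (r p) (hrD p hp hpy) hpZ mem_comp_self
    have h2 : h ∈ Z := by
      rcases hZ.2 p h1 h hp.symm with e | e | e
      · exact e
      · exact absurd e.symm hyh
      · exact absurd e.symm hne
    have h3 : q ∈ Z := by
      rcases hZ.2 h h2 q hq with e | e | e
      · exact e
      · exact absurd e hqy
      · exact absurd (e ▸ mem_comp_self) hq2
    exact hqZ (closed q hq hqy hq2 q mem_comp_self h3 (hrD q hq hqy))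
  subst hy₂h
  refine ⟨y, r, hyh, hyX, hrD, hyr, ?_, ?_, hdisj⟩
  · intro p hp hpy u hu w hw huw
    rcases (hcl p hp hpy).2 u hu w huw with e | rfl | rfl
    · exact absurd e hw
    · exact .inl ⟨hone p hp hpy u hu huw.symm, rfl⟩
    · refine .inr ⟨?_, rfl⟩
      by_contra hur
      have huh : u ≠ y₂ := fun e => (hcl p hp hpy).1 u hu (.inl e)
      have hrh : r p ≠ y₂ := fun e => (hcl p hp hpy).1 _ (hrD p hp hpy) (.inl e)
      obtain ⟨Z, hZ, huZ, hrZ⟩ := hy₂ u (r p) huw.symm (hyr p hp hpy) hur huh hrh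
      rw [pair_comm] at hZ
      have := hu Z hZ
      have e2 : comp G {y₂, w} p ⊆ Z := by
        rw [← comp_eq_of_mem (hS p hp hpy) hu]
        exact comp_subset hZ huZ
      exact hrZ (e2 (hrD p hp hpy))
  · intro u hu huh huy
    by_contra hcon
    push Not at hcon
    have huS : u ∉ ({y₂, y} : Set V) := by simp [huh, huy]
    -- A component without a neighbour of `h`, now called `y₂`, would be closed in the connected
    -- graph `G - y`, and would hence contain `y₂`.
    refine (closedUpTo_comp (G := G) huS).1 y₂ ?_ (.inl rfl)
    refine hG.conn_diff y _ ⟨u, ⟨hu, huy⟩, mem_comp_self⟩ ?_ ⟨hhX, hyh.symm⟩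
    intro s hs hsD w hw hsw
    rcases (closedUpTo_comp huS).2 s hsD w hsw with e | rfl | rfl
    · exact e
    · exfalso
      exact hcon s hsw.symm hs.2 (by
        rw [comp_eq_of_mem huS hsD]
        exact mem_comp_self)
    · exact absurd rfl hw.2

end GemSPQR

namespace GemSPQR
open Set

universe u

variable {V : Type u} {G H : SimpleGraph V} {S X Y Y' Z A B : Set V}
  {a b c d h p q u v w x y z x' y' : V}

/-! ### Minimal sides of edge cuts of size two -/

/-- Each vertex of degree two lies in a triangle. -/
def DegreeTwoInTriangle (G : SimpleGraph V) : Prop :=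
  ∀ v a b, (∀ w, G.Adj v w ↔ w = a ∨ w = b) → G.Adj a b

/-- `A` is the whole vertex set, or a side of an edge cut of size two with at least two vertices on
either side, and it is minimal with this property. -/
structure MinimalSide (G : SimpleGraph V) (X A : Set V) : Prop where
  subset : A ⊆ X
  two_le : 2 ≤ A.ncard
  cut_le : (cutEdges G A).ncard ≤ 2
  eq_or : A = X ∨ 2 ≤ (X \ A).ncard
  min : ∀ A', A' ⊆ A → A' ≠ A → 2 ≤ A'.ncard → 2 ≤ (X \ A').ncard → ¬ (cutEdges G A').ncard ≤ 2

/-- `x` and `y` are adjacent, and they are the two neighbours of each other vertex of `A`. -/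
structure DipoleOn (G : SimpleGraph V) (A : Set V) (x y : V) : Prop where
  x_mem : x ∈ A
  y_mem : y ∈ A
  adj : G.Adj x y
  other : ∀ u ∈ A, u ≠ x → u ≠ y → ∀ w, G.Adj u w ↔ w = x ∨ w = y
  exists_other : ∃ u ∈ A, u ≠ x ∧ u ≠ y

theorem DipoleOn.symm (h : DipoleOn G A x y) : DipoleOn G A y x :=
  ⟨h.y_mem, h.x_mem, h.adj.symm, fun u hu hx hy w => (h.other u hu hy hx w).trans or_comm, by
    obtain ⟨u, hu, h1, h2⟩ := h.exists_other
    exact ⟨u, hu, h2, h1⟩⟩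

theorem Bicon.exists_minimalSide [Finite V] (hG : Bicon G X) : ∃ A, MinimalSide G X A := by
  let T : Set (Set V) := {A | A ⊆ X ∧ 2 ≤ A.ncard ∧ (cutEdges G A).ncard ≤ 2 ∧
    (A = X ∨ 2 ≤ (X \ A).ncard)}
  have hX : X ∈ T := by
    refine ⟨Subset.rfl, hG.three_le.trans' (by omega), ?_, .inl rfl⟩
    have : cutEdges G X = ∅ := by
      ext e
      simp only [cutEdges, mem_ofPred_eq, mem_empty_iff_false, iff_false]
      exact fun h => h.2.1 (hG.mem_right h.2.2)
    simp [this]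
  obtain ⟨A, -, hA⟩ := (toFinite T).exists_le_minimal hX
  refine ⟨A, hA.prop.1, hA.prop.2.1, hA.prop.2.2.1, hA.prop.2.2.2, ?_⟩
  intro A' hsub hne h2 h2' hcut
  exact hne (hsub.antisymm (hA.le_of_le ⟨hsub.trans hA.prop.1, h2, hcut, .inr h2'⟩ hsub))

theorem two_le_ncard [Finite V] (ha : a ∈ A) (hb : b ∈ A) (hab : a ≠ b) : 2 ≤ A.ncard :=
  (one_lt_ncard (toFinite _)).2 ⟨a, ha, b, hb, hab⟩

theorem eq_singleton_of_not_two_le [Finite V] (ha : a ∈ A) (h : ¬ 2 ≤ A.ncard) : A = {a} := by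
  ext z
  refine ⟨fun hz => ?_, fun hz => hz ▸ ha⟩
  by_contra hza
  exact h (two_le_ncard ha hz (Ne.symm hza))

theorem MinimalSide.exists_twoCut [Finite V] (hA : MinimalSide G X A) (hG : Bicon G X) :
    A = X ∨ (2 ≤ (X \ A).ncard ∧ ∃ x y x' y', TwoCut G A x y x' y') :=
  hA.eq_or.imp_right fun h => ⟨h, hG.exists_twoCut hA.subset hA.two_le h hA.cut_le⟩

theorem Bicon.comp_subset (hG : Bicon G X) (hp : G.Adj h p) (hpy : p ≠ y) :
    comp G {h, y} p ⊆ X \ {h, y} := by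
  have hS : p ∉ ({h, y} : Set V) := by simp [hp.ne', hpy]
  intro u hu
  refine ⟨?_, (closedUpTo_comp hS).1 u hu⟩
  have : ClosedUpTo G {h, y} (X \ {h, y}) :=
    ⟨fun u hu => hu.2, fun u hu w huw => by
      by_cases hw : w ∈ ({h, y} : Set V)
      · exact .inr hw
      · exact .inl ⟨hG.mem_right huw, hw⟩⟩
  exact (GemSPQR.comp_subset this ⟨hG.mem_right hp, hS⟩ hu).1

section dipole

variable {r : V → V} (hD : DipoleAt G X h y r)

include hD

theorem DipoleAt.cut_le (hp : G.Adj h p) (hpy : p ≠ y) :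
    (cutEdges G (comp G {h, y} p)).ncard ≤ 2 :=
  ncard_cutEdges_le_two (p, h) (r p, y) fun u hu w hw huw => by
    simpa using hD.leave p hp hpy u hu w hw huw

/-- If a component of `G - h - y` lies in the minimal side, then it is a single vertex. -/
theorem DipoleAt.comp_eq_singleton [Finite V] (hG : Bicon G X) (hA : MinimalSide G X A)
    (hhA : h ∈ A) (hp : G.Adj h p) (hpy : p ≠ y) (hsub : comp G {h, y} p ⊆ A) :
    comp G {h, y} p = {p} := by
  have hsubX := hG.comp_subset hp hpy
  refine eq_singleton_of_not_two_le mem_comp_self fun h2 => ?_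
  refine hA.min _ hsub (fun e => ?_) h2 ?_ (hD.cut_le hp hpy)
  · exact (hsubX (e ▸ hhA)).2 (.inl rfl)
  · exact two_le_ncard (a := h) (b := y) ⟨hG.mem_left hp, fun e => (hsubX e).2 (.inl rfl)⟩
      ⟨hD.y_mem, fun e => (hsubX e).2 (.inr rfl)⟩ hD.ne.symm

theorem DipoleAt.adj_iff_of_comp_eq (hp : G.Adj h p) (hpy : p ≠ y)
    (hs : comp G {h, y} p = {p}) : G.Adj p w ↔ w = h ∨ w = y := by
  have hr := hD.r_mem p hp hpy
  rw [hs, mem_singleton_iff] at hr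
  have hyp := hD.adj_r p hp hpy
  rw [hr] at hyp
  constructor
  · intro hpw
    have := hD.leave p hp hpy p mem_comp_self w (by rw [hs]; exact hpw.ne') hpw
    tauto
  · rintro (rfl | rfl)
    exacts [hp.symm, hyp.symm]

/-- Were `y` on the other side than `h`, each of at least three components would contain an end of a
cut edge, since it connects `h` to `y`. No edge meets two components, and the cut has only two
edges. -/
theorem DipoleAt.mem_of_twoCut [Finite V] (hh : 4 ≤ (G.neighborSet h).ncard)
    (hhA : h ∈ A) {a b a' b' : V} (hc : TwoCut G A a b a' b') : y ∈ A := by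
  by_contra hyA
  obtain ⟨p₁, p₂, p₃, hp₁, hp₂, hp₃, hy₁, hy₂, hy₃, h12, h13, h23⟩ := exists_three_adj_ne hh y
  have hS : ∀ p, G.Adj h p → p ≠ y → p ∉ ({h, y} : Set V) := fun p hp hpy => by
    simp [hp.ne', hpy]
  have crossing : ∀ p, G.Adj h p → p ≠ y → (a ∈ comp G {h, y} p ∨ a' ∈ comp G {h, y} p) ∨
      (b ∈ comp G {h, y} p ∨ b' ∈ comp G {h, y} p) := by
    intro p hp hpy
    have main : ∃ u w, G.Adj u w ∧ u ∈ A ∧ w ∉ A ∧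
        (u ∈ comp G {h, y} p ∨ w ∈ comp G {h, y} p) := by
      by_contra hcon
      push Not at hcon
      have hpA : p ∈ A := by
        by_contra hpA
        exact (hcon h p hp hhA hpA).2 mem_comp_self
      have hsub := conn_comp (hS p hp hpy) A ⟨p, mem_comp_self, hpA⟩ (by
        intro u hu huA w hw huw
        by_contra hwA
        exact (hcon u w huw huA hwA).1 hu)
      have hr := hD.r_mem p hp hpy
      exact (hcon _ _ (hD.adj_r p hp hpy).symm (hsub hr) hyA).1 hr
    obtain ⟨u, w, huw, hu, hw, hor⟩ := main
    rcases hc.eq_or u hu w hw huw with ⟨rfl, rfl⟩ | ⟨rfl, rfl⟩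
    exacts [.inl hor, .inr hor]
  have once : ∀ u w p q, G.Adj u w → G.Adj h p → p ≠ y → G.Adj h q → q ≠ y → p ≠ q →
      (u ∈ comp G {h, y} p ∨ w ∈ comp G {h, y} p) →
      (u ∈ comp G {h, y} q ∨ w ∈ comp G {h, y} q) → False := by
    intro u w p q huw hp hpy hq hqy hpq h1 h2
    have hd := hD.disj p q hp hpy hq hqy hpq
    have aux : ∀ u w, G.Adj u w → u ∈ comp G {h, y} p → w ∈ comp G {h, y} q → False := by
      intro u w huw hu hw
      rcases (closedUpTo_comp (hS p hp hpy)).2 u hu w huw with e | e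
      · exact disjoint_left.1 hd e hw
      · exact (closedUpTo_comp (hS q hq hqy)).1 w hw e
    rcases h1 with h1 | h1 <;> rcases h2 with h2 | h2
    · exact disjoint_left.1 hd h1 h2
    · exact aux u w huw h1 h2
    · exact aux w u huw.symm h1 h2
    · exact disjoint_left.1 hd h1 h2
  rcases crossing p₁ hp₁ hy₁ with c1 | c1 <;> rcases crossing p₂ hp₂ hy₂ with c2 | c2 <;>
    rcases crossing p₃ hp₃ hy₃ with c3 | c3
  · exact once _ _ p₁ p₂ hc.adj_x hp₁ hy₁ hp₂ hy₂ h12 c1 c2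
  · exact once _ _ p₁ p₂ hc.adj_x hp₁ hy₁ hp₂ hy₂ h12 c1 c2
  · exact once _ _ p₁ p₃ hc.adj_x hp₁ hy₁ hp₃ hy₃ h13 c1 c3
  · exact once _ _ p₂ p₃ hc.adj_y hp₂ hy₂ hp₃ hy₃ h23 c2 c3
  · exact once _ _ p₂ p₃ hc.adj_x hp₂ hy₂ hp₃ hy₃ h23 c2 c3
  · exact once _ _ p₁ p₃ hc.adj_y hp₁ hy₁ hp₃ hy₃ h13 c1 c3
  · exact once _ _ p₁ p₂ hc.adj_y hp₁ hy₁ hp₂ hy₂ h12 c1 c2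
  · exact once _ _ p₁ p₂ hc.adj_y hp₁ hy₁ hp₂ hy₂ h12 c1 c2

end dipole

/-- What a minimal side looks like. -/
inductive SideShape (G : SimpleGraph V) (X A : Set V) : Prop
  | triangle (a b v : V) (hav : G.Adj a v) (hbv : G.Adj b v) (hab : G.Adj a b)
      (hX : X = {a, b, v}) (hA : A = X)
  | dipole (x y : V) (hD : DipoleOn G A x y) (hA : A = X) (u w : V) (hu : u ∈ A) (hw : w ∈ A)
      (huw : u ≠ w) (hux : u ≠ x) (huy : u ≠ y) (hwx : w ≠ x) (hwy : w ≠ y)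
  | dipoleCut (x y x' y' : V) (hD : DipoleOn G A x y) (hc : TwoCut G A x y x' y')
      (hB : 2 ≤ (X \ A).ncard)
  | cubic (hdeg : ∀ u ∈ A, (G.neighborSet u).ncard = 3) (hA : A = X)
  | cubicCut (hdeg : ∀ u ∈ A, (G.neighborSet u).ncard = 3) (x y x' y' : V)
      (hc : TwoCut G A x y x' y') (hxy : ¬ G.Adj x y) (hB : 2 ≤ (X \ A).ncard)

/-- Every component of `G - h - y` is itself a side of an edge cut of size at most two, so by
minimality those inside `A` are single vertices. They have degree two, and lying in triangles they
force the edge `hy`. If `A` is not everything, exactly one component lies outside `A`. -/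
theorem MinimalSide.shape_of_four_le [Finite V] (hA : MinimalSide G X A) (hG : Bicon G X)
    (hP : HasPartners G) (ht : DegreeTwoInTriangle G) (hhA : h ∈ A)
    (hh : 4 ≤ (G.neighborSet h).ncard) : SideShape G X A := by
  obtain ⟨y, r, hD⟩ := hG.exists_dipoleAt hP hh
  obtain ⟨p₁, p₂, p₃, hp₁, hp₂, hp₃, hy₁, hy₂, hy₃, h12, h13, h23⟩ := exists_three_adj_ne hh y
  rcases hA.exists_twoCut hG with rfl | ⟨hB, a, b, a', b', hc⟩
  · have hsing : ∀ p, G.Adj h p → p ≠ y → comp G {h, y} p = {p} := fun p hp hpy =>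
      hD.comp_eq_singleton hG hA hhA hp hpy
        fun u hu => (hG.comp_subset hp hpy hu).1
    have hN : ∀ p, G.Adj h p → p ≠ y → ∀ w, G.Adj p w ↔ w = h ∨ w = y := fun p hp hpy w =>
      hD.adj_iff_of_comp_eq hp hpy (hsing p hp hpy)
    have hdip : DipoleOn G A h y := by
      refine ⟨hhA, hD.y_mem, ht p₁ h y (hN p₁ hp₁ hy₁), ?_,
        ⟨p₁, hG.mem_right hp₁, hp₁.ne', hy₁⟩⟩
      intro u hu huh huy
      obtain ⟨p, hp, hpy, hup⟩ := hD.cover u hu huh huy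
      rw [hsing p hp hpy, mem_singleton_iff] at hup
      exact hup ▸ hN p hp hpy
    exact .dipole h y hdip rfl p₁ p₂ (hG.mem_right hp₁) (hG.mem_right hp₂) h12 hp₁.ne' hy₁
      hp₂.ne' hy₂
  · have hyA : y ∈ A := hD.mem_of_twoCut hh hhA hc
    have ha'h : a' ≠ h := fun e => hc.x'_notMem (e ▸ hhA)
    have ha'y : a' ≠ y := fun e => hc.x'_notMem (e ▸ hyA)
    have ha'X : a' ∈ X \ A := ⟨hG.mem_right hc.adj_x, hc.x'_notMem⟩
    obtain ⟨p₀, hp₀, hp₀y, ha'p⟩ := hD.cover a' ha'X.1 ha'h ha'y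
    have hS : p₀ ∉ ({h, y} : Set V) := by simp [hp₀.ne', hp₀y]
    -- The far side is connected and avoids `h` and `y`, so a single component contains it.
    have hBD : X \ A ⊆ comp G {h, y} p₀ := by
      refine (hc.conn_compl hG hA.subset) _ ⟨a', ha'X, ha'p⟩ fun u hu huD w hw huw => ?_
      rcases (closedUpTo_comp hS).2 u huD w huw with e | rfl | rfl
      exacts [e, absurd hhA hw.2, absurd hyA hw.2]
    have hnot := fun z hz => (hG.comp_subset hp₀ hp₀y (a := z) hz).2
    have hcut' : ∀ u ∈ A \ comp G {h, y} p₀, ∀ w, w ∉ A \ comp G {h, y} p₀ → G.Adj u w →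
        (u = h ∧ w = p₀) ∨ (u = y ∧ w = r p₀) := by
      intro u hu w hw huw
      have hwD : w ∈ comp G {h, y} p₀ := by
        by_contra hwD
        exact hwD (hBD ⟨hG.mem_right huw, fun h => hw ⟨h, hwD⟩⟩)
      have := hD.leave p₀ hp₀ hp₀y w hwD u hu.2 huw.symm
      tauto
    -- Removing that component from `A` leaves a set bounded by its two edges to `h` and `y`; by
    -- minimality nothing was removed.
    have hA' : A \ comp G {h, y} p₀ = A := by
      by_contra hne
      refine hA.min _ sdiff_subset hne ?_ ?_
        (ncard_cutEdges_le_two (h, p₀) (y, r p₀) (by simpa using hcut'))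
      · exact two_le_ncard (a := h) (b := y) ⟨hhA, fun e => hnot h e (.inl rfl)⟩
          ⟨hyA, fun e => hnot y e (.inr rfl)⟩ hD.ne.symm
      · exact hB.trans (ncard_le_ncard (sdiff_subset_sdiff_right sdiff_subset) (toFinite _))
    rw [hA'] at hcut'
    have hdisj : ∀ z ∈ comp G {h, y} p₀, z ∉ A := fun z hz hzA => (hA'.symm.subset hzA).2 hz
    have hr₀ := hD.r_mem p₀ hp₀ hp₀y
    have hc' : TwoCut G A h y p₀ (r p₀) := by
      refine ⟨hD.ne.symm, ?_, hhA, hyA, hdisj _ mem_comp_self, hdisj _ hr₀, hp₀,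
        hD.adj_r p₀ hp₀ hp₀y, hcut'⟩
      -- If the new cut edges had the same outer end, so would the original ones.
      intro e
      have h1 := hcut' a hc.x_mem a' hc.x'_notMem hc.adj_x
      have h2 := hcut' b hc.y_mem b' hc.y'_notMem hc.adj_y
      rw [← e] at h1 h2
      exact hc.ne' ((by tauto : a' = p₀).trans (by tauto : b' = p₀).symm)
    have hsing : ∀ p, G.Adj h p → p ≠ y → p ≠ p₀ → comp G {h, y} p = {p} := by
      intro p hp hpy hne
      refine hD.comp_eq_singleton hG hA hhA hp hpy fun u hu => ?_
      by_contra huA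
      exact disjoint_left.1 (hD.disj p p₀ hp hpy hp₀ hp₀y hne) hu
        (hBD ⟨(hG.comp_subset hp hpy hu).1, huA⟩)
    have hN : ∀ p, G.Adj h p → p ≠ y → p ≠ p₀ → ∀ w, G.Adj p w ↔ w = h ∨ w = y :=
      fun p hp hpy hne w => hD.adj_iff_of_comp_eq hp hpy (hsing p hp hpy hne)
    have memA : ∀ p, G.Adj h p → p ≠ p₀ → p ∈ A := by
      intro p hp hne
      by_contra hpA
      rcases hcut' h hhA p hpA hp with e | e
      exacts [hne e.2, hD.ne e.1.symm]
    obtain ⟨p, hp, hpy, hne⟩ : ∃ p, G.Adj h p ∧ p ≠ y ∧ p ≠ p₀ := by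
      by_cases e : p₁ = p₀
      · exact ⟨p₂, hp₂, hy₂, fun h => h12 (e.trans h.symm)⟩
      · exact ⟨p₁, hp₁, hy₁, e⟩
    refine .dipoleCut h y p₀ (r p₀) ⟨hhA, hyA, ht p h y (hN p hp hpy hne), ?_,
      ⟨p, memA p hp hne, hp.ne', hpy⟩⟩ hc' hB
    intro u hu huh huy
    obtain ⟨q, hq, hqy, huq⟩ := hD.cover u (hA.subset hu) huh huy
    have hqp : q ≠ p₀ := by
      rintro rfl
      exact hdisj u huq hu
    rw [hsing q hq hqy hqp, mem_singleton_iff] at huq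
    exact huq ▸ hN q hq hqy hqp

/-- A vertex set that is closed up to one vertex is everything else. -/
theorem Bicon.eq_of_closed (hG : Bicon G X) (hu : u ∈ A) (huX : u ∈ X) (huc : u ≠ c)
    (hcl : ∀ u ∈ A, ∀ w, G.Adj u w → w ∈ A ∨ w = c) (hz : z ∈ X) (hzc : z ≠ c) : z ∈ A :=
  hG.conn_diff c A ⟨u, ⟨huX, huc⟩, hu⟩
    (fun s _ hsA w hw hsw => (hcl s hsA w hsw).resolve_right hw.2) ⟨hz, hzc⟩

/-- If `a` or `b` has degree two as well, the other one would be a cut vertex unless `X` is the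
triangle. Otherwise `a` and `b` have degree three and `{a, b, v}` has two outgoing edges: it is `A`
by minimality, or only one vertex is left outside it. -/
theorem MinimalSide.shape_of_degree_two [Finite V] (hA : MinimalSide G X A) (hG : Bicon G X)
    (h3 : ∀ u ∈ A, (G.neighborSet u).ncard ≤ 3) (hab : G.Adj a b) (hvA : v ∈ A)
    (hN : ∀ w, G.Adj v w ↔ w = a ∨ w = b) : SideShape G X A := by
  have hva : G.Adj v a := (hN a).2 (.inl rfl)
  have hvb : G.Adj v b := (hN b).2 (.inr rfl)
  have haX := hG.mem_right hva
  have hbX := hG.mem_right hvb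
  have hvX := hG.mem_left hvb
  have hX : ∀ a b, G.Adj a b → (∀ w, G.Adj v w ↔ w = a ∨ w = b) → (G.neighborSet a).ncard = 2 →
      X = {a, b, v} := by
    intro a b hab hN hdeg
    have hva : G.Adj v a := (hN a).2 (.inl rfl)
    have hvb : G.Adj v b := (hN b).2 (.inr rfl)
    obtain ⟨s, t, hst, h⟩ := exists_adj_iff_of_ncard_two hdeg
    have hN' : ∀ w, G.Adj a w ↔ w = v ∨ w = b := by
      intro w
      have h1 := (h v).1 hva.symm
      have h2 := (h b).1 hab
      rw [h]
      have := hvb.ne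
      grind
    ext z
    constructor
    · intro hz
      by_cases hzb : z = b
      · exact .inr (.inl hzb)
      have := hG.eq_of_closed (A := {a, v}) (c := b) (.inl rfl) (hG.mem_left hab) hab.ne (by
        rintro u (rfl | rfl) w huw
        · rcases (hN' w).1 huw with rfl | rfl
          exacts [.inl (.inr rfl), .inr rfl]
        · rcases (hN w).1 huw with rfl | rfl
          exacts [.inl (.inl rfl), .inr rfl]) hz hzb
      rcases this with rfl | rfl
      exacts [.inl rfl, .inr (.inr rfl)]
    · rintro (rfl | rfl | rfl)
      exacts [hG.mem_left hab, hG.mem_right hab, hG.mem_left hvb]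
  have hN' : ∀ w, G.Adj v w ↔ w = b ∨ w = a := fun w => (hN w).trans or_comm
  have hmem : a ∈ A ∧ b ∈ A := by
    rcases hA.exists_twoCut hG with rfl | ⟨hB, x, y, x', y', hc⟩
    · exact ⟨haX, hbX⟩
    -- A cut through a triangle contains two of its edges, and these share a vertex, whereas the two
    -- edges of this cut are disjoint.
    · have aux : ∀ a b, G.Adj a b → G.Adj v a → G.Adj v b → a ∈ A := by
        intro a b hab hva hvb
        by_contra haA
        have e1 := hc.eq_or v hvA a haA hva
        have := hc.ne
        have := hc.ne'
        have := hvb.ne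
        have := hab.ne
        by_cases hbA : b ∈ A
        · have e2 := hc.eq_or b hbA a haA hab.symm
          grind
        · have e2 := hc.eq_or v hvA b hbA hvb
          grind
      exact ⟨aux a b hab hva hvb, aux b a hab.symm hvb hva⟩
  have htri : X = {a, b, v} → SideShape G X A := by
    intro e
    refine .triangle a b v hva.symm hvb.symm hab e (hA.subset.antisymm ?_)
    rw [e]
    rintro z (rfl | rfl | rfl)
    exacts [hmem.1, hmem.2, hvA]
  have hdega := hG.two_le_degree haX
  have hdegb := hG.two_le_degree hbX
  by_cases ha2 : (G.neighborSet a).ncard = 2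
  · exact htri (hX a b hab hN ha2)
  by_cases hb2 : (G.neighborSet b).ncard = 2
  · refine htri ((hX b a hab.symm hN' hb2).trans ?_)
    rw [insert_comm]
  have ha3 : (G.neighborSet a).ncard = 3 := le_antisymm (h3 a hmem.1) (by omega)
  have hb3 : (G.neighborSet b).ncard = 3 := le_antisymm (h3 b hmem.2) (by omega)
  obtain ⟨a', ha'v, ha'b, hNa⟩ := exists_third_of_ncard_three ha3 hva.symm hab hvb.ne
  obtain ⟨b', hb'v, hb'a, hNb⟩ := exists_third_of_ncard_three hb3 hvb.symm hab.symm hva.ne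
  have haa' : G.Adj a a' := (hNa a').2 (.inr (.inr rfl))
  have hbb' : G.Adj b b' := (hNb b').2 (.inr (.inr rfl))
  have hcut : ∀ u ∈ ({a, b, v} : Set V), ∀ w, w ∉ ({a, b, v} : Set V) → G.Adj u w →
      (u, w) = (a, a') ∨ (u, w) = (b, b') := by
    rintro u (rfl | rfl | rfl) w hw huw
    · have := (hNa w).1 huw
      simp only [mem_insert_iff, mem_singleton_iff] at hw
      grind
    · have := (hNb w).1 huw
      simp only [mem_insert_iff, mem_singleton_iff] at hw
      grind
    · have := (hN w).1 huw
      simp only [mem_insert_iff, mem_singleton_iff] at hw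
      grind
  have hsub : ({a, b, v} : Set V) ⊆ A := by
    rintro z (rfl | rfl | rfl)
    exacts [hmem.1, hmem.2, hvA]
  by_cases hbig : 2 ≤ (X \ {a, b, v}).ncard
  · have hAe : ({a, b, v} : Set V) = A := by
      by_contra hne
      exact hA.min _ hsub hne (two_le_ncard (.inl rfl) (.inr (.inl rfl)) hab.ne) hbig
        (ncard_cutEdges_le_two _ _ hcut)
    have hdip : DipoleOn G A a b := by
      refine ⟨hmem.1, hmem.2, hab, ?_, ⟨v, hvA, hva.ne, hvb.ne⟩⟩
      intro u hu hua hub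
      rw [← hAe] at hu
      rcases hu with rfl | rfl | rfl
      exacts [absurd rfl hua, absurd rfl hub, hN]
    rcases hA.exists_twoCut hG with rfl | ⟨hB, x, y, x', y', hc⟩
    · exfalso
      rw [hAe, sdiff_self] at hbig
      simp at hbig
    · have hend : ∀ u ∈ A, ∀ w, w ∉ A → G.Adj u w → u = a ∨ u = b := by
        intro u hu w hw huw
        have := hcut u (hAe ▸ hu) w (hAe ▸ hw) huw
        simp only [Prod.mk.injEq] at this
        tauto
      have h1 := hend x hc.x_mem x' hc.x'_notMem hc.adj_x
      have h2 := hend y hc.y_mem y' hc.y'_notMem hc.adj_y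
      have h12 := hc.ne
      rcases h1 with rfl | rfl <;> rcases h2 with rfl | rfl
      · exact absurd rfl h12
      · exact .dipoleCut _ _ _ _ hdip hc hB
      · exact .dipoleCut _ _ _ _ hdip.symm hc hB
      · exact absurd rfl h12
  -- The one vertex outside the triangle is the third neighbour of both `a` and `b`. So `G` is a
  -- dipole on `a` and `b` whose other vertices are `v` and this one.
  · have ha'X : a' ∈ X \ {a, b, v} := by
      refine ⟨hG.mem_right haa', ?_⟩
      simp [haa'.ne', ha'v, ha'b]
    have hb'X : b' ∈ X \ {a, b, v} := by
      refine ⟨hG.mem_right hbb', ?_⟩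
      simp [hbb'.ne', hb'v, hb'a]
    have hXe := eq_singleton_of_not_two_le ha'X hbig
    have hba' : b' = a' := by
      rw [hXe] at hb'X
      exact hb'X
    subst hba'
    have hXmem : ∀ z ∈ X, z = a ∨ z = b ∨ z = v ∨ z = b' := by
      intro z hz
      by_contra hcon
      have : z ∈ X \ {a, b, v} := ⟨hz, by simp; tauto⟩
      rw [hXe] at this
      simp only [mem_singleton_iff] at this
      tauto
    have hAX : A = X := by
      rcases hA.eq_or with h | h
      · exact h
      · refine absurd (h.trans (ncard_le_ncard (sdiff_subset_sdiff_right hsub) (toFinite _))) hbig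
    refine .dipole a b ⟨hmem.1, hmem.2, hab, ?_, ⟨v, hvA, hva.ne, hvb.ne⟩⟩ hAX v b' hvA
      (hAX ▸ ha'X.1) (Ne.symm hb'v) hva.ne hvb.ne haa'.ne' hbb'.ne'
    intro u hu hua hub w
    rcases hXmem u (hA.subset hu) with rfl | rfl | rfl | rfl
    · exact absurd rfl hua
    · exact absurd rfl hub
    · exact hN w
    · constructor
      · intro huw
        rcases hXmem w (hG.mem_right huw) with rfl | rfl | rfl | rfl
        · exact .inl rfl
        · exact .inr rfl
        · have := (hN u).1 huw.symm
          tauto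
        · exact absurd huw (G.irrefl)
      · rintro (rfl | rfl)
        exacts [haa'.symm, hbb'.symm]

/-- If `x` and `y` were adjacent, `A \ {x, y}` would be left only by the edges to their third
neighbours. It would be a smaller side, or a single vertex of degree at most two. -/
theorem MinimalSide.not_adj [Finite V] (hA : MinimalSide G X A) (hB : 2 ≤ (X \ A).ncard)
    (h3 : ∀ u ∈ A, (G.neighborSet u).ncard = 3) (hc : TwoCut G A x y x' y') : ¬ G.Adj x y := by
  intro hxy
  obtain ⟨x₁, hx₁, hx₁y, hNx⟩ := exists_third_of_ncard_three (h3 x hc.x_mem) hc.adj_x hxy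
    (fun e => hc.x'_notMem (e ▸ hc.y_mem))
  obtain ⟨y₁, hy₁, hy₁x, hNy⟩ := exists_third_of_ncard_three (h3 y hc.y_mem) hc.adj_y hxy.symm
    (fun e => hc.y'_notMem (e ▸ hc.x_mem))
  have hxx₁ : G.Adj x x₁ := (hNx x₁).2 (.inr (.inr rfl))
  have hx₁A : x₁ ∈ A := by
    by_contra h
    have := hc.eq_or x hc.x_mem x₁ h hxx₁
    have := hc.ne
    tauto
  have hx₁A' : x₁ ∈ A \ {x, y} := ⟨hx₁A, by simp [hxx₁.ne', hx₁y]⟩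
  have hcut : ∀ u ∈ A \ {x, y}, ∀ w, w ∉ A \ {x, y} → G.Adj u w →
      (u, w) = (x₁, x) ∨ (u, w) = (y₁, y) := by
    intro u hu w hw huw
    have hu2 := hu.2
    simp only [mem_insert_iff, mem_singleton_iff, not_or] at hu2
    have hw2 : w = x ∨ w = y := by
      by_contra hcon
      have hwA : w ∉ A := fun h => hw ⟨h, by simpa using hcon⟩
      have := hc.eq_or u hu.1 w hwA huw
      tauto
    rcases hw2 with rfl | rfl
    · have := (hNx u).1 huw.symm
      have h1 : u ≠ x' := fun e => hc.x'_notMem (e ▸ hu.1)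
      left
      congr 1
      tauto
    · have := (hNy u).1 huw.symm
      have h1 : u ≠ y' := fun e => hc.y'_notMem (e ▸ hu.1)
      right
      congr 1
      tauto
  by_cases h2 : 2 ≤ (A \ {x, y}).ncard
  · refine hA.min _ sdiff_subset ?_ h2 ?_ (ncard_cutEdges_le_two _ _ hcut)
    · intro e
      exact (e.symm.subset hc.x_mem).2 (.inl rfl)
    · exact hB.trans (ncard_le_ncard (sdiff_subset_sdiff_right sdiff_subset) (toFinite _))
  · have hs := eq_singleton_of_not_two_le hx₁A' h2
    have hsub : G.neighborSet x₁ ⊆ {x, y} := by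
      intro w hw
      have hwne : w ≠ x₁ := SimpleGraph.Adj.ne' hw
      have := hcut x₁ hx₁A' w (by rw [hs]; exact hwne) hw
      simp only [Prod.mk.injEq] at this
      simp only [mem_insert_iff, mem_singleton_iff]
      tauto
    have h4 := ncard_le_ncard hsub (toFinite _)
    rw [h3 x₁ hx₁A, ncard_pair hxy.ne] at h4
    omega

theorem MinimalSide.shape [Finite V] (hA : MinimalSide G X A) (hG : Bicon G X)
    (hP : HasPartners G) (ht : DegreeTwoInTriangle G) : SideShape G X A := by
  by_cases h4 : ∃ h ∈ A, 4 ≤ (G.neighborSet h).ncard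
  · obtain ⟨h, hhA, hh⟩ := h4
    exact hA.shape_of_four_le hG hP ht hhA hh
  push Not at h4
  have h3 : ∀ u ∈ A, (G.neighborSet u).ncard ≤ 3 := fun u hu => by
    have := h4 u hu
    omega
  by_cases h2 : ∃ v ∈ A, (G.neighborSet v).ncard = 2
  · obtain ⟨v, hvA, hv⟩ := h2
    obtain ⟨a, b, -, hN⟩ := exists_adj_iff_of_ncard_two hv
    exact hA.shape_of_degree_two hG h3 (ht v a b hN) hvA hN
  push Not at h2
  have hdeg : ∀ u ∈ A, (G.neighborSet u).ncard = 3 := fun u hu => by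
    have := h3 u hu
    have := h2 u hu
    have := hG.two_le_degree (hA.subset hu)
    omega
  rcases hA.exists_twoCut hG with h | ⟨hB, x, y, x', y', hc⟩
  · exact .cubic hdeg h
  · exact .cubicCut hdeg x y x' y' hc (hA.not_adj hB hdeg hc) hB

end GemSPQR

namespace GemSPQR
open Set

universe u

variable {V : Type u} {G K : SimpleGraph V} {S X Y Z A B P Q : Set V}
  {a b c d h p q u v w x y z x' y' : V}

/-! ### Cubic graphs without small edge cuts are `3`-connected -/

/-- `K` is a `3`-connected cubic graph with vertex set `A`. -/
structure CubicThreeConn (K : SimpleGraph V) (A : Set V) : Prop where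
  mem_left : ∀ {u w}, K.Adj u w → u ∈ A
  degree : ∀ u ∈ A, (K.neighborSet u).ncard = 3
  four_le : 4 ≤ A.ncard
  three_le : ∀ P Q : Set V, P ∪ Q = A → (∀ x ∈ P \ Q, ∀ y ∈ Q \ P, ¬ K.Adj x y) →
    ¬ P ⊆ Q → ¬ Q ⊆ P → 3 ≤ (P ∩ Q).ncard

theorem ncard_cutEdges_le_of_pair [Finite V] (m₁ m₂ : V)
    (h : ∀ u ∈ S, ∀ w, w ∉ S → K.Adj u w → w = m₁ ∨ w = m₂) :
    (cutEdges K S).ncard ≤ (K.neighborSet m₁ ∩ S).ncard + (K.neighborSet m₂ ∩ S).ncard := by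
  have hsub : cutEdges K S ⊆ (fun u => (u, m₁)) '' (K.neighborSet m₁ ∩ S) ∪
      (fun u => (u, m₂)) '' (K.neighborSet m₂ ∩ S) := by
    rintro ⟨u, w⟩ ⟨hu, hw, huw⟩
    rcases h u hu w hw huw with rfl | rfl
    · exact .inl ⟨u, ⟨huw.symm, hu⟩, rfl⟩
    · exact .inr ⟨u, ⟨huw.symm, hu⟩, rfl⟩
  refine (ncard_le_ncard hsub (toFinite _)).trans ((ncard_union_le _ _).trans ?_)
  exact Nat.add_le_add (ncard_image_le (toFinite _)) (ncard_image_le (toFinite _))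

theorem ncard_cutEdges_compl (K : SimpleGraph V) (S : Set V) :
    (cutEdges K Sᶜ).ncard = (cutEdges K S).ncard := by
  have : cutEdges K Sᶜ = Prod.swap '' cutEdges K S := by
    ext ⟨u, w⟩
    simp only [cutEdges, mem_ofPred_eq, mem_compl_iff, not_not, image_swap_eq_preimage_swap,
      mem_preimage, Prod.swap_prod_mk, K.adj_comm]
    tauto
  rw [this, ncard_image_of_injective _ Prod.swap_injective]

/-- The restriction to sides with two vertices is harmless: a side with a single vertex has three
edges by its degree. -/
theorem three_le_ncard_cutEdges [Finite V] (hmem : ∀ {u w}, K.Adj u w → u ∈ A)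
    (hdeg : ∀ u ∈ A, (K.neighborSet u).ncard = 3)
    (hcut : ∀ S ⊆ A, 2 ≤ S.ncard → 2 ≤ (A \ S).ncard → 3 ≤ (cutEdges K S).ncard)
    (hS : S ⊆ A) (hu : u ∈ S) (hw : w ∈ A \ S) : 3 ≤ (cutEdges K S).ncard := by
  by_cases h1 : 2 ≤ S.ncard
  · by_cases h2 : 2 ≤ (A \ S).ncard
    · exact hcut S hS h1 h2
    · have hs := eq_singleton_of_not_two_le hw h2
      rw [← hdeg w hw.1]
      refine ncard_le_ncard_of_injOn (fun z => (z, w)) ?_ (fun _ _ _ _ e => congrArg Prod.fst e)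
        (toFinite _)
      intro z hz
      refine ⟨?_, hw.2, SimpleGraph.Adj.symm hz⟩
      by_contra hzS
      have : z ∈ A \ S := ⟨hmem (SimpleGraph.Adj.symm hz), hzS⟩
      rw [hs] at this
      exact SimpleGraph.Adj.ne' hz this
  · have hs := eq_singleton_of_not_two_le hu h1
    rw [← hdeg u (hS hu)]
    refine ncard_le_ncard_of_injOn (fun z => (u, z)) ?_ (fun _ _ _ _ e => congrArg Prod.snd e)
      (toFinite _)
    intro z hz
    refine ⟨hu, ?_, hz⟩
    rw [hs]
    exact SimpleGraph.Adj.ne' hz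

/-- Let `D` and `E` be the two sides of a separator with at most two vertices. All edges leaving `D`
or `E` end in the separator, whose vertices have only three edges each. This is too few for a single
vertex; for two vertices the numbers are settled by parity. -/
theorem cubicThreeConn_of_cut [Finite V] (hmem : ∀ {u w}, K.Adj u w → u ∈ A)
    (hdeg : ∀ u ∈ A, (K.neighborSet u).ncard = 3) (hA : A.Nonempty)
    (hcut : ∀ S ⊆ A, 2 ≤ S.ncard → 2 ≤ (A \ S).ncard → 3 ≤ (cutEdges K S).ncard) :
    CubicThreeConn K A := by
  refine ⟨hmem, hdeg, ?_, ?_⟩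
  · obtain ⟨u, hu⟩ := hA
    have hsub : insert u (K.neighborSet u) ⊆ A := by
      rintro z (rfl | hz)
      exacts [hu, hmem (SimpleGraph.Adj.symm hz)]
    have := ncard_le_ncard hsub (toFinite _)
    rw [ncard_insert_of_notMem (a := u) (s := K.neighborSet u) (fun h => K.irrefl h) (toFinite _),
      hdeg u hu] at this
    exact this
  · intro P Q hPQ hsep hP hQ
    obtain ⟨d, hdP, hdQ⟩ := not_subset.1 hP
    obtain ⟨e, heQ, heP⟩ := not_subset.1 hQ
    by_contra hlt
    have memA : ∀ {z}, z ∈ P ∨ z ∈ Q → z ∈ A := fun h => hPQ ▸ h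
    have ofA : ∀ {z}, z ∈ A → z ∈ P ∨ z ∈ Q := fun h => by rwa [← hPQ] at h
    have hD : P \ Q ⊆ A := fun z hz => memA (.inl hz.1)
    have hE : Q \ P ⊆ A := fun z hz => memA (.inr hz.1)
    have big := fun {S : Set V} {u w} (hS : S ⊆ A) (hu : u ∈ S) (hw : w ∈ A \ S) =>
      three_le_ncard_cutEdges hmem hdeg hcut hS hu hw
    -- the separator has two (possibly equal) elements
    obtain ⟨m₁, m₂, hM, hm⟩ : ∃ m₁ m₂, (∀ z, z ∈ P → z ∈ Q → z = m₁ ∨ z = m₂) ∧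
        ((m₁ ∈ P ∧ m₁ ∈ Q) ∧ (m₂ ∈ P ∧ m₂ ∈ Q) ∧ m₁ ≠ m₂ ∨
          (∀ z, z ∈ P → z ∈ Q → z = m₁) ∧ m₁ = m₂) := by
      by_cases h2 : 2 ≤ (P ∩ Q).ncard
      · obtain ⟨m₁, m₂, hne, h⟩ := ncard_eq_two.1 (show (P ∩ Q).ncard = 2 by omega)
        have h1 : m₁ ∈ P ∩ Q := h ▸ .inl rfl
        have h3 : m₂ ∈ P ∩ Q := h ▸ .inr rfl
        refine ⟨m₁, m₂, fun z hz hz' => ?_, .inl ⟨h1, h3, hne⟩⟩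
        have : z ∈ P ∩ Q := ⟨hz, hz'⟩
        rw [h] at this
        simpa using this
      · by_cases hne : (P ∩ Q).Nonempty
        · obtain ⟨m, hm⟩ := hne
          have h := eq_singleton_of_not_two_le hm h2
          have h' : ∀ z, z ∈ P → z ∈ Q → z = m := fun z hz hz' => by
            have : z ∈ P ∩ Q := ⟨hz, hz'⟩
            rwa [h] at this
          exact ⟨m, m, fun z hz hz' => .inl (h' z hz hz'), .inr ⟨h', rfl⟩⟩
        · exact ⟨d, d, fun z hz hz' => absurd ⟨z, hz, hz'⟩ hne,
            .inr ⟨fun z hz hz' => absurd ⟨z, hz, hz'⟩ hne, rfl⟩⟩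
    have leaveD : ∀ u ∈ P \ Q, ∀ w, w ∉ P \ Q → K.Adj u w → w ∈ P ∧ w ∈ Q := by
      intro u hu w hw huw
      have := ofA (hmem huw.symm)
      have := hsep u hu w
      simp only [mem_sdiff] at *
      tauto
    have leaveE : ∀ u ∈ Q \ P, ∀ w, w ∉ Q \ P → K.Adj u w → w ∈ P ∧ w ∈ Q := by
      intro u hu w hw huw
      have := ofA (hmem huw.symm)
      have := fun h => hsep w h u hu huw.symm
      simp only [mem_sdiff] at *
      tauto
    have cD := big hD ⟨hdP, hdQ⟩ (w := e) ⟨memA (.inr heQ), fun h => heP h.1⟩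
    have cE := big hE ⟨heQ, heP⟩ (w := d) ⟨memA (.inl hdP), fun h => hdQ h.1⟩
    have hdis : Disjoint (P \ Q) (Q \ P) := disjoint_left.2 fun z h1 h2 => h1.2 h2.1
    rcases hm with ⟨hm₁, hm₂, hne⟩ | ⟨hM1, -⟩
    · have bD := ncard_cutEdges_le_of_pair m₁ m₂ fun u hu w hw huw =>
        hM w (leaveD u hu w hw huw).1 (leaveD u hu w hw huw).2
      have bE := ncard_cutEdges_le_of_pair m₁ m₂ fun u hu w hw huw =>
        hM w (leaveE u hu w hw huw).1 (leaveE u hu w hw huw).2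
      -- the edges at `m`, where `m'` is the other element of the separator
      have count : ∀ m m', m ∈ P → m ∈ Q → m' ∈ P → m' ∈ Q →
          (K.neighborSet m ∩ (P \ Q)).ncard + (K.neighborSet m ∩ (Q \ P)).ncard +
            (K.neighborSet m ∩ {m'}).ncard ≤ 3 := by
        intro m m' hm hm' hmm hmm'
        rw [← hdeg m (memA (.inl hm)), ← ncard_union_eq, ← ncard_union_eq]
        · refine ncard_le_ncard ?_ (toFinite _)
          rintro z ((h | h) | h) <;> exact h.1
        · rw [disjoint_left]
          rintro z (h | h) ⟨-, rfl⟩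
          exacts [h.2.2 hmm', h.2.2 hmm]
        · exact hdis.mono inter_subset_right inter_subset_right
      -- The bound for the cut around `D` with `m` moved to its side: the edges counted are those
      -- from `m'` to `D`, from `m` to `E`, and possibly `mm'`.
      have shift : ∀ m m', m ∈ P → m ∈ Q → (∀ z, z ∈ P → z ∈ Q → z = m ∨ z = m') →
          3 ≤ (K.neighborSet m' ∩ (P \ Q)).ncard + (K.neighborSet m ∩ (Q \ P)).ncard +
            (K.neighborSet m ∩ {m'}).ncard := by
        intro m m' hm hm' hM
        refine (big (S := insert m (P \ Q)) ?_ (.inl rfl) (w := e) ⟨memA (.inr heQ), ?_⟩).trans ?_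
        · rintro z (rfl | hz)
          exacts [memA (.inl hm), hD hz]
        · rintro (rfl | h)
          exacts [heP hm, heP h.1]
        · have hsub : cutEdges K (insert m (P \ Q)) ⊆
              (fun u => (u, m')) '' (K.neighborSet m' ∩ (P \ Q)) ∪
              ((fun u => (m, u)) '' (K.neighborSet m ∩ (Q \ P)) ∪
              (fun u => (m, u)) '' (K.neighborSet m ∩ {m'})) := by
            rintro ⟨u, w⟩ ⟨hu, hw, huw⟩
            rcases hu with rfl | hu
            · have hwu : w ≠ u := fun h => hw (.inl h)
              have hwD : w ∉ P \ Q := fun h => hw (.inr h)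
              have hwQ : w ∈ Q := by
                by_contra hwQ
                exact hwD ⟨(ofA (hmem huw.symm)).resolve_right hwQ, hwQ⟩
              by_cases hwP : w ∈ P
              · rcases hM w hwP hwQ with rfl | rfl
                · exact absurd rfl hwu
                · exact .inr (.inr ⟨w, ⟨huw, rfl⟩, rfl⟩)
              · exact .inr (.inl ⟨w, ⟨huw, hwQ, hwP⟩, rfl⟩)
            · have h := leaveD u hu w (fun h => hw (.inr h)) huw
              rcases hM w h.1 h.2 with rfl | rfl
              · exact absurd (.inl rfl) hw
              · exact .inl ⟨u, ⟨huw.symm, hu⟩, rfl⟩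
          refine (ncard_le_ncard hsub (toFinite _)).trans ((ncard_union_le _ _).trans ?_)
          rw [add_assoc]
          refine Nat.add_le_add (ncard_image_le (toFinite _)) ((ncard_union_le _ _).trans ?_)
          exact Nat.add_le_add (ncard_image_le (toFinite _)) (ncard_image_le (toFinite _))
      have c1 := count m₁ m₂ hm₁.1 hm₁.2 hm₂.1 hm₂.2
      have c2 := count m₂ m₁ hm₂.1 hm₂.2 hm₁.1 hm₁.2
      have s1 := shift m₁ m₂ hm₁.1 hm₁.2 hM
      have s2 := shift m₂ m₁ hm₂.1 hm₂.2 fun z h h' => (hM z h h').symm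
      -- The cuts around `D` and `E` have at least six edges together, so they use up all edges at
      -- `m₁` and `m₂`, and `m₁m₂` is not an edge. The two shifted cuts then force `m₁` to have
      -- equally many neighbours in `D` and `E`, which is impossible for degree three.
      omega
    · have hbound : ∀ T : Set V, (∀ u ∈ T, ∀ w, w ∉ T → K.Adj u w → w ∈ P ∧ w ∈ Q) →
          (cutEdges K T).ncard ≤ (K.neighborSet m₁ ∩ T).ncard := by
        intro T hT
        refine (ncard_le_ncard (t := (fun u => (u, m₁)) '' (K.neighborSet m₁ ∩ T)) ?_
          (toFinite _)).trans (ncard_image_le (toFinite _))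
        rintro ⟨u, w⟩ ⟨hu, hw, huw⟩
        have h := hT u hu w hw huw
        obtain rfl := hM1 w h.1 h.2
        exact ⟨u, ⟨huw.symm, hu⟩, rfl⟩
      have bD := hbound _ leaveD
      have bE := hbound _ leaveE
      have hm₁ : m₁ ∈ A := by
        have : (K.neighborSet m₁ ∩ (P \ Q)).Nonempty := by
          rw [nonempty_iff_ne_empty]
          intro h0
          rw [h0, ncard_empty] at bD
          omega
        obtain ⟨z, hz, -⟩ := this
        exact hmem hz
      have := hdeg m₁ hm₁
      have hle : (K.neighborSet m₁ ∩ (P \ Q)).ncard + (K.neighborSet m₁ ∩ (Q \ P)).ncard ≤ 3 := by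
        rw [← this, ← ncard_union_eq]
        · refine ncard_le_ncard ?_ (toFinite _)
          rintro z (h | h) <;> exact h.1
        · exact hdis.mono inter_subset_right inter_subset_right
      omega

/-- The subgraph of `G` on the vertex set `A`, with the additional edge `xy`. -/
def sideGraph (G : SimpleGraph V) (A : Set V) (x y : V) : SimpleGraph V where
  Adj p q := (G.Adj p q ∧ p ∈ A ∧ q ∈ A) ∨ (x ≠ y ∧ ((p = x ∧ q = y) ∨ (p = y ∧ q = x)))
  symm := ⟨by
    rintro p q (h | h)
    · exact .inl ⟨h.1.symm, h.2.2, h.2.1⟩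
    · exact .inr (by tauto)⟩
  loopless := ⟨by
    rintro p (h | ⟨h, ⟨rfl, h'⟩ | ⟨rfl, h'⟩⟩)
    · exact G.irrefl h.1
    · exact h h'
    · exact h h'.symm⟩

theorem Bicon.cubicThreeConn [Finite V] (hG : Bicon G X) (hA : MinimalSide G X X)
    (hdeg : ∀ u ∈ X, (G.neighborSet u).ncard = 3) : CubicThreeConn G X := by
  refine cubicThreeConn_of_cut hG.mem_left hdeg ?_ ?_
  · refine nonempty_of_ncard_ne_zero ?_
    have := hG.three_le
    omega
  · intro S hS h2 h2'
    have := hA.min S hS (fun e => ?_) h2 h2'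
    · omega
    · rw [e, sdiff_self] at h2'
      simp at h2'

/-- The new edge `xy` makes up for the lost cut edges `xx'` and `yy'`: degrees are unchanged, and a
set that does not contain both `x` and `y` has at least as many cut edges as in `G`, where
minimality of `A` applies. -/
theorem MinimalSide.cubicThreeConn [Finite V] (hA : MinimalSide G X A)
    (hB : 2 ≤ (X \ A).ncard) (hdeg : ∀ u ∈ A, (G.neighborSet u).ncard = 3)
    (hc : TwoCut G A x y x' y') (hxy : ¬ G.Adj x y) : CubicThreeConn (sideGraph G A x y) A := by
  classical
  have hmem : ∀ {u w}, (sideGraph G A x y).Adj u w → u ∈ A := by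
    rintro u w (h | ⟨_, ⟨rfl, rfl⟩ | ⟨rfl, rfl⟩⟩)
    exacts [h.2.1, hc.x_mem, hc.y_mem]
  have hyx : ¬ G.Adj y x := fun h => hxy h.symm
  have hx := hc.x_mem
  have hy := hc.y_mem
  have hx' := hc.x'_notMem
  have hy' := hc.y'_notMem
  have hne := hc.ne
  have hcross := hc.eq_or
  refine cubicThreeConn_of_cut hmem ?_ ⟨x, hc.x_mem⟩ ?_
  · intro u hu
    rw [← hdeg u hu]
    refine le_antisymm ?_ ?_
    · refine ncard_neighborSet_le_of_injOn
        (fun w => if u = x ∧ w = y then x' else if u = y ∧ w = x then y' else w) ?_ ?_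
      · rintro w (h | ⟨_, ⟨rfl, rfl⟩ | ⟨rfl, rfl⟩⟩)
        · rw [if_neg, if_neg]
          · exact h.1
          · rintro ⟨rfl, rfl⟩
            exact hyx h.1
          · rintro ⟨rfl, rfl⟩
            exact hxy h.1
        · simpa using hc.adj_x
        · simpa [hne.symm] using hc.adj_y
      · intro z hz z' hz'
        have h1 := hmem hz.symm
        have h2 := hmem hz'.symm
        split_ifs <;> grind
    · refine ncard_neighborSet_le_of_injOn
        (fun w => if w ∈ A then w else if u = x then y else x) ?_ ?_
      · intro w hw
        by_cases hwA : w ∈ A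
        · simp only [hwA, if_true]
          exact .inl ⟨hw, hu, hwA⟩
        · simp only [hwA, if_false]
          rcases hcross u hu w hwA hw with ⟨rfl, rfl⟩ | ⟨rfl, rfl⟩
          · simp only [if_true]
            exact .inr ⟨hne, .inl ⟨rfl, rfl⟩⟩
          · simp only [hne.symm, if_false]
            exact .inr ⟨hne, .inr ⟨rfl, rfl⟩⟩
      · intro z hz z' hz'
        have h1 := hcross u hu z
        have h2 := hcross u hu z'
        split_ifs <;> grind
  · have key : ∀ S ⊆ A, S ≠ A → 2 ≤ S.ncard → ¬ (x ∈ S ∧ y ∈ S) →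
        3 ≤ (cutEdges (sideGraph G A x y) S).ncard := by
      intro S hS hne' h2 hxyS
      have h3 := hA.min S hS hne' h2
        (hB.trans (ncard_le_ncard (sdiff_subset_sdiff_right hS) (toFinite _)))
      have hle : (cutEdges G S).ncard ≤ (cutEdges (sideGraph G A x y) S).ncard := by
        refine ncard_le_ncard_of_injOn
          (fun e => if e.2 ∈ A then e else if e.1 = x then (x, y) else (y, x)) ?_ ?_ (toFinite _)
        · rintro ⟨u, w⟩ ⟨hu, hw, huw⟩
          by_cases hwA : w ∈ A
          · simp only [hwA, if_true]
            exact ⟨hu, hw, .inl ⟨huw, hS hu, hwA⟩⟩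
          · simp only [hwA, if_false]
            rcases hcross u (hS hu) w hwA huw with ⟨rfl, rfl⟩ | ⟨rfl, rfl⟩
            · simp only [if_true]
              exact ⟨hu, fun h => hxyS ⟨hu, h⟩, .inr ⟨hne, .inl ⟨rfl, rfl⟩⟩⟩
            · simp only [hne.symm, if_false]
              exact ⟨hu, fun h => hxyS ⟨h, hu⟩, .inr ⟨hne, .inr ⟨rfl, rfl⟩⟩⟩
        · rintro ⟨u, w⟩ ⟨hu, hw, huw⟩ ⟨u', w'⟩ ⟨hu', hw', huw'⟩
          have h1 := hcross u (hS hu) w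
          have h2 := hcross u' (hS hu') w'
          dsimp only at *
          split_ifs <;> grind
      omega
    intro S hS h2 h2'
    have hSA : S ≠ A := by
      rintro rfl
      simp at h2'
    by_cases hxyS : x ∈ S ∧ y ∈ S
    -- A set containing both `x` and `y` has the same cut as its complement in `A`, which contains
    -- neither.
    · have h3 := key (A \ S) sdiff_subset
        (fun e => (e.symm.subset hx).2 hxyS.1) h2' (fun h => h.1.2 hxyS.1)
      have : cutEdges (sideGraph G A x y) (A \ S) = cutEdges (sideGraph G A x y) Sᶜ := by
        ext ⟨u, w⟩
        simp only [cutEdges, mem_ofPred_eq, mem_sdiff, mem_compl_iff]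
        constructor
        · rintro ⟨h1, h2, h3⟩
          exact ⟨h1.2, fun h => h2 ⟨hmem h3.symm, h⟩, h3⟩
        · rintro ⟨h1, h2, h3⟩
          exact ⟨⟨hmem h3, h1⟩, fun h => h2 h.2, h3⟩
      rw [this, ncard_cutEdges_compl] at h3
      exact h3
    · exact key S hS hSA h2 hxyS

end GemSPQR

namespace GemSPQR
open Set

universe u

/-! ### Trees, in terms of cuts -/

section tree

variable {N N₁ N₂ : Type*} {T : SimpleGraph N}

/-- Every edge of a forest is the only edge between some set of nodes and its complement. -/
theorem exists_cut_of_isAcyclic (hT : T.IsAcyclic) {u w : N} (huw : T.Adj u w) :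
    ∃ Z : Set N, u ∈ Z ∧ w ∉ Z ∧ ∀ p ∈ Z, ∀ q, q ∉ Z → T.Adj p q → p = u ∧ q = w := by
  have hb := SimpleGraph.isAcyclic_iff_forall_adj_isBridge.1 hT huw
  rw [SimpleGraph.isBridge_iff] at hb
  refine ⟨{z | (T \ SimpleGraph.fromEdgeSet {s(u, w)}).Reachable u z}, .rfl, hb, ?_⟩
  intro p hp q hq hpq
  by_contra hne
  have hadj : ¬ (T \ SimpleGraph.fromEdgeSet {s(u, w)}).Adj p q := fun h =>
    hq (SimpleGraph.Reachable.trans hp h.reachable)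
  have he : s(p, q) = s(u, w) := by
    by_contra he
    exact hadj (by simp [hpq, he])
  rcases Sym2.eq_iff.1 he with h | ⟨rfl, rfl⟩
  · exact hne h
  · exact hq .rfl

theorem isTree_of_cut [Nonempty N] (hc : Conn T univ)
    (hcut : ∀ u w, T.Adj u w → ∃ Z : Set N, u ∈ Z ∧ w ∉ Z ∧
      ∀ p ∈ Z, ∀ q, q ∉ Z → T.Adj p q → p = u ∧ q = w) : T.IsTree := by
  refine ⟨⟨?_⟩, ?_⟩
  · intro u w
    obtain ⟨W, -⟩ := hc.exists_isPath (mem_univ u) (mem_univ w)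
    exact W.reachable
  · rw [SimpleGraph.isAcyclic_iff_forall_adj_isBridge]
    intro u w huw
    obtain ⟨Z, huZ, hwZ, hZ⟩ := hcut u w huw
    rw [SimpleGraph.isBridge_iff]
    rintro ⟨W⟩
    have key : ∀ a b, (T \ SimpleGraph.fromEdgeSet {s(u, w)}).Walk a b → a ∈ Z → b ∈ Z := by
      intro a b W
      induction W with
      | nil => exact id
      | @cons a b c hab _ ih =>
        intro ha
        refine ih ?_
        by_contra hb
        obtain ⟨rfl, rfl⟩ := hZ a ha b hb hab.1
        exact hab.2 (by simpa using hab.1.ne)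
    exact hwZ (key u w W huZ)

theorem conn_univ_of_isTree (hT : T.IsTree) : Conn T univ := by
  intro Z ⟨u, _, hu⟩ hcl w _
  obtain ⟨W⟩ := hT.connected.preconnected u w
  have key : ∀ a b, T.Walk a b → a ∈ Z → b ∈ Z := by
    intro a b W
    induction W with
    | nil => exact id
    | cons hab _ ih => exact fun ha => ih (hcl _ trivial ha _ trivial hab)
  exact key u w W hu

/-- The disjoint union of two graphs together with an edge between them. -/
def glueGraph (T₁ : SimpleGraph N₁) (T₂ : SimpleGraph N₂) (s : N₁) (l : N₂) :
    SimpleGraph (N₁ ⊕ N₂) where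
  Adj a b :=
    match a, b with
    | .inl a, .inl b => T₁.Adj a b
    | .inr a, .inr b => T₂.Adj a b
    | .inl a, .inr b => a = s ∧ b = l
    | .inr a, .inl b => b = s ∧ a = l
  symm := ⟨by
    rintro (a | a) (b | b) h
    exacts [(show T₁.Adj a b from h).symm, h, h, (show T₂.Adj a b from h).symm]⟩
  loopless := ⟨by
    rintro (a | a) h
    exacts [T₁.irrefl h, T₂.irrefl h]⟩

variable {T₁ : SimpleGraph N₁} {T₂ : SimpleGraph N₂} {s : N₁} {l : N₂}

theorem conn_inl {Y : Set N₁} (hY : Conn T₁ Y) : Conn (glueGraph T₁ T₂ s l) (Sum.inl '' Y) := by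
  rintro Z ⟨_, ⟨u, hu, rfl⟩, huZ⟩ hcl
  have := hY (Sum.inl ⁻¹' Z) ⟨u, hu, huZ⟩ fun a ha haZ b hb hab =>
    hcl _ ⟨a, ha, rfl⟩ haZ _ ⟨b, hb, rfl⟩ hab
  rintro _ ⟨w, hw, rfl⟩
  exact this hw

theorem conn_inr {Y : Set N₂} (hY : Conn T₂ Y) : Conn (glueGraph T₁ T₂ s l) (Sum.inr '' Y) := by
  rintro Z ⟨_, ⟨u, hu, rfl⟩, huZ⟩ hcl
  have := hY (Sum.inr ⁻¹' Z) ⟨u, hu, huZ⟩ fun a ha haZ b hb hab =>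
    hcl _ ⟨a, ha, rfl⟩ haZ _ ⟨b, hb, rfl⟩ hab
  rintro _ ⟨w, hw, rfl⟩
  exact this hw

theorem conn_sum {Y₁ : Set N₁} {Y₂ : Set N₂} (h₁ : Conn T₁ Y₁) (h₂ : Conn T₂ Y₂) (hs : s ∈ Y₁)
    (hl : l ∈ Y₂) : Conn (glueGraph T₁ T₂ s l) (Sum.inl '' Y₁ ∪ Sum.inr '' Y₂) :=
  (conn_inl h₁).union_adj (conn_inr h₂) ⟨s, hs, rfl⟩ ⟨l, hl, rfl⟩ ⟨rfl, rfl⟩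

/-- A cut of one tree at an edge extends to the union, with the entire other tree on the side of the
node to which it is attached. The new edge is cut off by one of the two trees. -/
theorem isTree_glueGraph (h₁ : T₁.IsTree) (h₂ : T₂.IsTree) : (glueGraph T₁ T₂ s l).IsTree := by
  have : Nonempty (N₁ ⊕ N₂) := ⟨.inl s⟩
  refine isTree_of_cut ?_ ?_
  · have := conn_sum (s := s) (l := l) (conn_univ_of_isTree h₁) (conn_univ_of_isTree h₂)
      trivial trivial
    convert this
    ext (z | z) <;> simp
  · have c₁ : ∀ u w, T₁.Adj u w → ∃ Z : Set (N₁ ⊕ N₂), .inl u ∈ Z ∧ .inl w ∉ Z ∧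
        ∀ p ∈ Z, ∀ q, q ∉ Z → (glueGraph T₁ T₂ s l).Adj p q → p = .inl u ∧ q = .inl w := by
      intro u w huw
      obtain ⟨Z, hu, hw, hZ⟩ := exists_cut_of_isAcyclic h₁.isAcyclic huw
      refine ⟨{z | z.elim (· ∈ Z) fun _ => s ∈ Z}, hu, hw, ?_⟩
      rintro (p | p) hp (q | q) hq hpq
      · obtain ⟨rfl, rfl⟩ := hZ p hp q hq hpq
        exact ⟨rfl, rfl⟩
      · obtain ⟨rfl, rfl⟩ := hpq
        exact absurd hp hq
      · obtain ⟨rfl, rfl⟩ := hpq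
        exact absurd hp hq
      · exact absurd hp hq
    have c₂ : ∀ u w, T₂.Adj u w → ∃ Z : Set (N₁ ⊕ N₂), .inr u ∈ Z ∧ .inr w ∉ Z ∧
        ∀ p ∈ Z, ∀ q, q ∉ Z → (glueGraph T₁ T₂ s l).Adj p q → p = .inr u ∧ q = .inr w := by
      intro u w huw
      obtain ⟨Z, hu, hw, hZ⟩ := exists_cut_of_isAcyclic h₂.isAcyclic huw
      refine ⟨{z | z.elim (fun _ => l ∈ Z) (· ∈ Z)}, hu, hw, ?_⟩
      rintro (p | p) hp (q | q) hq hpq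
      · exact absurd hp hq
      · obtain ⟨rfl, rfl⟩ := hpq
        exact absurd hp hq
      · obtain ⟨rfl, rfl⟩ := hpq
        exact absurd hp hq
      · obtain ⟨rfl, rfl⟩ := hZ p hp q hq hpq
        exact ⟨rfl, rfl⟩
    rintro (u | u) (w | w) huw
    · exact c₁ u w huw
    · obtain ⟨rfl, rfl⟩ := huw
      refine ⟨range Sum.inl, ⟨_, rfl⟩, by simp, ?_⟩
      rintro _ ⟨p, rfl⟩ (q | q) hq hpq
      · exact absurd ⟨q, rfl⟩ hq
      · obtain ⟨rfl, rfl⟩ := hpq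
        exact ⟨rfl, rfl⟩
    · obtain ⟨rfl, rfl⟩ := huw
      refine ⟨range Sum.inr, ⟨_, rfl⟩, by simp, ?_⟩
      rintro _ ⟨p, rfl⟩ (q | q) hq hpq
      · obtain ⟨rfl, rfl⟩ := hpq
        exact ⟨rfl, rfl⟩
      · exact absurd ⟨q, rfl⟩ hq
    · exact c₂ u w huw

theorem conn_starGraph {Y : Set N} {r : N} (hr : r ∈ Y) : Conn (SimpleGraph.starGraph r) Y := by
  rintro Z ⟨u, hu, huZ⟩ hcl w hw
  have hrZ : r ∈ Z := by
    by_cases h : u = r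
    · exact h ▸ huZ
    · exact hcl u hu huZ r hr (by simp [h])
  by_cases h : w = r
  · exact h ▸ hrZ
  · exact hcl r hr hrZ w hw (by simpa using Ne.symm h)

end tree

/-! ### Tree decompositions of adhesion two -/

variable {V : Type u} {G G₁ G₂ : SimpleGraph V} {X X₁ X₂ Y Z A : Set V}
  {a b c d h p q v w x y z x' y' : V}

/-- A tree decomposition of the vertex set `X` in which adjacent bags share exactly two vertices. -/
structure PreTree (X : Set V) where
  /-- the nodes -/
  Node : Type
  finite_node : Finite Node
  /-- the tree on the nodes -/
  tree : SimpleGraph Node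
  isTree : tree.IsTree
  /-- the bags -/
  bag : Node → Set V
  bag_subset : ∀ t, bag t ⊆ X
  adhesion : ∀ s t, tree.Adj s t → ∃ x y, x ≠ y ∧ bag s ∩ bag t = {x, y}
  exists_mem : ∀ x ∈ X, ∃ t, x ∈ bag t
  conn : ∀ x ∈ X, Conn tree {t | x ∈ bag t}

namespace PreTree

/-- Two decompositions whose vertex sets share exactly two vertices `x` and `y`, joined by an edge
between nodes whose bags contain `x` and `y`. -/
def glue (T₁ : PreTree X₁) (T₂ : PreTree X₂) (s : T₁.Node) (l : T₂.Node) (hxy : x ≠ y)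
    (hX : X₁ ∩ X₂ = {x, y}) (hs : {x, y} ⊆ T₁.bag s) (hl : {x, y} ⊆ T₂.bag l) :
    PreTree (X₁ ∪ X₂) where
  Node := T₁.Node ⊕ T₂.Node
  finite_node := by
    have := T₁.finite_node
    have := T₂.finite_node
    infer_instance
  tree := glueGraph T₁.tree T₂.tree s l
  isTree := isTree_glueGraph T₁.isTree T₂.isTree
  bag := Sum.elim T₁.bag T₂.bag
  bag_subset := by
    rintro (t | t)
    exacts [(T₁.bag_subset t).trans subset_union_left, (T₂.bag_subset t).trans subset_union_right]
  adhesion := by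
    have key : T₁.bag s ∩ T₂.bag l = {x, y} := by
      refine Subset.antisymm ?_ (subset_inter hs hl)
      rw [← hX]
      exact inter_subset_inter (T₁.bag_subset s) (T₂.bag_subset l)
    rintro (s' | s') (t | t) hst
    · exact T₁.adhesion s' t hst
    · obtain ⟨rfl, rfl⟩ := hst
      exact ⟨x, y, hxy, key⟩
    · obtain ⟨rfl, rfl⟩ := hst
      exact ⟨x, y, hxy, (inter_comm _ _).trans key⟩
    · exact T₂.adhesion s' t hst
  exists_mem := by
    rintro z (hz | hz)
    · obtain ⟨t, ht⟩ := T₁.exists_mem z hz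
      exact ⟨.inl t, ht⟩
    · obtain ⟨t, ht⟩ := T₂.exists_mem z hz
      exact ⟨.inr t, ht⟩
  conn := by
    intro z hz
    by_cases h₁ : z ∈ X₁ <;> by_cases h₂ : z ∈ X₂
    · have hzxy : z ∈ ({x, y} : Set V) := hX ▸ ⟨h₁, h₂⟩
      have := conn_sum (T₁.conn z h₁) (T₂.conn z h₂) (hs hzxy) (hl hzxy)
      convert this
      ext (t | t) <;> simp
    · have := conn_inl (T₂ := T₂.tree) (s := s) (l := l) (T₁.conn z h₁)
      convert this
      ext (t | t)
      · simp
      · simpa using fun h => h₂ (T₂.bag_subset t h)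
    · have := conn_inr (T₁ := T₁.tree) (s := s) (l := l) (T₂.conn z h₂)
      convert this
      ext (t | t)
      · simpa using fun h => h₁ (T₁.bag_subset t h)
      · simp
    · exact absurd hz (by simp [h₁, h₂])

/-- A star: the bag of the centre is `Y`, and each leaf has a bag of the form `{x, y, p i}`. -/
def star (Y : Set V) {k : ℕ} (p : Fin k → V) (hp : Function.Injective p) (hpY : ∀ i, p i ∉ Y)
    (hxy : x ≠ y) (hx : x ∈ Y) (hy : y ∈ Y) : PreTree (Y ∪ range p) where
  Node := Option (Fin k)
  finite_node := inferInstance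
  tree := SimpleGraph.starGraph none
  isTree := SimpleGraph.isTree_starGraph _
  bag t := t.elim Y fun i => {x, y, p i}
  bag_subset := by
    rintro (_ | i)
    · exact subset_union_left
    · rintro z (rfl | rfl | rfl)
      exacts [.inl hx, .inl hy, .inr ⟨i, rfl⟩]
  adhesion := by
    have key : ∀ i, Y ∩ {x, y, p i} = {x, y} := by
      intro i
      ext z
      simp only [mem_inter_iff, mem_insert_iff, mem_singleton_iff]
      constructor
      · rintro ⟨hz, rfl | rfl | rfl⟩
        exacts [.inl rfl, .inr rfl, absurd hz (hpY i)]
      · rintro (rfl | rfl)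
        exacts [⟨hx, .inl rfl⟩, ⟨hy, .inr (.inl rfl)⟩]
    rintro (_ | i) (_ | j) hst
    · exact absurd hst (SimpleGraph.irrefl _)
    · exact ⟨x, y, hxy, key j⟩
    · exact ⟨x, y, hxy, (inter_comm _ _).trans (key i)⟩
    · simp at hst
  exists_mem := by
    rintro z (hz | ⟨i, rfl⟩)
    · exact ⟨none, hz⟩
    · exact ⟨some i, .inr (.inr rfl)⟩
  conn := by
    rintro z hz
    by_cases hzY : z ∈ Y
    · exact conn_starGraph hzY
    · obtain ⟨i, rfl⟩ := hz.resolve_left hzY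
      convert conn_singleton (SimpleGraph.starGraph (none : Option (Fin k))) (some i)
      ext (_ | j)
      · simpa using hpY i
      · have h1 : p i ≠ x := fun h => hzY (h ▸ hx)
        have h2 : p i ≠ y := fun h => hzY (h ▸ hy)
        simp [h1, h2, hp.eq_iff, eq_comm]

open Classical in
/-- Add the new vertex `v` to the bag of `s`. -/
noncomputable def enlarge (T : PreTree X) (s : T.Node) (hv : v ∉ X) : PreTree (insert v X) where
  Node := T.Node
  finite_node := T.finite_node
  tree := T.tree
  isTree := T.isTree
  bag t := if t = s then insert v (T.bag t) else T.bag t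
  bag_subset := by
    intro t
    split_ifs
    · exact insert_subset_insert (T.bag_subset t)
    · exact (T.bag_subset t).trans (subset_insert _ _)
  adhesion := by
    intro s' t hst
    obtain ⟨x, y, hxy, h⟩ := T.adhesion s' t hst
    refine ⟨x, y, hxy, ?_⟩
    rw [← h]
    have hne := hst.ne
    have h1 : v ∉ T.bag s' := fun h => hv (T.bag_subset s' h)
    have h2 : v ∉ T.bag t := fun h => hv (T.bag_subset t h)
    by_cases e1 : s' = s
    · have e2 : t ≠ s := fun e => hne (e1.trans e.symm)
      simp only [e1, e2, if_true, if_false]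
      rw [insert_inter_of_notMem h2]
    · by_cases e2 : t = s
      · simp only [e1, e2, if_true, if_false]
        rw [inter_insert_of_notMem h1]
      · simp only [e1, e2, if_false]
  exists_mem := by
    rintro z (rfl | hz)
    · exact ⟨s, by simp⟩
    · obtain ⟨t, ht⟩ := T.exists_mem z hz
      refine ⟨t, ?_⟩
      split_ifs
      exacts [.inr ht, ht]
  conn := by
    intro z hz
    by_cases hzv : z = v
    · subst hzv
      convert conn_singleton T.tree s
      ext t
      have : z ∉ T.bag t := fun h => hv (T.bag_subset t h)
      by_cases e : t = s <;> simp [e, this]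
    · convert T.conn z (hz.resolve_left hzv) using 2
      ext t
      by_cases e : t = s <;> simp [e, hzv]

variable (T : PreTree X) (G : SimpleGraph V) (hm : Sym2 V → T.Node) (t : T.Node)

/-- The adjacency relation of the label of the node `t`, if the edges of `G` are distributed to the
nodes by `hm`. -/
def torso : SimpleGraph V where
  Adj p q := (G.Adj p q ∧ hm s(p, q) = t) ∨ ∃ s, T.tree.Adj t s ∧ p ≠ q ∧ T.bag t ∩ T.bag s = {p, q}
  symm := ⟨by
    rintro p q (h | ⟨s, h⟩)
    · exact .inl ⟨h.1.symm, Sym2.eq_swap (a := p) ▸ h.2⟩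
    · exact .inr ⟨s, h.1, h.2.1.symm, h.2.2.trans (pair_comm _ _)⟩⟩
  loopless := ⟨by
    rintro p (h | ⟨s, h⟩)
    · exact G.irrefl h.1
    · exact h.2.1 rfl⟩

/-- The label of `t` has no parallel edges. -/
structure SimpleAt : Prop where
  virtual : ∀ s s', T.tree.Adj t s → T.tree.Adj t s' → T.bag t ∩ T.bag s = T.bag t ∩ T.bag s' →
    s = s'
  real : ∀ s p q, T.tree.Adj t s → T.bag t ∩ T.bag s = {p, q} → G.Adj p q → hm s(p, q) ≠ t

/-- The label of `t` has two vertices and at least three edges. -/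
def DipoleAt : Prop :=
  ∃ x y, x ≠ y ∧ T.bag t = {x, y} ∧
    ((∃ s₁ s₂, s₁ ≠ s₂ ∧ T.tree.Adj t s₁ ∧ T.tree.Adj t s₂ ∧ G.Adj x y ∧ hm s(x, y) = t) ∨
      ∃ s₁ s₂ s₃, s₁ ≠ s₂ ∧ s₁ ≠ s₃ ∧ s₂ ≠ s₃ ∧ T.tree.Adj t s₁ ∧ T.tree.Adj t s₂ ∧
        T.tree.Adj t s₃)

end PreTree

/-- `K` is a connected `2`-regular graph with vertex set `Y`. -/
structure CycleOn (K : SimpleGraph V) (Y : Set V) : Prop where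
  mem_left : ∀ {p q}, K.Adj p q → p ∈ Y
  conn : Conn K Y
  degree : ∀ p ∈ Y, (K.neighborSet p).ncard = 2
  three_le : 3 ≤ Y.ncard

/-- A distribution of the edges of `G` to the nodes of the decomposition `T` such that the labels
are cycles, at the nodes in `S`, or else dipoles or `3`-connected cubic graphs, and the latter are
disjoint. -/
structure Good (T : PreTree X) (G : SimpleGraph V) (hm : Sym2 V → T.Node) (S : Set T.Node) :
    Prop where
  home : ∀ {p q}, G.Adj p q → p ∈ T.bag (hm s(p, q))
  simple : ∀ t ∈ S, T.SimpleAt G hm t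
  cycle : ∀ t ∈ S, CycleOn (T.torso G hm t) (T.bag t)
  other : ∀ t, t ∉ S → T.DipoleAt G hm t ∨
    (T.SimpleAt G hm t ∧ CubicThreeConn (T.torso G hm t) (T.bag t))
  alternate : ∀ s t, T.tree.Adj s t → (s ∈ S ↔ t ∉ S)
  unique : ∀ v s t, s ∉ S → t ∉ S → v ∈ T.bag s → v ∈ T.bag t → s = t
  -- This keeps vertices of degree two out of all P- and R-nodes, so that an edge between two of
  -- them can only be assigned to an S-node.
  degree : ∀ t, t ∉ S → ∀ v ∈ T.bag t, 3 ≤ (G.neighborSet v).ncard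

theorem Good.home' {T : PreTree X} {hm : Sym2 V → T.Node} {S : Set T.Node} (h : Good T G hm S)
    (hpq : G.Adj p q) : q ∈ T.bag (hm s(p, q)) := by
  rw [Sym2.eq_swap]
  exact h.home hpq.symm

end GemSPQR

namespace GemSPQR
open Set

universe u

variable {V : Type u} {G G₁ G₂ K K' : SimpleGraph V} {X X₁ X₂ Y Z A : Set V}
  {a b c d h p q u v w x y z x' y' : V}

/-! ### Gluing two decompositions -/

open Classical in
/-- The distribution of edges for a glued decomposition. -/
noncomputable def glueHome {N₁ N₂ : Type} (G₂ : SimpleGraph V) (hm₁ : Sym2 V → N₁)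
    (hm₂ : Sym2 V → N₂) (e : Sym2 V) : N₁ ⊕ N₂ :=
  if e ∈ G₂.edgeSet then .inr (hm₂ e) else .inl (hm₁ e)

theorem glueHome_eq_inl {N₁ N₂ : Type} {hm₁ : Sym2 V → N₁} {hm₂ : Sym2 V → N₂} {n : N₁} :
    glueHome G₂ hm₁ hm₂ s(p, q) = .inl n ↔ ¬ G₂.Adj p q ∧ hm₁ s(p, q) = n := by
  by_cases h : G₂.Adj p q <;> simp [glueHome, h]

theorem glueHome_eq_inr {N₁ N₂ : Type} {hm₁ : Sym2 V → N₁} {hm₂ : Sym2 V → N₂} {n : N₂} :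
    glueHome G₂ hm₁ hm₂ s(p, q) = .inr n ↔ G₂.Adj p q ∧ hm₂ s(p, q) = n := by
  by_cases h : G₂.Adj p q <;> simp [glueHome, h]

/-- The setting for gluing a decomposition `T₂` to a good decomposition `T₁`: the edge `ab` is
deleted from `G₁`, and the edges of `G₂`, which is decomposed by `T₂`, are added. -/
structure Gluing (T₁ : PreTree X₁) (T₂ : PreTree X₂) (G G₁ G₂ : SimpleGraph V)
    (hm₁ : Sym2 V → T₁.Node) (hm₂ : Sym2 V → T₂.Node) (S₁ : Set T₁.Node) (a b : V)
    (l : T₂.Node) : Prop where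
  good : Good T₁ G₁ hm₁ S₁
  adj : G₁.Adj a b
  inter : X₁ ∩ X₂ = {a, b}
  subset_bag : {a, b} ⊆ T₂.bag l
  adj_iff : ∀ p q, G.Adj p q ↔ (G₁.Adj p q ∧ s(p, q) ≠ s(a, b)) ∨ G₂.Adj p q
  home : ∀ {p q}, G₂.Adj p q → p ∈ T₂.bag (hm₂ s(p, q))
  degree : ∀ u ∈ X₁, 3 ≤ (G₁.neighborSet u).ncard → 3 ≤ (G.neighborSet u).ncard

namespace Gluing

variable {T₁ : PreTree X₁} {T₂ : PreTree X₂} {hm₁ : Sym2 V → T₁.Node} {hm₂ : Sym2 V → T₂.Node}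
  {S₁ : Set T₁.Node} {S₂ : Set T₂.Node} {l : T₂.Node}
  (D : Gluing T₁ T₂ G G₁ G₂ hm₁ hm₂ S₁ a b l)

include D

theorem subset_bag_left : {a, b} ⊆ T₁.bag (hm₁ s(a, b)) := by
  rintro z (rfl | rfl)
  exacts [D.good.home D.adj, D.good.home' D.adj]

theorem not_adj (h : G₁.Adj p q) (hne : s(p, q) ≠ s(a, b)) : ¬ G₂.Adj p q := by
  intro h₂
  have h₂' := D.home h₂.symm
  have hp : p ∈ ({a, b} : Set V) :=
    D.inter.subset ⟨T₁.bag_subset _ (D.good.home h), T₂.bag_subset _ (D.home h₂)⟩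
  have hq : q ∈ ({a, b} : Set V) :=
    D.inter.subset ⟨T₁.bag_subset _ (D.good.home' h), T₂.bag_subset _ h₂'⟩
  have := h.ne
  simp only [mem_insert_iff, mem_singleton_iff] at hp hq
  rw [Ne, Sym2.eq_iff] at hne
  grind

/-- The glued decomposition. -/
def tree : PreTree (X₁ ∪ X₂) :=
  T₁.glue T₂ (hm₁ s(a, b)) l D.adj.ne D.inter D.subset_bag_left D.subset_bag

theorem inter_bag : T₁.bag (hm₁ s(a, b)) ∩ T₂.bag l = {a, b} := by
  refine Subset.antisymm ?_ (subset_inter D.subset_bag_left D.subset_bag)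
  rw [← D.inter]
  exact inter_subset_inter (T₁.bag_subset _) (T₂.bag_subset l)

theorem adj_iff_inl {n : T₁.Node} : (G.Adj p q ∧ glueHome G₂ hm₁ hm₂ s(p, q) = .inl n) ↔
    (G₁.Adj p q ∧ hm₁ s(p, q) = n) ∧ s(p, q) ≠ s(a, b) := by
  rw [D.adj_iff, glueHome_eq_inl]
  have := D.not_adj (p := p) (q := q)
  tauto

theorem adj_iff_inr {n : T₂.Node} : (G.Adj p q ∧ glueHome G₂ hm₁ hm₂ s(p, q) = .inr n) ↔
    (G₂.Adj p q ∧ hm₂ s(p, q) = n) := by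
  rw [D.adj_iff, glueHome_eq_inr]
  tauto

/-- The edge `ab` lost by `G₁` comes back as the virtual edge leading to `l`, so the labels of the
old nodes do not change. -/
theorem torso_inl (n : T₁.Node) :
    D.tree.torso G (glueHome G₂ hm₁ hm₂) (.inl n) = T₁.torso G₁ hm₁ n := by
  ext p q
  change ((G.Adj p q ∧ glueHome G₂ hm₁ hm₂ s(p, q) = .inl n) ∨ _) ↔ (_ ∨ _)
  rw [D.adj_iff_inl]
  constructor
  · rintro (h | ⟨s | s, hs, hpq, hb⟩)
    · exact .inl h.1
    · exact .inr ⟨s, hs, hpq, hb⟩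
    · obtain ⟨rfl, rfl⟩ := hs
      have he : ({p, q} : Set V) = {a, b} := hb.symm.trans D.inter_bag
      left
      rcases pair_eq_pair_iff.1 he with ⟨rfl, rfl⟩ | ⟨rfl, rfl⟩
      · exact ⟨D.adj, rfl⟩
      · exact ⟨D.adj.symm, by rw [Sym2.eq_swap]⟩
  · rintro (h | ⟨s, hs, hpq, hb⟩)
    · by_cases hne : s(p, q) = s(a, b)
      · right
        refine ⟨.inr l, ⟨?_, rfl⟩, h.1.ne, ?_⟩
        · rw [← hne, h.2]
        · rw [← h.2, hne]
          refine D.inter_bag.trans ?_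
          rcases Sym2.eq_iff.1 hne with ⟨rfl, rfl⟩ | ⟨rfl, rfl⟩
          exacts [rfl, pair_comm _ _]
      · exact .inl ⟨h, hne⟩
    · exact .inr ⟨.inl s, hs, hpq, hb⟩

theorem torso_inr_of_ne {n : T₂.Node} (hn : n ≠ l) :
    D.tree.torso G (glueHome G₂ hm₁ hm₂) (.inr n) = T₂.torso G₂ hm₂ n := by
  ext p q
  change ((G.Adj p q ∧ glueHome G₂ hm₁ hm₂ s(p, q) = .inr n) ∨ _) ↔ (_ ∨ _)
  rw [D.adj_iff_inr]
  refine or_congr_right ⟨?_, fun ⟨s, h⟩ => ⟨.inr s, h⟩⟩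
  rintro ⟨s | s, hs, h⟩
  · exact absurd hs.2 hn
  · exact ⟨s, hs, h⟩

theorem torso_inr_self : (D.tree.torso G (glueHome G₂ hm₁ hm₂) (.inr l)).Adj p q ↔
    (T₂.torso G₂ hm₂ l).Adj p q ∨ (p = a ∧ q = b) ∨ (p = b ∧ q = a) := by
  change ((G.Adj p q ∧ glueHome G₂ hm₁ hm₂ s(p, q) = .inr l) ∨ _) ↔ (_ ∨ _) ∨ _
  rw [D.adj_iff_inr, or_assoc]
  refine or_congr_right ⟨?_, ?_⟩
  · rintro ⟨s | s, hs, hpq, hb⟩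
    · obtain ⟨rfl, -⟩ := hs
      right
      rw [← pair_eq_pair_iff]
      exact hb.symm.trans ((inter_comm _ _).trans D.inter_bag)
    · exact .inl ⟨s, hs, hpq, hb⟩
  · rintro (⟨s, h⟩ | h)
    · exact ⟨.inr s, h⟩
    · refine ⟨.inl (hm₁ s(a, b)), ⟨rfl, rfl⟩, ?_, ?_⟩
      · rcases h with ⟨rfl, rfl⟩ | ⟨rfl, rfl⟩
        exacts [D.adj.ne, D.adj.ne']
      · rw [pair_eq_pair_iff.2 h]
        exact (inter_comm _ _).trans D.inter_bag

/-- An old virtual edge parallel to the new one would already have been parallel to the real edge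
`ab` before gluing. -/
theorem simpleAt_inl {n : T₁.Node} (h : T₁.SimpleAt G₁ hm₁ n) :
    D.tree.SimpleAt G (glueHome G₂ hm₁ hm₂) (.inl n) := by
  constructor
  · rintro (s | s) (s' | s') hs hs' he
    · rw [h.virtual s s' hs hs' he]
    · obtain ⟨rfl, rfl⟩ := hs'
      exact absurd rfl (h.real s a b hs (he.trans D.inter_bag) D.adj)
    · obtain ⟨rfl, rfl⟩ := hs
      exact absurd rfl (h.real s' a b hs' (he.symm.trans D.inter_bag) D.adj)
    · rw [hs.2, hs'.2]
  · rintro (s | s) p q hs he hpq hh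
    · have := (D.adj_iff_inl).1 ⟨hpq, hh⟩
      exact h.real s p q hs he this.1.1 this.1.2
    · obtain ⟨rfl, rfl⟩ := hs
      refine ((D.adj_iff_inl).1 ⟨hpq, hh⟩).2 ?_
      rw [Sym2.eq_iff, ← pair_eq_pair_iff]
      exact he.symm.trans D.inter_bag

theorem dipoleAt_inl {n : T₁.Node} (h : T₁.DipoleAt G₁ hm₁ n) :
    D.tree.DipoleAt G (glueHome G₂ hm₁ hm₂) (.inl n) := by
  obtain ⟨x, y, hxy, hb, ⟨s₁, s₂, hne, h₁, h₂, hadj, hh⟩ | ⟨s₁, s₂, s₃, h12, h13, h23, h1, h2, h3⟩⟩ := h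
  · refine ⟨x, y, hxy, hb, ?_⟩
    -- If the real edge of the dipole is the one given up, the virtual edge leading to `l` takes its
    -- place as the third edge.
    by_cases he : s(x, y) = s(a, b)
    · right
      refine ⟨.inl s₁, .inl s₂, .inr l, Sum.inl_injective.ne hne, Sum.inl_ne_inr, Sum.inl_ne_inr, h₁, h₂, ?_, rfl⟩
      rw [← he, hh]
    · left
      have := (D.adj_iff_inl (n := n)).2 ⟨⟨hadj, hh⟩, he⟩
      exact ⟨.inl s₁, .inl s₂, Sum.inl_injective.ne hne, h₁, h₂, this.1, this.2⟩
  · exact ⟨x, y, hxy, hb, .inr ⟨.inl s₁, .inl s₂, .inl s₃, Sum.inl_injective.ne h12, Sum.inl_injective.ne h13,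
      Sum.inl_injective.ne h23, h1, h2, h3⟩⟩

theorem simpleAt_inr_of_ne {n : T₂.Node} (hn : n ≠ l) (h : T₂.SimpleAt G₂ hm₂ n) :
    D.tree.SimpleAt G (glueHome G₂ hm₁ hm₂) (.inr n) := by
  constructor
  · rintro (s | s) (s' | s') hs hs' he
    · exact absurd hs.2 hn
    · exact absurd hs.2 hn
    · exact absurd hs'.2 hn
    · rw [h.virtual s s' hs hs' he]
  · rintro (s | s) p q hs he hpq hh
    · exact absurd hs.2 hn
    · have := (D.adj_iff_inr).1 ⟨hpq, hh⟩
      exact h.real s p q hs he this.1 this.2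

/-- If the node `l` has no other neighbour, its label has no parallel edges. -/
theorem simpleAt_inr_self (hl : ∀ s, ¬ T₂.tree.Adj l s) (hab : ¬ G₂.Adj a b) :
    D.tree.SimpleAt G (glueHome G₂ hm₁ hm₂) (.inr l) := by
  constructor
  · rintro (s | s) (s' | s') hs hs' he
    · rw [hs.1, hs'.1]
    · exact absurd hs' (hl _)
    · exact absurd hs (hl _)
    · exact absurd hs (hl _)
  · rintro (s | s) p q hs he hpq hh
    · obtain ⟨rfl, -⟩ := hs
      have h₂ := ((D.adj_iff_inr).1 ⟨hpq, hh⟩).1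
      have he : ({p, q} : Set V) = {a, b} := he.symm.trans ((inter_comm _ _).trans D.inter_bag)
      rcases pair_eq_pair_iff.1 he with ⟨rfl, rfl⟩ | ⟨rfl, rfl⟩
      exacts [hab h₂, hab h₂.symm]
    · exact absurd hs (hl _)

/-- The three edges are the real edge `ab`, the virtual edge towards `T₁`, and the one towards `s`.
-/
theorem dipoleAt_inr (hl : T₂.bag l = {a, b}) (hab : G₂.Adj a b) (hh : hm₂ s(a, b) = l)
    {s : T₂.Node} (hs : T₂.tree.Adj l s) :
    D.tree.DipoleAt G (glueHome G₂ hm₁ hm₂) (.inr l) := by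
  have := (D.adj_iff_inr (n := l)).2 ⟨hab, hh⟩
  exact ⟨a, b, hab.ne, hl, .inl ⟨.inl (hm₁ s(a, b)), .inr s, Sum.inl_ne_inr, ⟨rfl, rfl⟩, hs, this.1,
    this.2⟩⟩

/-- The glued decomposition is good if its new nodes are. -/
theorem good_tree
    (hS : ∀ n ∈ S₂, D.tree.SimpleAt G (glueHome G₂ hm₁ hm₂) (.inr n) ∧
      CycleOn (D.tree.torso G (glueHome G₂ hm₁ hm₂) (.inr n)) (T₂.bag n))
    (hP : ∀ n, n ∉ S₂ → D.tree.DipoleAt G (glueHome G₂ hm₁ hm₂) (.inr n) ∨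
      (D.tree.SimpleAt G (glueHome G₂ hm₁ hm₂) (.inr n) ∧
        CubicThreeConn (D.tree.torso G (glueHome G₂ hm₁ hm₂) (.inr n)) (T₂.bag n)))
    (hl : l ∈ S₂ ↔ hm₁ s(a, b) ∉ S₁)
    (halt : ∀ s t, T₂.tree.Adj s t → (s ∈ S₂ ↔ t ∉ S₂))
    (huniq : ∀ v s t, s ∉ S₂ → t ∉ S₂ → v ∈ T₂.bag s → v ∈ T₂.bag t → s = t)
    (hcross : ∀ v s t, s ∉ S₁ → t ∉ S₂ → v ∈ T₁.bag s → v ∉ T₂.bag t)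
    (hdeg : ∀ t, t ∉ S₂ → ∀ v ∈ T₂.bag t, 3 ≤ (G.neighborSet v).ncard) :
    Good D.tree G (glueHome G₂ hm₁ hm₂) {n | Sum.elim (· ∈ S₁) (· ∈ S₂) n} where
  home := by
    intro p q hpq
    rcases hn : glueHome G₂ hm₁ hm₂ s(p, q) with n | n
    · have := ((D.adj_iff_inl).1 ⟨hpq, hn⟩).1
      have h := D.good.home this.1
      rw [this.2] at h
      exact h
    · have := (D.adj_iff_inr).1 ⟨hpq, hn⟩
      have h := D.home this.1
      rw [this.2] at h
      exact h
  simple := by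
    rintro (n | n) hn
    exacts [D.simpleAt_inl (D.good.simple n hn), (hS n hn).1]
  cycle := by
    rintro (n | n) hn
    · rw [D.torso_inl]
      exact D.good.cycle n hn
    · exact (hS n hn).2
  other := by
    rintro (n | n) hn
    · rw [D.torso_inl]
      exact (D.good.other n hn).imp D.dipoleAt_inl fun h => ⟨D.simpleAt_inl h.1, h.2⟩
    · exact hP n hn
  alternate := by
    rintro (s | s) (t | t) hst
    · exact D.good.alternate s t hst
    · obtain ⟨rfl, rfl⟩ := hst
      exact iff_not_comm.1 hl
    · obtain ⟨rfl, rfl⟩ := hst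
      exact hl
    · exact halt s t hst
  unique := by
    rintro v (s | s) (t | t) hs ht hvs hvt
    · rw [D.good.unique v s t hs ht hvs hvt]
    · exact absurd hvt (hcross v s t hs ht hvs)
    · exact absurd hvs (hcross v t s ht hs hvt)
    · rw [huniq v s t hs ht hvs hvt]
  degree := by
    rintro (t | t) ht v hv
    · exact D.degree v (T₁.bag_subset t hv) (D.good.degree t ht v hv)
    · exact hdeg t ht v hv

end Gluing

end GemSPQR

/-! ### Decompositions with one node, and lengthening a cycle by a vertex of degree two -/

namespace GemSPQR
open Set

universe u

variable {V : Type u} {G G₁ G₂ K K' : SimpleGraph V} {X X₁ X₂ Y Z A : Set V}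
  {a b c d h p q u v w x y z x' y' : V}

/-- `G` has a good decomposition with vertex set `X`. -/
def HasGoodTree (G : SimpleGraph V) (X : Set V) : Prop :=
  ∃ (T : PreTree X) (hm : Sym2 V → T.Node) (S : Set T.Node), Good T G hm S

/-- The decomposition with a single node. -/
def PreTree.single (X : Set V) : PreTree X where
  Node := Unit
  finite_node := inferInstance
  tree := ⊥
  isTree := ⟨.of_subsingleton, SimpleGraph.isAcyclic_bot⟩
  bag _ := X
  bag_subset _ := Subset.rfl
  adhesion _ _ h := h.elim
  exists_mem x hx := ⟨(), hx⟩
  conn x hx := by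
    convert conn_singleton (⊥ : SimpleGraph Unit) ()
    ext
    simpa using hx

/-- All edges go to the single node. -/
def PreTree.singleHome (X : Set V) : Sym2 V → (single X).Node := fun _ => ()

/-- The single node. -/
def PreTree.singleNode (X : Set V) : (single X).Node := ()

theorem PreTree.torso_single (hm : Sym2 V → (single X).Node) (t : (single X).Node) :
    (single X).torso G hm t = G := by
  ext p q
  constructor
  · rintro (h | ⟨s, h, -⟩)
    exacts [h.1, h.elim]
  · exact fun h => .inl ⟨h, rfl⟩

theorem PreTree.simpleAt_single (hm : Sym2 V → (single X).Node) (t : (single X).Node) :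
    (single X).SimpleAt G hm t :=
  ⟨fun _ _ h => h.elim, fun _ _ _ h => h.elim⟩

theorem hasGoodTree_of_cycleOn (hG : CycleOn G X) : HasGoodTree G X := by
  refine ⟨.single X, PreTree.singleHome X, univ, fun h => hG.mem_left h, fun t _ => PreTree.simpleAt_single _ t,
    fun t _ => ?_, fun t ht => absurd trivial ht, fun _ _ h => h.elim,
    fun _ t _ ht => absurd trivial ht, fun t ht => absurd trivial ht⟩
  rw [PreTree.torso_single]
  exact hG

theorem hasGoodTree_of_cubicThreeConn (hG : CubicThreeConn G X) : HasGoodTree G X := by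
  refine ⟨.single X, PreTree.singleHome X, ∅, fun h => hG.mem_left h, fun t ht => ht.elim,
    fun t ht => ht.elim, fun t _ => .inr ⟨PreTree.simpleAt_single _ t, ?_⟩, fun _ _ h => h.elim,
    fun _ _ _ _ _ _ _ => rfl, fun t _ v hv => (hG.degree v hv).ge⟩
  rw [PreTree.torso_single]
  exact hG

theorem cycleOn_triangle (hab : a ≠ b) (hav : a ≠ v) (hbv : b ≠ v)
    (hK : ∀ p q, K.Adj p q ↔ p ≠ q ∧ p ∈ ({a, b, v} : Set V) ∧ q ∈ ({a, b, v} : Set V)) :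
    CycleOn K {a, b, v} where
  mem_left h := ((hK _ _).1 h).2.1
  conn := by
    rintro Z ⟨u, hu, huZ⟩ hcl w hw
    by_cases e : u = w
    · exact e ▸ huZ
    · exact hcl u hu huZ w hw ((hK _ _).2 ⟨e, hu, hw⟩)
  degree := by
    have key : ∀ {a b v : V}, a ≠ b → a ≠ v → b ≠ v → (∀ p q, K.Adj p q ↔ p ≠ q ∧
        p ∈ ({a, b, v} : Set V) ∧ q ∈ ({a, b, v} : Set V)) → (K.neighborSet a).ncard = 2 := by
      intro a b v hab hav hbv hK
      refine ncard_neighborSet_of_adj_iff hbv fun w => ?_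
      rw [hK]
      simp only [mem_insert_iff, mem_singleton_iff]
      constructor
      · rintro ⟨h, -, rfl | h | h⟩
        exacts [absurd rfl h, .inl h, .inr h]
      · rintro (rfl | rfl)
        exacts [⟨hab, .inl trivial, .inr (.inl rfl)⟩, ⟨hav, .inl trivial, .inr (.inr rfl)⟩]
    rintro p (rfl | rfl | rfl)
    · exact key hab hav hbv hK
    · exact key hab.symm hbv hav (by rwa [insert_comm])
    · refine key hav.symm hbv.symm hab ?_
      have e : ({p, a, b} : Set V) = {a, b, p} := by
        ext
        simp only [mem_insert_iff, mem_singleton_iff]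
        tauto
      rwa [e]
  three_le := by
    rw [ncard_eq_three.2 ⟨a, b, v, hab, hav, hbv, rfl⟩]

/-- Subdividing an edge of a cycle. -/
theorem CycleOn.of_suppress [Finite V] (hK : CycleOn (suppress K v a b) Y)
    (hN : ∀ w, K.Adj v w ↔ w = a ∨ w = b) (hne : a ≠ b) (hab : ¬ K.Adj a b) :
    CycleOn K (insert v Y) := by
  have hva : K.Adj v a := (hN a).2 (.inl rfl)
  have hvb : K.Adj v b := (hN b).2 (.inr rfl)
  have hs : (suppress K v a b).Adj a b := .inr ⟨hne, .inl ⟨rfl, rfl⟩⟩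
  have haY := hK.mem_left hs
  have hbY := hK.mem_left hs.symm
  have hvY : v ∉ Y := by
    intro hvY
    have h2 := hK.degree v hvY
    have : (suppress K v a b).neighborSet v = ∅ := by
      ext z
      simp only [SimpleGraph.mem_neighborSet, mem_empty_iff_false, iff_false]
      rintro (h | ⟨_, ⟨h, _⟩ | ⟨h, _⟩⟩)
      exacts [h.2.1 rfl, hva.ne h, hvb.ne h]
    rw [this, ncard_empty] at h2
    omega
  refine ⟨?_, ?_, ?_, ?_⟩
  · intro p q hpq
    by_cases hp : p = v
    · exact .inl hp
    by_cases hq : q = v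
    · subst hq
      rcases (hN p).1 hpq.symm with rfl | rfl
      exacts [.inr haY, .inr hbY]
    · exact .inr (hK.mem_left (.inl ⟨hpq, hp, hq⟩))
  · rintro Z ⟨u, hu, huZ⟩ hcl
    obtain ⟨u, hu, huZ⟩ : ∃ u ∈ Y, u ∈ Z := by
      rcases hu with rfl | hu
      · exact ⟨a, haY, hcl _ (.inl rfl) huZ a (.inr haY) hva⟩
      · exact ⟨u, hu, huZ⟩
    have hYZ : Y ⊆ Z := by
      refine hK.conn Z ⟨u, hu, huZ⟩ ?_
      rintro p hp hpZ q hq (h | ⟨_, ⟨rfl, rfl⟩ | ⟨rfl, rfl⟩⟩)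
      · exact hcl p (.inr hp) hpZ q (.inr hq) h.1
      · exact hcl v (.inl rfl) (hcl _ (.inr hp) hpZ v (.inl rfl) hva.symm) _ (.inr hq) hvb
      · exact hcl v (.inl rfl) (hcl _ (.inr hp) hpZ v (.inl rfl) hvb.symm) _ (.inr hq) hva
    rintro w (rfl | hw)
    · exact hcl a (.inr haY) (hYZ haY) w (.inl rfl) hva.symm
    · exact hYZ hw
  · rintro p (rfl | hp)
    · exact ncard_neighborSet_of_adj_iff hne hN
    · rw [← ncard_neighborSet_suppress hN hne hab (ne_of_mem_of_not_mem hp hvY)]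
      exact hK.degree p hp
  · exact hK.three_le.trans (ncard_le_ncard (subset_insert _ _) (toFinite _))

namespace PreTree

variable {T : PreTree X} {s : T.Node} (hv : v ∉ X)

theorem enlarge_bag_self : (T.enlarge s hv).bag s = insert v (T.bag s) := if_pos rfl

theorem enlarge_bag_of_ne {t : T.Node} (ht : t ≠ s) : (T.enlarge s hv).bag t = T.bag t := if_neg ht

theorem enlarge_inter {t t' : T.Node} (h : T.tree.Adj t t') :
    (T.enlarge s hv).bag t ∩ (T.enlarge s hv).bag t' = T.bag t ∩ T.bag t' := by
  have h1 : v ∉ T.bag t := fun h => hv (T.bag_subset t h)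
  have h2 : v ∉ T.bag t' := fun h => hv (T.bag_subset t' h)
  by_cases e1 : t = s
  · subst e1
    rw [enlarge_bag_self, enlarge_bag_of_ne hv h.ne', insert_inter_of_notMem h2]
  · by_cases e2 : t' = s
    · subst e2
      rw [enlarge_bag_self, enlarge_bag_of_ne hv e1, inter_insert_of_notMem h1]
    · rw [enlarge_bag_of_ne hv e1, enlarge_bag_of_ne hv e2]

end PreTree

section enlarge

open Classical in
/-- The distribution of edges where those at `v` go to `s`. -/
noncomputable def enlargeHome {N : Type} (hm : Sym2 V → N) (v : V) (s : N) (e : Sym2 V) : N :=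
  if v ∈ e then s else hm e

theorem enlargeHome_of_ne {N : Type} {hm : Sym2 V → N} {s : N} (hp : p ≠ v) (hq : q ≠ v) :
    enlargeHome hm v s s(p, q) = hm s(p, q) :=
  if_neg (by simp [hp.symm, hq.symm])

theorem enlargeHome_left {N : Type} {hm : Sym2 V → N} {s : N} :
    enlargeHome hm v s s(v, q) = s := if_pos (by simp)

theorem enlargeHome_right {N : Type} {hm : Sym2 V → N} {s : N} :
    enlargeHome hm v s s(p, v) = s := if_pos (by simp)

variable [Finite V] {T : PreTree X} {hm : Sym2 V → T.Node} {S : Set T.Node}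

/-- A suppressed vertex of degree two is put into the cycle of the new edge. -/
theorem Good.enlarge (hT : Good T (suppress G v a b) hm S) (hv : v ∉ X)
    (hN : ∀ w, G.Adj v w ↔ w = a ∨ w = b) (hne : a ≠ b) (hab : ¬ G.Adj a b)
    (hS : hm s(a, b) ∈ S) :
    Good (T.enlarge (hm s(a, b)) hv) G (enlargeHome hm v (hm s(a, b))) S := by
  have hva : G.Adj v a := (hN a).2 (.inl rfl)
  have hvb : G.Adj v b := (hN b).2 (.inr rfl)
  have hsab : (suppress G v a b).Adj a b := .inr ⟨hne, .inl ⟨rfl, rfl⟩⟩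
  have has := hT.home hsab
  have hbs := hT.home' hsab
  set s := hm s(a, b) with hs_def
  have hvb' : ∀ t, v ∉ T.bag t := fun t h => hv (T.bag_subset t h)
  have hsub : ∀ t, T.bag t ⊆ (T.enlarge s hv).bag t := by
    intro t
    by_cases e : t = s
    · subst e
      rw [PreTree.enlarge_bag_self]
      exact subset_insert _ _
    · rw [PreTree.enlarge_bag_of_ne hv e]
  have hne_v : ∀ {t p q}, t ≠ s → enlargeHome hm v s s(p, q) = t → p ≠ v ∧ q ≠ v := by
    intro t p q ht he
    constructor
    · rintro rfl
      exact ht (he.symm.trans enlargeHome_left)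
    · rintro rfl
      exact ht (he.symm.trans enlargeHome_right)
  have htorso : ∀ t, t ≠ s → (T.enlarge s hv).torso G (enlargeHome hm v s) t =
      T.torso (suppress G v a b) hm t := by
    intro t ht
    ext p q
    change (_ ∨ _) ↔ (_ ∨ _)
    refine or_congr ⟨?_, ?_⟩ (exists_congr fun t' => ?_)
    · rintro ⟨hpq, he⟩
      obtain ⟨hp, hq⟩ := hne_v ht he
      exact ⟨.inl ⟨hpq, hp, hq⟩, (enlargeHome_of_ne hp hq).symm.trans he⟩
    · rintro ⟨h | ⟨_, ⟨rfl, rfl⟩ | ⟨rfl, rfl⟩⟩, he⟩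
      · exact ⟨h.1, (enlargeHome_of_ne h.2.1 h.2.2).trans he⟩
      · exact absurd he.symm ht
      · rw [Sym2.eq_swap] at he
        exact absurd he.symm ht
    · refine and_congr_right fun h => ?_
      rw [PreTree.enlarge_inter hv h]
  have hsimple : ∀ t, T.SimpleAt (suppress G v a b) hm t →
      (T.enlarge s hv).SimpleAt G (enlargeHome hm v s) t := by
    intro t ht
    constructor
    · intro t₁ t₂ h₁ h₂ he
      rw [PreTree.enlarge_inter hv h₁, PreTree.enlarge_inter hv h₂] at he
      exact ht.virtual t₁ t₂ h₁ h₂ he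
    · intro t' p q h he hpq hh
      rw [PreTree.enlarge_inter hv h] at he
      have hp : p ∈ T.bag t ∩ T.bag t' := he.symm.subset (.inl rfl)
      have hq : q ∈ T.bag t ∩ T.bag t' := he.symm.subset (.inr rfl)
      have hpv : p ≠ v := ne_of_mem_of_not_mem hp.1 (hvb' t)
      have hqv : q ≠ v := ne_of_mem_of_not_mem hq.1 (hvb' t)
      exact ht.real t' p q h he (.inl ⟨hpq, hpv, hqv⟩) ((enlargeHome_of_ne hpv hqv).symm.trans hh)
  refine ⟨?_, fun t ht => hsimple t (hT.simple t ht), ?_, ?_, hT.alternate, ?_, ?_⟩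
  · intro p q hpq
    have key : ∀ t, enlargeHome hm v s s(p, q) = t → p ∈ (T.enlarge s hv).bag t →
        p ∈ (T.enlarge s hv).bag (enlargeHome hm v s s(p, q)) := by
      rintro _ rfl h
      exact h
    by_cases hp : p = v
    · subst hp
      refine key s enlargeHome_left ?_
      rw [PreTree.enlarge_bag_self]
      exact .inl rfl
    by_cases hq : q = v
    · subst hq
      refine key s enlargeHome_right (hsub s ?_)
      rcases (hN p).1 hpq.symm with rfl | rfl
      exacts [has, hbs]
    · exact key _ (enlargeHome_of_ne hp hq) (hsub _ (hT.home (.inl ⟨hpq, hp, hq⟩)))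
  · intro t ht
    by_cases e : t = s
    · subst e
      rw [PreTree.enlarge_bag_self]
      -- The label of `s` is simple and has the real edge `ab`, so no virtual edge has these ends.
      have hlink : ∀ t', T.tree.Adj s t' → T.bag s ∩ T.bag t' ≠ {a, b} := fun t' h he =>
        (hT.simple s ht).real t' a b h he hsab rfl
      have hnv : ∀ {t' p q}, T.tree.Adj s t' →
          (T.enlarge s hv).bag s ∩ (T.enlarge s hv).bag t' = {p, q} →
          T.bag s ∩ T.bag t' = {p, q} ∧ p ≠ v ∧ q ≠ v := by
        intro t' p q h he
        rw [PreTree.enlarge_inter hv h] at he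
        exact ⟨he, ne_of_mem_of_not_mem (he.symm.subset (.inl rfl)).1 (hvb' s),
          ne_of_mem_of_not_mem (he.symm.subset (.inr rfl)).1 (hvb' s)⟩
      have hadj_v : ∀ w, ((T.enlarge s hv).torso G (enlargeHome hm v s) s).Adj v w ↔
          w = a ∨ w = b := by
        intro w
        rw [← hN]
        constructor
        · rintro (h | ⟨t', h, -, he⟩)
          exacts [h.1, absurd rfl (hnv h he).2.1]
        · exact fun h => .inl ⟨h, enlargeHome_left⟩
      have hnadj : ∀ p q, s(p, q) = s(a, b) →
          ¬ ((T.enlarge s hv).torso G (enlargeHome hm v s) s).Adj p q := by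
        rintro p q he (h | ⟨t', h, -, hb⟩)
        · rcases Sym2.eq_iff.1 he with ⟨rfl, rfl⟩ | ⟨rfl, rfl⟩
          exacts [hab h.1, hab h.1.symm]
        · refine hlink t' h ((hnv h hb).1.trans ?_)
          rwa [pair_eq_pair_iff, ← Sym2.eq_iff]
      -- Suppressing `v` in the new label of `s` gives back the old one, so the new label is a cycle
      -- with one more vertex.
      refine CycleOn.of_suppress (a := a) (b := b) ?_ hadj_v hne (hnadj a b rfl)
      convert hT.cycle s ht using 1
      ext p q
      constructor
      · rintro (⟨h | ⟨t', h, hpq, hb⟩, hp, hq⟩ | ⟨_, h⟩)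
        · exact .inl ⟨.inl ⟨h.1, hp, hq⟩, (enlargeHome_of_ne hp hq).symm.trans h.2⟩
        · exact .inr ⟨t', h, hpq, (hnv h hb).1⟩
        · rcases h with ⟨rfl, rfl⟩ | ⟨rfl, rfl⟩
          · exact .inl ⟨hsab, rfl⟩
          · exact .inl ⟨hsab.symm, by rw [Sym2.eq_swap]⟩
      · rintro (⟨⟨h, hp, hq⟩ | h, hh⟩ | ⟨t', h, hpq, hb⟩)
        · exact .inl ⟨.inl ⟨h, (enlargeHome_of_ne hp hq).trans hh⟩, hp, hq⟩
        · exact .inr h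
        · refine .inl ⟨.inr ⟨t', h, hpq, (PreTree.enlarge_inter hv h).trans hb⟩, ?_, ?_⟩
          exacts [ne_of_mem_of_not_mem (hb.symm.subset (.inl rfl)).1 (hvb' s),
            ne_of_mem_of_not_mem (hb.symm.subset (.inr rfl)).1 (hvb' s)]
    · rw [PreTree.enlarge_bag_of_ne hv e, htorso t e]
      exact hT.cycle t ht
  · intro t ht
    have e : t ≠ s := fun e => ht (e ▸ hS)
    rw [PreTree.enlarge_bag_of_ne hv e, htorso t e]
    refine (hT.other t ht).imp ?_ fun h => ⟨hsimple t h.1, h.2⟩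
    rintro ⟨x, y, hxy, hb, h⟩
    refine ⟨x, y, hxy, (PreTree.enlarge_bag_of_ne hv e).trans hb, h.imp ?_ id⟩
    rintro ⟨s₁, s₂, h12, h1, h2, hadj, hh⟩
    have hxv : x ≠ v := ne_of_mem_of_not_mem (hb.symm.subset (.inl rfl)) (hvb' t)
    have hyv : y ≠ v := ne_of_mem_of_not_mem (hb.symm.subset (.inr rfl)) (hvb' t)
    refine ⟨s₁, s₂, h12, h1, h2, ?_, (enlargeHome_of_ne hxv hyv).trans hh⟩
    rcases hadj with hadj | ⟨_, ⟨rfl, rfl⟩ | ⟨rfl, rfl⟩⟩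
    · exact hadj.1
    · exact absurd hh.symm e
    · rw [Sym2.eq_swap] at hh
      exact absurd hh.symm e
  · intro w t t' ht ht' hw hw'
    have e : t ≠ s := fun e => ht (e ▸ hS)
    have e' : t' ≠ s := fun e => ht' (e ▸ hS)
    rw [PreTree.enlarge_bag_of_ne hv e] at hw
    rw [PreTree.enlarge_bag_of_ne hv e'] at hw'
    exact hT.unique w t t' ht ht' hw hw'
  · intro t ht w hw
    have e : t ≠ s := fun e => ht (e ▸ hS)
    rw [PreTree.enlarge_bag_of_ne hv e] at hw
    rw [← ncard_neighborSet_suppress hN hne hab (ne_of_mem_of_not_mem hw (hvb' t))]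
    exact hT.degree t ht w hw

end enlarge

end GemSPQR

/-! ### Triangles for suppressed vertices of degree two -/

namespace GemSPQR
open Set

universe u

variable {V : Type u} {G G₁ G₂ K K' : SimpleGraph V} {X X₁ X₂ Y Z A : Set V}
  {a b c d h p q u v w x y z x' y' : V}

section suppress

variable [Finite V]

/-- A suppressed vertex of degree two is put into a new triangle. -/
theorem Good.glue_triangle {T : PreTree (X \ {v})} {hm : Sym2 V → T.Node} {S : Set T.Node}
    (hT : Good T (suppress G v a b) hm S) (hv : v ∈ X)
    (hN : ∀ w, G.Adj v w ↔ w = a ∨ w = b) (hne : a ≠ b) (hab : ¬ G.Adj a b)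
    (hS : hm s(a, b) ∉ S) : HasGoodTree G X := by
  have hva : G.Adj v a := (hN a).2 (.inl rfl)
  have hvb : G.Adj v b := (hN b).2 (.inr rfl)
  have hsab : (suppress G v a b).Adj a b := .inr ⟨hne, .inl ⟨rfl, rfl⟩⟩
  have ha := T.bag_subset _ (hT.home hsab)
  have hb := T.bag_subset _ (hT.home' hsab)
  -- The triangle has the two edges at `v` as real edges; its third edge is virtual and replaces the
  -- edge `ab` of the suppressed graph.
  let G₂ : SimpleGraph V :=
    { Adj := fun p q => G.Adj p q ∧ (p = v ∨ q = v)
      symm := ⟨fun p q h => ⟨h.1.symm, h.2.symm⟩⟩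
      loopless := ⟨fun p h => G.irrefl h.1⟩ }
  have hG₂ : ∀ p q, G₂.Adj p q ↔ (p = v ∧ (q = a ∨ q = b)) ∨ (q = v ∧ (p = a ∨ p = b)) := by
    intro p q
    rw [← hN, ← hN]
    constructor
    · rintro ⟨h, rfl | rfl⟩
      exacts [.inl ⟨rfl, h⟩, .inr ⟨rfl, h.symm⟩]
    · rintro (⟨rfl, h⟩ | ⟨rfl, h⟩)
      exacts [⟨h, .inl rfl⟩, ⟨h.symm, .inr rfl⟩]
  have D : Gluing T (PreTree.single {a, b, v}) G (suppress G v a b) G₂ hm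
      (PreTree.singleHome _) S a b (PreTree.singleNode _) := by
    refine ⟨hT, hsab, ?_, ?_, ?_, ?_, ?_⟩
    · ext z
      simp only [mem_inter_iff, mem_sdiff, mem_insert_iff, mem_singleton_iff]
      constructor
      · rintro ⟨h1, h2⟩
        have := h1.2
        tauto
      · rintro (rfl | rfl)
        exacts [⟨ha, .inl rfl⟩, ⟨hb, .inr (.inl rfl)⟩]
    · rintro z (rfl | rfl)
      exacts [.inl rfl, .inr (.inl rfl)]
    · intro p q
      constructor
      · intro h
        by_cases hp : p = v
        · exact .inr ⟨h, .inl hp⟩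
        by_cases hq : q = v
        · exact .inr ⟨h, .inr hq⟩
        refine .inl ⟨.inl ⟨h, hp, hq⟩, fun e => ?_⟩
        rcases Sym2.eq_iff.1 e with ⟨rfl, rfl⟩ | ⟨rfl, rfl⟩
        exacts [hab h, hab h.symm]
      · rintro (⟨h | ⟨_, h⟩, he⟩ | h)
        · exact h.1
        · exact absurd (Sym2.eq_iff.2 h) he
        · exact h.1
    · intro p q h
      change p ∈ ({a, b, v} : Set V)
      rcases (hG₂ p q).1 h with ⟨rfl, -⟩ | ⟨-, rfl | rfl⟩
      exacts [.inr (.inr rfl), .inl rfl, .inr (.inl rfl)]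
    · intro u hu h3
      rwa [← ncard_neighborSet_suppress hN hne hab hu.2]
  have hgood := D.good_tree (S₂ := univ) ?_ (fun n hn => absurd trivial hn) (iff_of_true trivial hS)
    (fun _ _ h => h.elim) (fun _ _ _ h => absurd trivial h) (fun _ _ _ _ h => absurd trivial h)
    (fun _ h => absurd trivial h)
  · have hX : X \ {v} ∪ {a, b, v} = X := by
      ext z
      simp only [mem_union, mem_sdiff, mem_insert_iff, mem_singleton_iff]
      constructor
      · rintro (h | rfl | rfl | rfl)
        exacts [h.1, ha.1, hb.1, hv]
      · tauto
    rw [← hX]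
    exact ⟨_, _, _, hgood⟩
  · intro n _
    obtain rfl : n = PreTree.singleNode _ := rfl
    refine ⟨D.simpleAt_inr_self (fun s h => h.elim) fun h => hab h.1, ?_⟩
    refine cycleOn_triangle hne hva.ne' hvb.ne' fun p q => ?_
    rw [D.torso_inr_self, PreTree.torso_single, hG₂]
    have h1 := hva.ne
    have h2 := hvb.ne
    simp only [mem_insert_iff, mem_singleton_iff]
    constructor
    · rintro ((⟨rfl, rfl | rfl⟩ | ⟨rfl, rfl | rfl⟩) | ⟨rfl, rfl⟩ | ⟨rfl, rfl⟩)
      all_goals simp [h1, h2, hne, h1.symm, h2.symm, hne.symm]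
    · rintro ⟨h, rfl | rfl | rfl, rfl | rfl | rfl⟩
      all_goals first | exact absurd rfl h | simp

/-- A good decomposition can be extended to a suppressed vertex of degree two. -/
theorem hasGoodTree_of_suppress (hT : HasGoodTree (suppress G v a b) (X \ {v})) (hv : v ∈ X)
    (hN : ∀ w, G.Adj v w ↔ w = a ∨ w = b) (hne : a ≠ b) (hab : ¬ G.Adj a b) :
    HasGoodTree G X := by
  obtain ⟨T, hm, S, hT⟩ := hT
  by_cases hS : hm s(a, b) ∈ S
  · have := hT.enlarge (fun h => h.2 rfl) hN hne hab hS
    have hX : insert v (X \ {v}) = X := by simpa using hv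
    rw [← hX]
    exact ⟨_, _, _, this⟩
  · exact hT.glue_triangle hv hN hne hab hS

end suppress

/-! ### Dipoles with triangles attached -/

section star

variable {k : ℕ} {f : Fin k → V}

open Classical in
/-- The edges at `f i` go to the leaf `i`, the others to the centre. -/
noncomputable def starHome (f : Fin k → V) (e : Sym2 V) : Option (Fin k) :=
  if h : ∃ i, f i ∈ e then some h.choose else none

/-- `x` and `y` are adjacent, and the other vertices are the `f i`, which have the neighbours `x`
and `y`. -/
structure DipoleStar (K : SimpleGraph V) (f : Fin k → V) (x y : V) : Prop where
  injective : Function.Injective f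
  notMem : ∀ i, f i ∉ ({x, y} : Set V)
  adj : K.Adj x y
  adj_iff : ∀ i w, K.Adj (f i) w ↔ w = x ∨ w = y
  mem_left : ∀ {p q}, K.Adj p q → p ∈ ({x, y} ∪ range f : Set V)

namespace DipoleStar

variable (D : DipoleStar K f x y)

include D

theorem home_adj {i : Fin k} (hw : w ∈ ({x, y} : Set V)) : starHome f s(f i, w) = some i := by
  have h : ∃ j, f j ∈ s(f i, w) := ⟨i, by simp⟩
  rw [starHome, dif_pos h]
  rcases Sym2.mem_iff.1 h.choose_spec with e | e
  · rw [D.injective e]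
  · exact absurd (e ▸ hw) (D.notMem _)

theorem home_xy : starHome f s(x, y) = none := by
  rw [starHome, dif_neg]
  rintro ⟨i, hi⟩
  exact D.notMem i (by simpa using hi)

/-- The decomposition into the dipole and the triangles. -/
def tree : PreTree ({x, y} ∪ range f) :=
  PreTree.star {x, y} f D.injective D.notMem D.adj.ne (.inl rfl) (.inr rfl)

/-- The distribution of edges for the decomposition into the dipole and the triangles. -/
noncomputable def home : Sym2 V → D.tree.Node := starHome f

theorem mem_home (h : K.Adj p q) : p ∈ D.tree.bag (D.home s(p, q)) := by
  have key : ∀ t, starHome f s(p, q) = t → p ∈ D.tree.bag t → p ∈ D.tree.bag (D.home s(p, q)) := by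
    rintro _ rfl h
    exact h
  rcases D.mem_left h with hp | ⟨i, rfl⟩
  · rcases D.mem_left h.symm with hq | ⟨i, rfl⟩
    · refine key none ?_ hp
      have := h.ne
      rcases hp with rfl | rfl <;> rcases hq with rfl | rfl
      · exact absurd rfl this
      · exact D.home_xy
      · rw [Sym2.eq_swap]
        exact D.home_xy
      · exact absurd rfl this
    · refine key (some i) ?_ ?_
      · rw [Sym2.eq_swap]
        exact D.home_adj hp
      · rcases hp with rfl | rfl
        exacts [.inl rfl, .inr (.inl rfl)]
  · refine key (some i) (D.home_adj ?_) (.inr (.inr rfl))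
    exact (D.adj_iff i q).1 h

theorem inter_some (i : Fin k) : D.tree.bag (some i) ∩ D.tree.bag none = {x, y} := by
  change ({x, y, f i} : Set V) ∩ {x, y} = {x, y}
  refine inter_eq_self_of_subset_right ?_
  rintro z (rfl | rfl)
  exacts [.inl rfl, .inr (.inl rfl)]

theorem simpleAt_some (i : Fin k) : D.tree.SimpleAt K D.home (some i) := by
  have hnone : ∀ s, D.tree.tree.Adj (some i) s → s = none := by
    rintro (_ | j) h
    · rfl
    · exact absurd h (by simp [tree, PreTree.star])
  constructor
  · intro s s' h h' _
    rw [hnone s h, hnone s' h']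
  · intro s p q h he hpq hh
    rw [hnone s h, D.inter_some i] at he
    have : starHome f s(p, q) = none := by
      rcases pair_eq_pair_iff.1 he with ⟨rfl, rfl⟩ | ⟨rfl, rfl⟩
      · exact D.home_xy
      · rw [Sym2.eq_swap]
        exact D.home_xy
    cases hh.symm.trans this

theorem cycleOn_some (i : Fin k) : CycleOn (D.tree.torso K D.home (some i)) {x, y, f i} := by
  have h1 : x ≠ f i := fun h => D.notMem i (.inl h.symm)
  have h2 : y ≠ f i := fun h => D.notMem i (.inr h.symm)
  refine cycleOn_triangle D.adj.ne h1 h2 ?_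
  have hx : (D.tree.torso K D.home (some i)).Adj (f i) x :=
    .inl ⟨(D.adj_iff i x).2 (.inl rfl), D.home_adj (.inl rfl)⟩
  have hy : (D.tree.torso K D.home (some i)).Adj (f i) y :=
    .inl ⟨(D.adj_iff i y).2 (.inr rfl), D.home_adj (.inr rfl)⟩
  have hxy : (D.tree.torso K D.home (some i)).Adj x y :=
    .inr ⟨none, by simp [tree, PreTree.star], D.adj.ne, D.inter_some i⟩
  intro p q
  constructor
  · refine fun h => ⟨h.ne, ?_⟩
    have key : ∀ p q, (D.tree.torso K D.home (some i)).Adj p q → p ∈ ({x, y, f i} : Set V) := by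
      rintro p q (⟨h, hh⟩ | ⟨s, h, -, hb⟩)
      · have := D.mem_home h
        rw [hh] at this
        exact this
      · exact (hb.symm.subset (.inl rfl)).1
    exact ⟨key p q h, key q p h.symm⟩
  · rintro ⟨h, rfl | rfl | rfl, rfl | rfl | rfl⟩
    all_goals first | exact absurd rfl h | assumption | exact SimpleGraph.Adj.symm (by assumption)

theorem none_adj (i : Fin k) : D.tree.tree.Adj none (some i) := by simp [tree, PreTree.star]

theorem mem_iff_of_adj {s t : D.tree.Node} (h : D.tree.tree.Adj s t) : s ≠ none ↔ ¬ t ≠ none := by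
  rcases s with _ | i <;> rcases t with _ | j
  · exact absurd h (SimpleGraph.irrefl _)
  · exact ⟨fun h => absurd rfl h, fun h => absurd (Option.some_ne_none j) h⟩
  · exact ⟨fun _ h => h rfl, fun _ => Option.some_ne_none i⟩
  · exact absurd h (by simp [tree, PreTree.star])

/-- Each end of the dipole has the other end, `f i`, and a further vertex `w` as neighbours. This
supplies the field `degree` of `Good` at the dipole. -/
theorem three_le_degree [Finite V] (hGK : ∀ p q, K.Adj p q → G.Adj p q) (hu : u ∈ ({x, y} : Set V))
    {i : Fin k} (hw : G.Adj u w) (hwi : w ≠ f i) (hwx : w ≠ x) (hwy : w ≠ y) :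
    3 ≤ (G.neighborSet u).ncard := by
  have key : ∀ z, z ≠ w → z ≠ f i → G.Adj u z → G.Adj u (f i) → 3 ≤ (G.neighborSet u).ncard := by
    intro z hzw hzi hz hi
    rw [← ncard_eq_three.2 ⟨z, w, f i, hzw, hzi, hwi, rfl⟩]
    refine ncard_le_ncard ?_ (toFinite _)
    rintro v (rfl | rfl | rfl) <;> assumption
  have hx := hGK _ _ ((D.adj_iff i x).2 (.inl rfl)).symm
  have hy := hGK _ _ ((D.adj_iff i y).2 (.inr rfl)).symm
  have hxy := hGK _ _ D.adj
  rcases hu with rfl | rfl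
  · exact key y hwy.symm (fun e => D.notMem i (.inr e.symm)) hxy hx
  · exact key x hwx.symm (fun e => D.notMem i (.inl e.symm)) hxy.symm hy

/-- Two distinct triangles are needed: with the real edge `xy` they give the dipole its three edges.
-/
theorem hasGoodTree [Finite V] {i j : Fin k} (hij : i ≠ j) :
    HasGoodTree K ({x, y} ∪ range f) := by
  refine ⟨D.tree, D.home, {n | n ≠ none}, D.mem_home, ?_, ?_, ?_, ?_, ?_, ?_⟩
  · rintro (_ | n) hn
    exacts [absurd rfl hn, D.simpleAt_some n]
  · rintro (_ | n) hn
    exacts [absurd rfl hn, D.cycleOn_some n]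
  · intro n hn
    obtain rfl := not_not.1 hn
    exact .inl ⟨x, y, D.adj.ne, rfl, .inl ⟨some i, some j, (Option.some_injective _).ne hij,
      D.none_adj i, D.none_adj j, D.adj, D.home_xy⟩⟩
  · exact fun s t => D.mem_iff_of_adj
  · intro v s t hs ht _ _
    exact (not_not.1 hs).trans (not_not.1 ht).symm
  · intro n hn v hv
    obtain rfl := not_not.1 hn
    have hv' : v ∈ ({x, y} : Set V) := hv
    refine D.three_le_degree (w := f j) (i := i) (fun _ _ h => h) hv' ?_ (D.injective.ne hij.symm)
      (fun e => D.notMem j (.inl e)) fun e => D.notMem j (.inr e)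
    exact ((D.adj_iff j v).2 hv').symm

end DipoleStar

end star

end GemSPQR

/-! ### Replacing one side of an edge cut of size two, and the main induction -/

namespace GemSPQR
open Set

universe u

variable {V : Type u} {G G₁ G₂ K K' : SimpleGraph V} {X X₁ X₂ Y Z A : Set V}
  {a b c d h p q u v w x y z x' y' : V}

/-- The graph obtained by deleting the edges within `A`, and then adding the edge `xy`. -/
def attach (G : SimpleGraph V) (A : Set V) (x y : V) : SimpleGraph V where
  Adj p q := (G.Adj p q ∧ (p ∉ A ∨ q ∉ A)) ∨ (x ≠ y ∧ ((p = x ∧ q = y) ∨ (p = y ∧ q = x)))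
  symm := ⟨by
    rintro p q (h | h)
    · exact .inl ⟨h.1.symm, h.2.symm⟩
    · exact .inr (by tauto)⟩
  loopless := ⟨by
    rintro p (h | ⟨h, ⟨rfl, h'⟩ | ⟨rfl, h'⟩⟩)
    · exact G.irrefl h.1
    · exact h h'
    · exact h h'.symm⟩

theorem attach_comm (G : SimpleGraph V) (A : Set V) (x y : V) : attach G A x y = attach G A y x := by
  ext p q
  simp only [attach]
  tauto

section twoCut

variable (hc : TwoCut G A x y x' y')

include hc

theorem TwoCut.attach_adj : (attach G A x y).Adj y w ↔ w = x ∨ w = y' := by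
  constructor
  · rintro (⟨h, h'⟩ | ⟨h, ⟨h', -⟩ | ⟨-, h'⟩⟩)
    · have hw : w ∉ A := h'.resolve_left fun h => h hc.y_mem
      rcases hc.eq_or y hc.y_mem w hw h with h | h
      exacts [absurd h.1.symm hc.ne, .inr h.2]
    · exact absurd h'.symm h
    · exact .inl h'
  · rintro (rfl | rfl)
    · exact .inr ⟨hc.ne, .inr ⟨rfl, rfl⟩⟩
    · exact .inl ⟨hc.adj_y, .inr hc.y'_notMem⟩

theorem TwoCut.attach_adj' : (attach G A x y).Adj x w ↔ w = y ∨ w = x' := by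
  rw [attach_comm]
  exact hc.swap.attach_adj

theorem TwoCut.ncard_attach : ((attach G A x y).neighborSet y).ncard = 2 :=
  ncard_neighborSet_of_adj_iff (a := x) (b := y') (fun e => hc.y'_notMem (e ▸ hc.x_mem))
    fun _ => hc.attach_adj

theorem TwoCut.ncard_attach' : ((attach G A x y).neighborSet x).ncard = 2 := by
  rw [attach_comm]
  exact hc.swap.ncard_attach

theorem TwoCut.attach_adj_of_notMem (hu : u ∉ A) : (attach G A x y).Adj u w ↔ G.Adj u w := by
  constructor
  · rintro (h | ⟨_, ⟨rfl, -⟩ | ⟨rfl, -⟩⟩)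
    exacts [h.1, absurd hc.x_mem hu, absurd hc.y_mem hu]
  · exact fun h => .inl ⟨h, .inl hu⟩

/-- In `attach G A x y` the side `A` has become the middle edge of a path `x' x y y'`, so
contracting the side is the same as suppressing `y` on this path. Hence a decomposition of the
contracted graph extends to `attach G A x y` by `hasGoodTree_of_suppress`. -/
theorem TwoCut.suppress_attach :
    suppress (attach G A x y) y x y' = contractSide G A x x' y' := by
  have hxy' : x ≠ y' := fun e => hc.y'_notMem (e ▸ hc.x_mem)
  have key : ∀ p, p ∉ A → ∀ q, (suppress (attach G A x y) y x y').Adj p q ↔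
      (contractSide G A x x' y').Adj p q := by
    intro p hp q
    have hpx : p ≠ x := fun e => hp (e ▸ hc.x_mem)
    have hpy : p ≠ y := fun e => hp (e ▸ hc.y_mem)
    change ((attach G A x y).Adj p q ∧ p ≠ y ∧ q ≠ y) ∨ _ ↔ _
    rw [hc.attach_adj_of_notMem hp]
    by_cases hq : q ∈ A
    · have h1 : G.Adj p q → (q = x ∧ p = x') ∨ (q = y ∧ p = y') := fun h =>
        hc.eq_or q hq p hp h.symm
      constructor
      · rintro (⟨h, -, hqy⟩ | ⟨-, ⟨h, -⟩ | ⟨h, h'⟩⟩)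
        · rcases h1 h with ⟨rfl, e⟩ | ⟨e, -⟩
          exacts [hc.contract_adj_right.2 (.inl e), absurd e hqy]
        · exact absurd h hpx
        · exact h' ▸ hc.contract_adj_right.2 (.inr h)
      · intro h
        rcases contractSide_adj h with h | ⟨h, -⟩ | ⟨h, -⟩ | ⟨h, h'⟩ | ⟨h, h'⟩
        · exact absurd hq h.2.2
        · exact absurd h hpx
        · exact absurd h hpx
        · subst h h'
          exact .inl ⟨hc.adj_x.symm, hpy, hc.ne⟩
        · exact .inr ⟨hxy', .inr ⟨h', h⟩⟩
    · rw [hc.adj_of_notMem hp hq]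
      constructor
      · rintro (h | ⟨-, ⟨h, -⟩ | ⟨-, h⟩⟩)
        exacts [h.1, absurd h hpx, absurd hc.x_mem (h ▸ hq)]
      · exact fun h => .inl ⟨h, hpy, fun e => hq (e ▸ hc.y_mem)⟩
  ext p q
  by_cases hp : p ∈ A
  · by_cases hq : q ∈ A
    · refine iff_of_false ?_ ?_
      · rintro (⟨h | ⟨-, h⟩, h1, h2⟩ | ⟨-, ⟨-, h⟩ | ⟨h, -⟩⟩)
        · exact h.2.elim (fun h => h hp) fun h => h hq
        · tauto
        · exact hc.y'_notMem (h ▸ hq)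
        · exact hc.y'_notMem (h ▸ hp)
      · intro h
        have h1 := hc.x'_notMem
        have h2 := hc.y'_notMem
        rcases contractSide_adj h with h | ⟨-, h⟩ | ⟨-, h⟩ | ⟨-, h⟩ | ⟨-, h⟩
        exacts [h.2.1 hp, h1 (h ▸ hq), h2 (h ▸ hq), h1 (h ▸ hp), h2 (h ▸ hp)]
    · rw [SimpleGraph.adj_comm, key q hq, SimpleGraph.adj_comm]
  · exact key p hp q

theorem TwoCut.hasGoodTree_attach [Finite V]
    (h : HasGoodTree (contractSide G A x x' y') (insert x (X \ A))) :
    HasGoodTree (attach G A x y) (insert y (insert x (X \ A))) := by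
  have hxy' : x ≠ y' := fun e => hc.y'_notMem (e ▸ hc.x_mem)
  refine hasGoodTree_of_suppress (a := x) (b := y') ?_ (.inl rfl) (fun w => hc.attach_adj) hxy' ?_
  · rw [hc.suppress_attach]
    convert h
    refine insert_sdiff_self_of_notMem ?_
    rintro (h | h)
    exacts [hc.ne h.symm, h.2 hc.y_mem]
  · rw [hc.attach_adj']
    rintro (h | h)
    exacts [hc.y'_notMem (h ▸ hc.y_mem), hc.ne' h.symm]

section good

variable {T₁ : PreTree (insert y (insert x (X \ A)))} {hm₁ : Sym2 V → T₁.Node} {S₁ : Set T₁.Node}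
  (hT : Good T₁ (attach G A x y) hm₁ S₁)

include hT

/-- The only vertices of `A` left in the decomposition are `x` and `y`. They have degree two in
`attach G A x y`, whereas the bags outside `S₁` require degree three. -/
theorem TwoCut.notMem_bag {s : T₁.Node} (hs : s ∉ S₁) (hv : v ∈ A) : v ∉ T₁.bag s := by
  intro hvs
  have h3 := hT.degree s hs v hvs
  have h2 : ((attach G A x y).neighborSet v).ncard = 2 := by
    rcases T₁.bag_subset s hvs with rfl | rfl | h
    · exact hc.ncard_attach
    · exact hc.ncard_attach'
    · exact absurd hv h.2
  omega

/-- Hence the node glued on along `xy` is adjacent to an S-node, as required when it is a P- or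
R-node. -/
theorem TwoCut.home_mem : hm₁ s(x, y) ∈ S₁ := by
  by_contra h
  exact hc.notMem_bag hT h hc.x_mem (hT.home (.inr ⟨hc.ne, .inl ⟨rfl, rfl⟩⟩))

/-- The edge `xy` is exchanged for the edges of `G` inside `A`. Degrees outside `A` are those in
`G`, and `x` and `y` are exempt from the degree condition because they have degree two. -/
theorem TwoCut.gluing {T₂ : PreTree A} {hm₂ : Sym2 V → T₂.Node} {l : T₂.Node}
    (hl : {x, y} ⊆ T₂.bag l) (home : ∀ {p q}, (within G A).Adj p q → p ∈ T₂.bag (hm₂ s(p, q))) :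
    Gluing T₁ T₂ G (attach G A x y) (within G A) hm₁ hm₂ S₁ x y l := by
  refine ⟨hT, .inr ⟨hc.ne, .inl ⟨rfl, rfl⟩⟩, ?_, hl, ?_, home, ?_⟩
  · have hx := hc.x_mem
    have hy := hc.y_mem
    ext z
    simp only [mem_inter_iff, mem_sdiff, mem_insert_iff, mem_singleton_iff]
    constructor
    · tauto
    · rintro (rfl | rfl) <;> tauto
  · intro p q
    constructor
    · intro h
      by_cases hA : p ∈ A ∧ q ∈ A
      · exact .inr ⟨h, hA⟩
      · refine .inl ⟨.inl ⟨h, not_and_or.1 hA⟩, fun e => hA ?_⟩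
        rcases Sym2.eq_iff.1 e with ⟨rfl, rfl⟩ | ⟨rfl, rfl⟩
        exacts [⟨hc.x_mem, hc.y_mem⟩, ⟨hc.y_mem, hc.x_mem⟩]
    · rintro (⟨h | ⟨_, h⟩, he⟩ | h)
      · exact h.1
      · exact absurd (Sym2.eq_iff.2 h) he
      · exact h.1
  · rintro u hu h3
    have key : u ∉ A → 3 ≤ (G.neighborSet u).ncard := by
      intro huA
      convert h3 using 2
      ext w
      exact (hc.attach_adj_of_notMem huA).symm
    rcases hu with rfl | rfl | h
    · rw [hc.ncard_attach] at h3
      omega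
    · rw [hc.ncard_attach'] at h3
      omega
    · exact key h.2

end good

theorem TwoCut.union_eq (hA : A ⊆ X) : insert y (insert x (X \ A)) ∪ A = X := by
  ext z
  simp only [mem_union, mem_sdiff, mem_insert_iff]
  constructor
  · rintro ((rfl | rfl | h) | h)
    exacts [hA hc.y_mem, hA hc.x_mem, h.1, hA h]
  · tauto

/-- The case that one side of an edge cut of size two is a cubic `3`-connected graph. -/
theorem TwoCut.hasGoodTree_of_cubic [Finite V] (hA : A ⊆ X)
    (h : HasGoodTree (contractSide G A x x' y') (insert x (X \ A))) (hxy : ¬ G.Adj x y)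
    (hdeg : ∀ u ∈ A, (G.neighborSet u).ncard = 3) (hK : CubicThreeConn (sideGraph G A x y) A) :
    HasGoodTree G X := by
  obtain ⟨T₁, hm₁, S₁, hT⟩ := hc.hasGoodTree_attach h
  have D := hc.gluing hT (T₂ := .single A) (hm₂ := PreTree.singleHome A)
    (l := PreTree.singleNode A) (by rintro z (rfl | rfl); exacts [hc.x_mem, hc.y_mem])
    (fun h => h.2.1)
  have hS := hc.home_mem hT
  have := D.good_tree (S₂ := ∅) (fun n hn => hn.elim) ?_ (iff_of_false id fun h => h hS)
    (fun _ _ h => h.elim) (fun _ _ _ _ _ _ _ => rfl)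
    (fun v s t hs _ hv hvt => hc.notMem_bag hT hs hvt hv) (fun t _ v hv => (hdeg v hv).ge)
  · rw [← hc.union_eq hA]
    exact ⟨_, _, _, this⟩
  · intro n _
    obtain rfl : n = PreTree.singleNode _ := rfl
    refine .inr ⟨D.simpleAt_inr_self (fun s h => h.elim) fun h => hxy h.1, ?_⟩
    convert hK using 1
    · ext p q
      rw [D.torso_inr_self, PreTree.torso_single]
      have := hc.ne
      change (G.Adj p q ∧ p ∈ A ∧ q ∈ A) ∨ _ ↔ _ ∨ _
      tauto
    · rfl

omit hc in
theorem DipoleOn.exists_dipoleStar [Finite V] (hD : DipoleOn G A x y) :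
    ∃ (k : ℕ) (f : Fin k → V), DipoleStar (within G A) f x y ∧ {x, y} ∪ range f = A := by
  obtain ⟨k, ⟨e⟩⟩ := Finite.exists_equiv_fin ↥(A \ {x, y})
  have hunion : {x, y} ∪ range (fun i => (e.symm i : V)) = A := by
    have : range (fun i => (e.symm i : V)) = A \ {x, y} := by
      ext z
      constructor
      · rintro ⟨i, rfl⟩
        exact (e.symm i).2
      · exact fun hz => ⟨e ⟨z, hz⟩, by simp⟩
    rw [this]
    refine union_sdiff_cancel ?_
    rintro z (rfl | rfl)
    exacts [hD.x_mem, hD.y_mem]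
  refine ⟨k, fun i => e.symm i, ⟨?_, fun i => (e.symm i).2.2, ⟨hD.adj, hD.x_mem, hD.y_mem⟩, ?_, ?_⟩,
    hunion⟩
  · exact Subtype.val_injective.comp e.symm.injective
  · intro i w
    have hi := (e.symm i).2
    have hi2 := hi.2
    simp only [mem_insert_iff, mem_singleton_iff, not_or] at hi2
    have hadj := hD.other _ hi.1 hi2.1 hi2.2 w
    constructor
    · exact fun h => hadj.1 h.1
    · intro h
      refine ⟨hadj.2 h, hi.1, ?_⟩
      rcases h with rfl | rfl
      exacts [hD.x_mem, hD.y_mem]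
  · intro p q h
    rw [hunion]
    exact h.2.1

/-- The case that one side of an edge cut of size two is a dipole. -/
theorem TwoCut.hasGoodTree_of_dipole [Finite V] (hA : A ⊆ X)
    (h : HasGoodTree (contractSide G A x x' y') (insert x (X \ A))) (hD : DipoleOn G A x y) :
    HasGoodTree G X := by
  obtain ⟨T₁, hm₁, S₁, hT⟩ := hc.hasGoodTree_attach h
  obtain ⟨k, f, hf, hfA⟩ := hD.exists_dipoleStar
  obtain ⟨u, huA, hux, huy⟩ := hD.exists_other
  obtain ⟨i, rfl⟩ : u ∈ range f := (hfA.symm.subset huA).resolve_left (by simp [hux, huy])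
  subst hfA
  have D := hc.gluing hT (T₂ := hf.tree) (hm₂ := hf.home) (l := none) Subset.rfl hf.mem_home
  have hS := hc.home_mem hT
  have hdeg : ∀ v ∈ ({x, y} : Set V), 3 ≤ (G.neighborSet v).ncard := by
    have hne : ∀ z, z ∉ ({x, y} ∪ range f : Set V) → z ≠ f i ∧ z ≠ x ∧ z ≠ y := fun z hz =>
      ⟨fun e => hz (e ▸ huA), fun e => hz (e ▸ hc.x_mem), fun e => hz (e ▸ hc.y_mem)⟩
    have hx := hne x' hc.x'_notMem
    have hy := hne y' hc.y'_notMem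
    rintro v (rfl | rfl)
    · exact hf.three_le_degree (fun _ _ h => h.1) (.inl rfl) hc.adj_x hx.1 hx.2.1 hx.2.2
    · exact hf.three_le_degree (fun _ _ h => h.1) (.inr rfl) hc.adj_y hy.1 hy.2.1 hy.2.2
  let S₂ : Set hf.tree.Node := {n | n ≠ none}
  have := D.good_tree (S₂ := S₂) ?_ ?_ (iff_of_false (fun h => h rfl) fun h => h hS)
    (fun _ _ h => hf.mem_iff_of_adj h)
    (fun v s t hs ht _ _ => (not_not.1 hs).trans (not_not.1 ht).symm) ?_ ?_
  · rw [← hc.union_eq hA]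
    exact ⟨_, _, _, this⟩
  · rintro (_ | n) hn
    · exact absurd rfl hn
    · have hn : (some n : Option (Fin k)) ≠ none := Option.some_ne_none n
      rw [D.torso_inr_of_ne hn]
      exact ⟨D.simpleAt_inr_of_ne hn (hf.simpleAt_some n), hf.cycleOn_some n⟩
  · intro n hn
    obtain rfl := not_not.1 hn
    exact .inl (D.dipoleAt_inr rfl hf.adj hf.home_xy (hf.none_adj i))
  · intro v s t hs _ hv hvt
    exact hc.notMem_bag hT hs (hf.tree.bag_subset t hvt) hv
  · intro n hn v hv
    obtain rfl := not_not.1 hn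
    exact hdeg v hv

end twoCut

/-- A `2`-connected graph in which every vertex of degree at least four has a partner has a good
decomposition. -/
theorem Bicon.hasGoodTree [Finite V] (hG : Bicon G X) (hP : HasPartners G) : HasGoodTree G X := by
  induction hn : X.ncard using Nat.strong_induction_on generalizing X G with
  | _ n ih =>
    subst hn
    by_cases ht : DegreeTwoInTriangle G
    · obtain ⟨A, hA⟩ := hG.exists_minimalSide
      -- At least two vertices are contracted to one, so induction applies to the contracted graph.
      have hrec : ∀ {x y x' y'}, TwoCut G A x y x' y' → 2 ≤ (X \ A).ncard →
          HasGoodTree (contractSide G A x x' y') (insert x (X \ A)) := by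
        intro x y x' y' hc hB
        refine ih _ ?_ (hc.bicon_contractSide hG hA.subset hB)
          (hc.hasPartners_contractSide hG hA.subset hP) rfl
        rw [ncard_insert_of_notMem (fun h => h.2 hc.x_mem) (toFinite _)]
        have := ncard_sdiff_add_ncard_of_subset hA.subset (toFinite _)
        have := hA.two_le
        omega
      cases hA.shape hG hP ht with
      | triangle a b v hav hbv hab hX hAX =>
        subst hX
        refine hasGoodTree_of_cycleOn (cycleOn_triangle hab.ne hav.ne hbv.ne fun p q => ?_)
        constructor
        · exact fun h => ⟨h.ne, hG.mem_left h, hG.mem_right h⟩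
        · rintro ⟨h, rfl | rfl | rfl, rfl | rfl | rfl⟩
          all_goals first | exact absurd rfl h | assumption | exact SimpleGraph.Adj.symm (by assumption)
      | dipole x y hD hAX u w hu hw huw hux huy hwx hwy =>
        subst hAX
        obtain ⟨k, f, hf, hfA⟩ := hD.exists_dipoleStar
        obtain ⟨i, rfl⟩ : u ∈ range f := (hfA.symm.subset hu).resolve_left (by simp [hux, huy])
        obtain ⟨j, rfl⟩ : w ∈ range f := (hfA.symm.subset hw).resolve_left (by simp [hwx, hwy])
        have := hf.hasGoodTree (i := i) (j := j) fun e => huw (e ▸ rfl)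
        rw [hfA] at this
        convert this using 1
        ext p q
        exact ⟨fun h => ⟨h, hG.mem_left h, hG.mem_right h⟩, fun h => h.1⟩
      | dipoleCut x y x' y' hD hc hB => exact hc.hasGoodTree_of_dipole hA.subset (hrec hc hB) hD
      | cubic hdeg hAX =>
        subst hAX
        exact hasGoodTree_of_cubicThreeConn (hG.cubicThreeConn hA hdeg)
      | cubicCut hdeg x y x' y' hc hxy hB =>
        exact hc.hasGoodTree_of_cubic hA.subset (hrec hc hB) hxy hdeg
          (hA.cubicThreeConn hB hdeg hc hxy)
    · simp only [DegreeTwoInTriangle, not_forall] at ht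
      obtain ⟨v, a, b, hN, hab⟩ := ht
      have hva : G.Adj v a := (hN a).2 (.inl rfl)
      have hv := hG.mem_left hva
      have hne := hG.ne_of_adj_iff hv hN
      refine hasGoodTree_of_suppress (ih _ ?_ (bicon_suppress hG hv hN hab)
        (hasPartners_suppress hP hN hne hab) rfl) hv hN hne hab
      exact ncard_sdiff_singleton_lt_of_mem hv (toFinite _)

end GemSPQR

namespace GemSPQR
open Set
open scoped Graph

universe u

/-! ### Types of labels -/

section types

variable {W : Type u} {H : SimpleGraph W}

theorem ncard_neighborSet_cycleGraph {n : ℕ} (hn : 3 ≤ n) (i : Fin n) :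
    ((SimpleGraph.cycleGraph n).neighborSet i).ncard = 2 := by
  obtain ⟨m, rfl⟩ := Nat.exists_eq_add_of_le' hn
  rw [← Nat.card_coe_set_eq, Nat.card_eq_fintype_card, SimpleGraph.card_neighborSet_eq_degree]
  exact SimpleGraph.cycleGraph_degree_three_le

/-- A finite connected `2`-regular graph is a cycle. -/
theorem exists_iso_cycleGraph [Finite W] [Nonempty W] (hc : H.Preconnected)
    (hd : ∀ v, (H.neighborSet v).ncard = 2) :
    ∃ n : ℕ, 3 ≤ n ∧ Nonempty (H ≃g SimpleGraph.cycleGraph n) := by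
  classical
  have := Fintype.ofFinite W
  obtain ⟨v⟩ := ‹Nonempty W›
  have hcyc : H.IsCycles := fun v _ => hd v
  have hne : ∀ v, (H.neighborSet v).Nonempty := fun v =>
    nonempty_of_ncard_ne_zero (by rw [hd v]; decide)
  -- A cycle through all vertices of the component, that is, of the graph.
  obtain ⟨p, hp, hverts⟩ := hcyc.exists_cycle_toSubgraph_verts_eq_connectedComponentSupp
    (c := H.connectedComponentMk v) (v := v) rfl (hne v)
  have hall : ∀ w, w ∈ p.support := by
    intro w
    rw [← SimpleGraph.Walk.mem_verts_toSubgraph, hverts]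
    exact SimpleGraph.ConnectedComponent.eq.2 (hc w v)
  refine ⟨p.length, hp.three_le_length, ?_⟩
  obtain ⟨f⟩ := (SimpleGraph.cycleGraph_isContained_iff hp.three_le_length).2 ⟨v, p, hp, rfl⟩
  have hcard : p.length = Nat.card W := by
    have h1 : p.support.tail.toFinset = p.support.toFinset := by
      ext w
      simp only [List.mem_toFinset]
      refine ⟨List.mem_of_mem_tail, fun h => ?_⟩
      rw [← SimpleGraph.Walk.cons_tail_support, List.mem_cons] at h
      rcases h with rfl | h
      · exact SimpleGraph.Walk.end_mem_tail_support hp.not_nil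
      · exact h
    have := List.toFinset_card_of_nodup hp.support_nodup
    rw [h1, List.length_tail, SimpleGraph.Walk.length_support, Nat.add_sub_cancel] at this
    rw [← this]
    have : p.support.toFinset = Finset.univ := by
      ext w
      simp [hall w]
    rw [this, Finset.card_univ, ← Nat.card_eq_fintype_card]
  have hbij : Function.Bijective f.toHom :=
    (Nat.bijective_iff_injective_and_card f.toHom).2 ⟨f.injective, by simpa using hcard⟩
  refine ⟨SimpleGraph.Iso.symm ⟨Equiv.ofBijective _ hbij, ?_⟩⟩
  intro i j
  change H.Adj (f.toHom i) (f.toHom j) ↔ _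
  refine ⟨fun h => ?_, f.toHom.map_adj⟩
  -- The spanning cycle already uses both neighbours of every vertex, so it has no chords.
  have hsub : f.toHom '' (SimpleGraph.cycleGraph p.length).neighborSet i ⊆
      H.neighborSet (f.toHom i) := by
    rintro _ ⟨j, hj, rfl⟩
    exact f.toHom.map_adj hj
  have hdeg := ncard_neighborSet_cycleGraph hp.three_le_length i
  have heq := eq_of_subset_of_ncard_le hsub (by rw [ncard_image_of_injective _ f.injective, hdeg, hd])
    (toFinite _)
  obtain ⟨j', hj', e⟩ := heq.symm.subset h
  rw [← f.injective e]
  exact hj'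

/-- The neighbourhood of `v` separates `v` from all other vertices, unless `v` is adjacent to all of
them, and then there are at least three. -/
theorem IsKConnected.three_le_degree (hH : IsKConnected 3 H) (v : W) :
    3 ≤ (H.neighborSet v).encard := by
  by_cases hB : {v}ᶜ ⊆ H.neighborSet v
  · have h1 : (3 : ℕ∞) < ENat.card W := hH.1
    rw [← encard_univ, ← union_compl_self {v}] at h1
    have h2 := encard_union_le {v} ({v}ᶜ)
    rw [encard_singleton] at h2
    have h3 := encard_le_encard hB
    have h4 : (3 : ℕ∞) < 1 + (H.neighborSet v).encard := h1.trans_le (h2.trans (by gcongr))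
    rw [add_comm] at h4
    exact Order.le_of_lt_add_one h4
  · have hv : v ∉ H.neighborSet v := H.irrefl
    have := hH.2 (insert v (H.neighborSet v)) {v}ᶜ ⟨?_, ?_⟩ (fun h => h (.inl rfl) rfl) ?_
    · refine this.trans (encard_le_encard ?_)
      rintro z ⟨rfl | h, h'⟩
      exacts [absurd rfl h', h]
    · ext z
      by_cases h : z = v <;> simp [h]
    · rintro z ⟨hz, hz'⟩ y ⟨hy, hy'⟩ hzy
      obtain rfl := not_not.1 hz'
      exact hy' (.inr hzy)
    · intro h
      refine hB fun z hz => (h hz).resolve_left hz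

end types

section label

variable {V : Type u} {E : Type*} {M : Graph V E}

theorem IsDipoleLabel.not_simple (h : IsDipoleLabel M) : ¬ M.Simple := by
  obtain ⟨x, y, F, hxy, hF, rfl⟩ := h
  intro hs
  have : F.Subsingleton := fun e he f hf => hs.eq_of_isLink (x := x) (y := y)
    ⟨he, .inl ⟨rfl, rfl⟩⟩ ⟨hf, .inl ⟨rfl, rfl⟩⟩
  have := hF.trans (encard_le_one_iff_subsingleton.2 this)
  exact absurd this (by decide)

theorem IsThreeConnectedLabel.not_isCycleLabel (h : IsThreeConnectedLabel M) :
    ¬ IsCycleLabel M := by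
  rintro ⟨-, n, hn, ⟨f⟩⟩
  have h3 := h.2.three_le_degree (f.symm ⟨0, by omega⟩)
  rw [← encard_congr (f.symm.mapNeighborSet _), ← Set.Finite.cast_ncard_eq (toFinite _),
    ncard_neighborSet_cycleGraph hn] at h3
  exact absurd h3 (by decide)

end label

end GemSPQR

/-! ### From good decompositions to SPQR trees -/

namespace GemSPQR
open Set
open scoped Graph

universe u

variable {V : Type u} {G K : SimpleGraph V} {X Y : Set V} {p q x y : V}

theorem CycleOn.exists_iso [Finite V] (hK : CycleOn K Y) :
    ∃ n : ℕ, 3 ≤ n ∧ Nonempty (K.induce Y ≃g SimpleGraph.cycleGraph n) := by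
  have hne : Y.Nonempty := nonempty_of_ncard_ne_zero (by have := hK.three_le; omega)
  have := hne.to_subtype
  refine exists_iso_cycleGraph (conn_iff_induce_preconnected.1 hK.conn) fun v => ?_
  rw [← hK.degree v v.2, ← ncard_image_of_injective _ Subtype.val_injective]
  congr 1
  ext w
  constructor
  · rintro ⟨w, hw, rfl⟩
    exact hw
  · exact fun hw => ⟨⟨w, hK.mem_left (SimpleGraph.Adj.symm hw)⟩, hw, rfl⟩

theorem CubicThreeConn.isKConnected [Finite V] (hK : CubicThreeConn K Y) :
    IsKConnected 3 (K.induce Y) := by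
  refine ⟨?_, ?_⟩
  · have h4 := hK.four_le
    rw [← encard_univ, ← Subtype.val_injective.encard_image, image_univ, Subtype.range_coe,
      ← Set.Finite.cast_ncard_eq (toFinite Y), Nat.cast_lt]
    omega
  · rintro A B ⟨hAB, hsep⟩ hA hB
    have hinj : Function.Injective ((↑) : Y → V) := Subtype.val_injective
    rw [← hinj.encard_image, image_inter hinj, ← Set.Finite.cast_ncard_eq (toFinite _),
      Nat.cast_le]
    refine hK.three_le _ _ ?_ ?_ ?_ ?_
    · rw [← image_union, hAB, image_univ, Subtype.range_coe]
    · rw [← image_sdiff hinj, ← image_sdiff hinj]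
      rintro _ ⟨a, ha, rfl⟩ _ ⟨b, hb, rfl⟩ h
      exact hsep a ha b hb h
    · rwa [image_subset_image_iff hinj]
    · rwa [image_subset_image_iff hinj]

namespace Good

variable {T : PreTree X} {hm : Sym2 V → T.Node} {S : Set T.Node} (hT : Good T G hm S)

/-- The label of the node `t`. -/
def label (t : T.Node) : Graph V (Sym2 V ⊕ T.Node) where
  vertexSet := T.bag t
  IsLink e p q := match e with
    | .inl e => e ∈ G.edgeSet ∧ hm e = t ∧ e = s(p, q)
    | .inr s => T.tree.Adj t s ∧ p ≠ q ∧ T.bag t ∩ T.bag s = {p, q}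
  isLink_symm := by
    rintro (e | s) -
    · exact ⟨fun p q h => ⟨h.1, h.2.1, h.2.2.trans Sym2.eq_swap⟩⟩
    · exact ⟨fun p q h => ⟨h.1, h.2.1.symm, h.2.2.trans (pair_comm _ _)⟩⟩
  eq_or_eq_of_isLink_of_isLink := by
    rintro (e | s) x y v w h h'
    · rcases Sym2.eq_iff.1 (h.2.2.symm.trans h'.2.2) with h | h
      exacts [.inl h.1, .inr h.1]
    · rcases pair_eq_pair_iff.1 (h.2.2.symm.trans h'.2.2) with h | h
      exacts [.inl h.1, .inr h.1]
  left_mem_of_isLink := by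
    rintro (e | s) x y h
    · obtain ⟨h, rfl, rfl⟩ := h
      exact hT.home h
    · exact (h.2.2.symm.subset (.inl rfl)).1

variable {t : T.Node}

theorem label_adj : (hT.label t).Adj p q ↔ (T.torso G hm t).Adj p q := by
  constructor
  · rintro ⟨e | s, h⟩
    · obtain ⟨h1, h2, rfl⟩ := h
      exact .inl ⟨h1, h2⟩
    · exact .inr ⟨s, h⟩
  · rintro (h | ⟨s, h⟩)
    · exact ⟨.inl s(p, q), h.1, h.2, rfl⟩
    · exact ⟨.inr s, h⟩

theorem toSimpleGraph_label :
    (hT.label t).toSimpleGraph = (T.torso G hm t).induce (T.bag t) := by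
  ext p q
  change p ≠ q ∧ (hT.label t).Adj p q ↔ (T.torso G hm t).Adj p q
  rw [hT.label_adj]
  exact ⟨fun h => h.2, fun h => ⟨fun e => h.ne (congrArg Subtype.val e), h⟩⟩

theorem label_ne {e : Sym2 V ⊕ T.Node} (h : (hT.label t).IsLink e p q) : p ≠ q :=
  ((hT.label_adj).1 ⟨e, h⟩).ne

theorem simple_label (h : T.SimpleAt G hm t) : (hT.label t).Simple where
  not_isLoopAt e x hx := hT.label_ne hx rfl
  eq_of_isLink := by
    rintro (e | s) (e' | s') x y he he'
    · rw [he.2.2, he'.2.2]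
    · obtain ⟨h1, h2, rfl⟩ := he
      exact absurd h2 (h.real s' x y he'.1 he'.2.2 h1)
    · obtain ⟨h1, h2, rfl⟩ := he'
      exact absurd h2 (h.real s x y he.1 he.2.2 h1)
    · rw [h.virtual s s' he.1 he'.1 (he.2.2.trans he'.2.2.symm)]

theorem isCycleLabel [Finite V] (ht : t ∈ S) : IsCycleLabel (hT.label t) := by
  refine ⟨hT.simple_label (hT.simple t ht), ?_⟩
  rw [toSimpleGraph_label]
  exact (hT.cycle t ht).exists_iso

theorem isDipoleLabel (h : T.DipoleAt G hm t) : IsDipoleLabel (hT.label t) := by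
  obtain ⟨x, y, hxy, hb, h⟩ := h
  refine ⟨x, y, (hT.label t).edgeSet, hxy, ?_, ?_⟩
  · have key : ∀ s, T.tree.Adj t s → (.inr s : Sym2 V ⊕ T.Node) ∈ (hT.label t).edgeSet := by
      intro s hs
      obtain ⟨p, q, hpq, hb⟩ := T.adhesion t s hs
      exact ⟨p, q, hs, hpq, hb⟩
    have key' : ∀ e₁ e₂ e₃, e₁ ≠ e₂ → e₁ ≠ e₃ → e₂ ≠ e₃ → e₁ ∈ (hT.label t).edgeSet →
        e₂ ∈ (hT.label t).edgeSet → e₃ ∈ (hT.label t).edgeSet →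
        3 ≤ (hT.label t).edgeSet.encard := by
      intro e₁ e₂ e₃ h12 h13 h23 h1 h2 h3
      rw [← encard_eq_three.2 ⟨e₁, e₂, e₃, h12, h13, h23, rfl⟩]
      refine encard_le_encard ?_
      rintro e (rfl | rfl | rfl) <;> assumption
    rcases h with ⟨s₁, s₂, hne, h1, h2, hadj, hh⟩ | ⟨s₁, s₂, s₃, h12, h13, h23, h1, h2, h3⟩
    · exact key' (.inl s(x, y)) (.inr s₁) (.inr s₂) Sum.inl_ne_inr Sum.inl_ne_inr
        (Sum.inr_injective.ne hne) ⟨x, y, hadj, hh, rfl⟩ (key _ h1) (key _ h2)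
    · exact key' (.inr s₁) (.inr s₂) (.inr s₃) (Sum.inr_injective.ne h12)
        (Sum.inr_injective.ne h13) (Sum.inr_injective.ne h23) (key _ h1) (key _ h2) (key _ h3)
  · have hlink : ∀ {e p q}, (hT.label t).IsLink e p q → (p = x ∧ q = y) ∨ (p = y ∧ q = x) := by
      intro e p q h
      have h1 : p ∈ ({x, y} : Set V) := hb ▸ h.left_mem
      have h2 : q ∈ ({x, y} : Set V) := hb ▸ h.right_mem
      have h3 := hT.label_ne h
      rcases h1 with rfl | rfl <;> rcases h2 with rfl | rfl
      exacts [absurd rfl h3, .inl ⟨rfl, rfl⟩, .inr ⟨rfl, rfl⟩, absurd rfl h3]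
    refine Graph.ext hb fun e p q => ⟨fun h => ⟨h.edge_mem, hlink h⟩, ?_⟩
    rintro ⟨⟨p', q', he⟩, hpq⟩
    have he : (hT.label t).IsLink e p' q' := he
    have he' := he.symm
    rcases hlink he with ⟨rfl, rfl⟩ | ⟨rfl, rfl⟩ <;> rcases hpq with ⟨rfl, rfl⟩ | ⟨rfl, rfl⟩
    exacts [he, he', he', he]

theorem isThreeConnectedLabel [Finite V] (h : T.SimpleAt G hm t)
    (hK : CubicThreeConn (T.torso G hm t) (T.bag t)) : IsThreeConnectedLabel (hT.label t) := by
  refine ⟨hT.simple_label h, ?_⟩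
  rw [toSimpleGraph_label]
  exact hK.isKConnected

theorem notMem_of_isDipoleLabel [Finite V] (h : IsDipoleLabel (hT.label t)) : t ∉ S :=
  fun ht => h.not_simple (hT.isCycleLabel ht).1

theorem notMem_of_isThreeConnectedLabel [Finite V] (h : IsThreeConnectedLabel (hT.label t)) :
    t ∉ S := fun ht => h.not_isCycleLabel (hT.isCycleLabel ht)

theorem isDipoleLabel_or [Finite V] (ht : t ∉ S) :
    IsDipoleLabel (hT.label t) ∨ IsThreeConnectedLabel (hT.label t) :=
  (hT.other t ht).imp hT.isDipoleLabel fun h => hT.isThreeConnectedLabel h.1 h.2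

theorem mem_of_isCycleLabel [Finite V] (h : IsCycleLabel (hT.label t)) : t ∈ S := by
  by_contra ht
  rcases hT.isDipoleLabel_or ht with h' | h'
  exacts [h'.not_simple h.1, h'.not_isCycleLabel h]

/-- A good decomposition as an SPQR tree. -/
def toSPQRTree [Finite V] (hX : X = univ) : SPQRTree G where
  Node := T.Node
  finite_node := T.finite_node
  tree := T.tree
  isTree := T.isTree
  label := hT.label
  label_type t := by
    by_cases ht : t ∈ S
    · exact .inl (hT.isCycleLabel ht)
    · rcases hT.isDipoleLabel_or ht with h | h
      exacts [.inr (.inl h), .inr (.inr (.inl h))]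
  real_mem := by
    rintro t e ⟨x, y, h⟩
    exact h.1
  real_ends t e x y h := h.2.2
  real_unique := by
    intro e he
    refine ⟨hm e, ?_, ?_⟩
    · induction e with
      | _ x y => exact ⟨x, y, he, rfl, rfl⟩
    · rintro t ⟨x, y, h⟩
      exact h.2.1.symm
  virtual_mem s t := by
    refine ⟨fun ⟨x, y, h⟩ => h.1, fun h => ?_⟩
    obtain ⟨x, y, hxy, hb⟩ := T.adhesion s t h
    exact ⟨x, y, h, hxy, hb⟩
  virtual_ends s t x y h := ⟨h.1.symm, h.2.1, (inter_comm _ _).trans h.2.2⟩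
  adhesion s t x y h := h.2.2
  vertex_subtree x := by
    obtain ⟨t, ht⟩ := T.exists_mem x (hX ▸ mem_univ x)
    exact { preconnected := conn_iff_induce_preconnected.1 (T.conn x (hX ▸ mem_univ x))
            nonempty := ⟨⟨t, ht⟩⟩ }
  not_adj_S s t h := fun ⟨hs, ht⟩ =>
    (hT.alternate s t h).1 (hT.mem_of_isCycleLabel hs) (hT.mem_of_isCycleLabel ht)
  not_adj_P s t h := fun ⟨hs, ht⟩ => hT.notMem_of_isDipoleLabel hs
    ((hT.alternate s t h).2 (hT.notMem_of_isDipoleLabel ht))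

theorem encard_le_three [Finite V] (h : IsThreeConnectedLabel (hT.label t)) :
    {y | (hT.label t).Adj x y}.encard ≤ 3 := by
  rcases hT.other t (hT.notMem_of_isThreeConnectedLabel h) with h' | ⟨-, h'⟩
  · exact absurd h.1 (hT.isDipoleLabel h').not_simple
  · have : {y | (hT.label t).Adj x y} = (T.torso G hm t).neighborSet x := by
      ext y
      exact hT.label_adj
    rw [this]
    by_cases hx : x ∈ T.bag t
    · rw [← Set.Finite.cast_ncard_eq (toFinite _), h'.degree x hx]
      rfl
    · have : (T.torso G hm t).neighborSet x = ∅ :=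
        eq_empty_of_forall_notMem fun y hy => hx (h'.mem_left hy)
      rw [this, encard_empty]
      exact zero_le

end Good

/-- A `2`-connected graph without butterflies has an SPQR tree with the two properties of the
theorem. -/
theorem exists_sPQRTree [Finite V] (hG : Bicon G univ) (hb : ∀ h, ¬ Butterfly G h) :
    ∃ T : SPQRTree G,
      (∀ t : T.Node, T.IsRNode t →
        ∀ x ∈ (T.label t).vertexSet, {y | (T.label t).Adj x y}.encard ≤ 3) ∧
      (∀ u : V, ¬ ∃ s t : T.Node, s ≠ t ∧
        (T.IsPNode s ∨ T.IsRNode s) ∧ (T.IsPNode t ∨ T.IsRNode t) ∧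
        u ∈ (T.label s).vertexSet ∧ u ∈ (T.label t).vertexSet) := by
  obtain ⟨T, hm, S, hT⟩ := hG.hasGoodTree (hG.hasPartners hb)
  refine ⟨hT.toSPQRTree rfl, fun t ht x _ => hT.encard_le_three ht, ?_⟩
  rintro u ⟨s, t, hst, hs, ht, hus, hut⟩
  exact hst (hT.unique u s t (hs.elim hT.notMem_of_isDipoleLabel hT.notMem_of_isThreeConnectedLabel)
    (ht.elim hT.notMem_of_isDipoleLabel hT.notMem_of_isThreeConnectedLabel) hus hut)

end GemSPQR

namespace GemSPQR
open Set

universe u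

/-! ### From butterflies to topological minors -/

section mk

variable {W : Type} {V : Type u} {H : SimpleGraph W} {G : SimpleGraph V}

/-- A topological minor model from connected sets that contain the paths. -/
theorem isTopologicalMinor_of_conn (f : W → ℕ) (hf : Function.Injective f) (branch : W → V)
    (hb : Function.Injective branch) (S : W → W → Set V)
    (hconn : ∀ a b, H.Adj a b → f a < f b → Conn G (S a b))
    (hl : ∀ a b, H.Adj a b → f a < f b → branch a ∈ S a b)
    (hr : ∀ a b, H.Adj a b → f a < f b → branch b ∈ S a b)
    (hS : ∀ a b, H.Adj a b → f a < f b → ∀ c, branch c ∈ S a b → c = a ∨ c = b)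
    (hd : ∀ a b, H.Adj a b → f a < f b → ∀ a' b', H.Adj a' b' → f a' < f b' →
      (a ≠ a' ∨ b ≠ b') → ∀ x ∈ S a b, x ∈ S a' b' → x ∈ range branch) :
    IsTopologicalMinor H G := by
  choose P hP hPS using fun a b (h : H.Adj a b) (hab : f a < f b) =>
    (hconn a b h hab).exists_isPath (hl a b h hab) (hr a b h hab)
  have hlt : ∀ {a b}, H.Adj a b → ¬ f a < f b → f b < f a := fun h hab =>
    lt_of_le_of_ne (not_lt.1 hab) fun e => h.ne (hf e.symm)
  -- The path is chosen in the direction in which `f` increases and reversed for the other one, so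
  -- that both directions of an edge get the same path.
  let path : ∀ a b, H.Adj a b → G.Walk (branch a) (branch b) := fun a b h =>
    if hab : f a < f b then P a b h hab else (P b a h.symm (hlt h hab)).reverse
  have hsupp : ∀ a b (h : H.Adj a b), ∃ a' b', ∃ h' : H.Adj a' b', f a' < f b' ∧
      s(a, b) = s(a', b') ∧ ∀ x, x ∈ (path a b h).support → x ∈ S a' b' := by
    intro a b h
    by_cases hab : f a < f b
    · refine ⟨a, b, h, hab, rfl, fun x hx => ?_⟩
      simp only [path, dif_pos hab] at hx
      exact hPS a b h hab x hx
    · refine ⟨b, a, h.symm, hlt h hab, Sym2.eq_swap, fun x hx => ?_⟩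
      simp only [path, dif_neg hab, SimpleGraph.Walk.support_reverse, List.mem_reverse] at hx
      exact hPS b a h.symm (hlt h hab) x hx
  refine ⟨⟨branch, hb, path, ?_, ?_, ?_, ?_⟩⟩
  · intro a b h
    by_cases hab : f a < f b
    · simp only [path, dif_pos hab]
      exact hP a b h hab
    · simp only [path, dif_neg hab]
      exact (hP b a h.symm (hlt h hab)).reverse
  · intro a b h
    by_cases hab : f a < f b
    · simp only [path, dif_pos hab, dif_neg hab.not_gt]
    · simp only [path, dif_neg hab, dif_pos (hlt h hab), SimpleGraph.Walk.reverse_reverse]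
  · intro a b h c hc
    obtain ⟨a', b', h', hab, he, hx⟩ := hsupp a b h
    have := hS a' b' h' hab c (hx _ hc)
    have hc' : c ∈ s(a, b) := by rw [he]; simpa using this
    simpa using hc'
  · intro a b h a' b' h' hne x hx hx'
    obtain ⟨a₁, b₁, h₁, hab₁, he₁, hx₁⟩ := hsupp a b h
    obtain ⟨a₂, b₂, h₂, hab₂, he₂, hx₂⟩ := hsupp a' b' h'
    refine hd a₁ b₁ h₁ hab₁ a₂ b₂ h₂ hab₂ ?_ x (hx₁ x hx) (hx₂ x hx')
    by_contra hcon
    push Not at hcon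
    rw [he₁, he₂, hcon.1, hcon.2] at hne
    exact hne rfl

end mk

variable {V : Type u} {G : SimpleGraph V} {A A₁ A₂ C C₁ C₂ R X Y : Set V} {a b c d h p q : V}

/-- The hub is `h` and the rim vertices are `a`, `p`, `q`, `c`. The rim runs through `A₁`, `R` and
`C₁`. The spokes to `a` and `c` are single edges; those to `p` and `q` start with the edges `hb` and
`hd` and continue in `A₂` and `C₂`. The vertices `b` and `d` may coincide with `p` and `q`. -/
theorem isTopologicalMinor_fan_of_conn (hA₁ : Conn G A₁) (hA₂ : Conn G A₂) (hC₁ : Conn G C₁)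
    (hC₂ : Conn G C₂) (hR : Conn G R) (haA₁ : a ∈ A₁) (hpA₁ : p ∈ A₁) (hpA₂ : p ∈ A₂)
    (hbA₂ : b ∈ A₂) (hcC₁ : c ∈ C₁) (hqC₁ : q ∈ C₁) (hqC₂ : q ∈ C₂) (hdC₂ : d ∈ C₂) (hpR : p ∈ R)
    (hqR : q ∈ R) (hA : ∀ z ∈ A₁, z ∈ A₂ → z = p) (hC : ∀ z ∈ C₁, z ∈ C₂ → z = q)
    (hRA : ∀ z ∈ R, z ∈ A₁ ∪ A₂ → z = p) (hRC : ∀ z ∈ R, z ∈ C₁ ∪ C₂ → z = q)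
    (hAC : ∀ z ∈ A₁ ∪ A₂, z ∉ C₁ ∪ C₂) (hhA : h ∉ A₁ ∪ A₂) (hhC : h ∉ C₁ ∪ C₂) (hhR : h ∉ R)
    (ha : G.Adj h a) (hb : G.Adj h b) (hc : G.Adj h c) (hd : G.Adj h d) (hap : a ≠ p)
    (hcq : c ≠ q) : IsTopologicalMinor (fan 4) G := by
  simp only [mem_union, not_or] at hRA hRC hAC hhA hhC
  let branch : Option (Fin 4) → V := fun i => i.elim h ![a, p, q, c]
  let S : Option (Fin 4) → Option (Fin 4) → Set V := fun i j => match i, j with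
    | none, some j => ![{h} ∪ {a}, {h} ∪ A₂, {h} ∪ C₂, {h} ∪ {c}] j
    | some i, _ => ![A₁, R, C₁, ∅] i
    | none, none => ∅
  let f : Option (Fin 4) → ℕ := fun i => i.elim 0 fun i => i + 1
  have hh : Conn G {h} := conn_singleton G h
  have edge : ∀ i j, (fan 4).Adj i j → f i < f j → (i = none ∧ ∃ k, j = some k) ∨
      (i = some 0 ∧ j = some 1) ∨ (i = some 1 ∧ j = some 2) ∨ (i = some 2 ∧ j = some 3) := by
    rintro (_ | i) (_ | j) hij hlt
    · exact hij.elim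
    · exact .inl ⟨rfl, j, rfl⟩
    · simp [f] at hlt
    · have hij' : (SimpleGraph.pathGraph 4).Adj i j := hij
      rw [SimpleGraph.pathGraph_adj] at hij'
      simp only [f, Option.elim] at hlt
      simp only [Option.some.injEq]
      right
      omega
  have haA₂ : a ∉ A₂ := fun e => hap (hA a haA₁ e)
  have haR : a ∉ R := fun e => hap (hRA a e (.inl haA₁))
  have hcC₂ : c ∉ C₂ := fun e => hcq (hC c hcC₁ e)
  have hcR : c ∉ R := fun e => hcq (hRC c e (.inl hcC₁))
  have haC := hAC a (.inl haA₁)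
  have hpC := hAC p (.inl hpA₁)
  have hnA : ∀ z, z ∈ C₁ ∨ z ∈ C₂ → z ∉ A₁ ∧ z ∉ A₂ := fun z hz =>
    ⟨fun e => not_or.2 (hAC z (.inl e)) hz, fun e => not_or.2 (hAC z (.inr e)) hz⟩
  have hqA := hnA q (.inl hqC₁)
  have hcA := hnA c (.inl hcC₁)
  have haq : a ≠ q := fun e => hqA.1 (e ▸ haA₁)
  have hac : a ≠ c := fun e => hcA.1 (e ▸ haA₁)
  have hpq : p ≠ q := fun e => hqA.1 (e ▸ hpA₁)
  have hpc : p ≠ c := fun e => hcA.1 (e ▸ hpA₁)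
  have hha := ha.ne
  have hhc := hc.ne
  have hhp : h ≠ p := fun e => hhR (e ▸ hpR)
  have hhq : h ≠ q := fun e => hhR (e ▸ hqR)
  have hall : ∀ k, k = none ∨ k = some 0 ∨ k = some 1 ∨ k = some 2 ∨ k = some (3 : Fin 4) := by
    decide
  have hinj : Function.Injective branch := by
    intro i j hij
    rcases hall i with rfl | rfl | rfl | rfl | rfl <;>
      rcases hall j with rfl | rfl | rfl | rfl | rfl <;>
      simp [branch, hha, hhc, hhp, hhq, hap, haq, hac, hpq, hpc, hcq, hha.symm, hhc.symm, hhp.symm,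
        hhq.symm, hap.symm, haq.symm, hac.symm, hpq.symm, hpc.symm, hcq.symm] at hij ⊢
  refine isTopologicalMinor_of_conn f ?_ branch hinj S ?_ ?_ ?_ ?_ ?_
  · rintro (_ | i) (_ | j) hij
    · rfl
    · simp [f] at hij
    · simp [f] at hij
    · simp only [f, Option.elim] at hij
      congr 1
      omega
  · intro i j hij hlt
    obtain ⟨rfl, k, rfl⟩ | ⟨rfl, rfl⟩ | ⟨rfl, rfl⟩ | ⟨rfl, rfl⟩ := edge i j hij hlt
    · fin_cases k
      exacts [hh.union_adj (conn_singleton G a) rfl rfl ha, hh.union_adj hA₂ rfl hbA₂ hb,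
        hh.union_adj hC₂ rfl hdC₂ hd, hh.union_adj (conn_singleton G c) rfl rfl hc]
    · exact hA₁
    · exact hR
    · exact hC₁
  · intro i j hij hlt
    obtain ⟨rfl, k, rfl⟩ | ⟨rfl, rfl⟩ | ⟨rfl, rfl⟩ | ⟨rfl, rfl⟩ := edge i j hij hlt
    · fin_cases k
      exacts [.inl rfl, .inl rfl, .inl rfl, .inl rfl]
    · exact haA₁
    · exact hpR
    · exact hqC₁
  · intro i j hij hlt
    obtain ⟨rfl, k, rfl⟩ | ⟨rfl, rfl⟩ | ⟨rfl, rfl⟩ | ⟨rfl, rfl⟩ := edge i j hij hlt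
    · fin_cases k
      exacts [.inr rfl, .inr hpA₂, .inr hqC₂, .inr rfl]
    · exact hpA₁
    · exact hqR
    · exact hcC₁
  · have mA₁ : ∀ k, branch k ∈ A₁ → k = some 0 ∨ k = some 1 := by
      intro k hk
      rcases hall k with rfl | rfl | rfl | rfl | rfl
      exacts [absurd hk hhA.1, .inl rfl, .inr rfl, absurd hk hqA.1, absurd hk hcA.1]
    have mA₂ : ∀ k, branch k ∈ A₂ → k = some 1 := by
      intro k hk
      rcases hall k with rfl | rfl | rfl | rfl | rfl
      exacts [absurd hk hhA.2, absurd hk haA₂, rfl, absurd hk hqA.2, absurd hk hcA.2]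
    have mC₁ : ∀ k, branch k ∈ C₁ → k = some 2 ∨ k = some 3 := by
      intro k hk
      rcases hall k with rfl | rfl | rfl | rfl | rfl
      exacts [absurd hk hhC.1, absurd hk haC.1, absurd hk hpC.1, .inl rfl, .inr rfl]
    have mC₂ : ∀ k, branch k ∈ C₂ → k = some 2 := by
      intro k hk
      rcases hall k with rfl | rfl | rfl | rfl | rfl
      exacts [absurd hk hhC.2, absurd hk haC.2, absurd hk hpC.2, rfl, absurd hk hcC₂]
    have mR : ∀ k, branch k ∈ R → k = some 1 ∨ k = some 2 := by
      intro k hk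
      rcases hall k with rfl | rfl | rfl | rfl | rfl
      exacts [absurd hk hhR, absurd hk haR, .inl rfl, .inr rfl, absurd hk hcR]
    intro i j hij hlt k hk
    obtain ⟨rfl, l, rfl⟩ | ⟨rfl, rfl⟩ | ⟨rfl, rfl⟩ | ⟨rfl, rfl⟩ := edge i j hij hlt
    · fin_cases l
      exacts [hk.imp (@hinj k none) (@hinj k (some 0)), hk.imp (@hinj k none) (mA₂ k),
        hk.imp (@hinj k none) (mC₂ k), hk.imp (@hinj k none) (@hinj k (some 3))]
    exacts [mA₁ k hk, mR k hk, mC₁ k hk]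
  · intro i j hij hlt i' j' hij' hlt' hne x hx hx'
    by_contra hxr
    have hxh : x ≠ h := fun e => hxr ⟨none, e.symm⟩
    have hxa : x ≠ a := fun e => hxr ⟨some 0, e.symm⟩
    have hxp : x ≠ p := fun e => hxr ⟨some 1, e.symm⟩
    have hxq : x ≠ q := fun e => hxr ⟨some 2, e.symm⟩
    have hxc : x ≠ c := fun e => hxr ⟨some 3, e.symm⟩
    have h1 : x ∈ A₁ → x ∉ A₂ := fun e e' => hxp (hA x e e')
    have h2 : x ∈ C₁ → x ∉ C₂ := fun e e' => hxq (hC x e e')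
    have h3 : x ∈ R → x ∉ A₁ ∧ x ∉ A₂ := fun e => not_or.1 fun e' => hxp (hRA x e e')
    have h4 : x ∈ R → x ∉ C₁ ∧ x ∉ C₂ := fun e => not_or.1 fun e' => hxq (hRC x e e')
    have h5 := hAC x
    have key : ∀ i j, (fan 4).Adj i j → f i < f j → x ∈ S i j →
        (i = none ∧ j = some 1 ∧ x ∈ A₂) ∨ (i = none ∧ j = some 2 ∧ x ∈ C₂) ∨
        (i = some 0 ∧ j = some 1 ∧ x ∈ A₁) ∨ (i = some 1 ∧ j = some 2 ∧ x ∈ R) ∨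
        (i = some 2 ∧ j = some 3 ∧ x ∈ C₁) := by
      intro i j hij hlt hx
      obtain ⟨rfl, l, rfl⟩ | ⟨rfl, rfl⟩ | ⟨rfl, rfl⟩ | ⟨rfl, rfl⟩ := edge i j hij hlt
      · fin_cases l
        · exact absurd hx (not_or.2 ⟨hxh, hxa⟩)
        · exact .inl ⟨rfl, rfl, hx.resolve_left hxh⟩
        · exact .inr (.inl ⟨rfl, rfl, hx.resolve_left hxh⟩)
        · exact absurd hx (not_or.2 ⟨hxh, hxc⟩)
      · exact .inr (.inr (.inl ⟨rfl, rfl, hx⟩))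
      · exact .inr (.inr (.inr (.inl ⟨rfl, rfl, hx⟩)))
      · exact .inr (.inr (.inr (.inr ⟨rfl, rfl, hx⟩)))
    have k1 := key i j hij hlt hx
    have k2 := key i' j' hij' hlt' hx'
    clear * - h1 h2 h3 h4 h5 hne k1 k2
    rcases k1 with ⟨rfl, rfl, k1⟩ | ⟨rfl, rfl, k1⟩ | ⟨rfl, rfl, k1⟩ | ⟨rfl, rfl, k1⟩ | ⟨rfl, rfl, k1⟩ <;>
      rcases k2 with ⟨rfl, rfl, k2⟩ | ⟨rfl, rfl, k2⟩ | ⟨rfl, rfl, k2⟩ | ⟨rfl, rfl, k2⟩ | ⟨rfl, rfl, k2⟩ <;>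
      tauto

end GemSPQR

/-! ### Completing a butterfly to a subdivided gem -/

namespace GemSPQR
open Set

universe u

variable {V : Type u} {G : SimpleGraph V} {A A₁ A₂ C C₁ C₂ P Q R X Y : Set V} {a b c d h p q : V}

/-- A path is divided by one of its vertices. -/
theorem exists_conn_of_isPath {W : G.Walk a b} (hW : W.IsPath) (hp : p ∈ W.support) :
    ∃ A₁ A₂ : Set V, Conn G A₁ ∧ Conn G A₂ ∧ a ∈ A₁ ∧ p ∈ A₁ ∧ p ∈ A₂ ∧ b ∈ A₂ ∧
      (∀ z ∈ A₁ ∪ A₂, z ∈ W.support) ∧ ∀ z ∈ A₁, z ∈ A₂ → z = p := by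
  classical
  refine ⟨_, _, conn_walk_support (W.takeUntil p hp), conn_walk_support (W.dropUntil p hp),
    SimpleGraph.Walk.start_mem_support _, SimpleGraph.Walk.end_mem_support _,
    SimpleGraph.Walk.start_mem_support _, SimpleGraph.Walk.end_mem_support _, ?_, ?_⟩
  · rintro z (hz | hz)
    exacts [W.support_takeUntil_subset_support hp hz, W.support_dropUntil_subset_support hp hz]
  · intro z hz hz'
    by_contra hne
    have hnd := hW.support_nodup
    rw [← W.take_spec hp, SimpleGraph.Walk.support_append] at hnd
    have hz'' : z ∈ (W.dropUntil p hp).support.tail := by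
      have hz' : z ∈ (W.dropUntil p hp).support := hz'
      rw [← SimpleGraph.Walk.cons_tail_support, List.mem_cons] at hz'
      exact hz'.resolve_left hne
    exact (List.nodup_append'.1 hnd).2.2 hz hz''

/-- A minimal connected set meeting two given sets. -/
theorem Conn.exists_bridge [Finite V] (hY : Conn G Y) (ha : a ∈ A) (haY : a ∈ Y) (hc : c ∈ C)
    (hcY : c ∈ Y) : ∃ R ⊆ Y, Conn G R ∧ ∃ p q, p ∈ A ∧ p ∈ R ∧ q ∈ C ∧ q ∈ R ∧
      (∀ z ∈ R, z ∈ A → z = p) ∧ ∀ z ∈ R, z ∈ C → z = q := by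
  obtain ⟨R, hR⟩ := exists_minimal_of_wellFoundedLT
    (fun R : Set V => R ⊆ Y ∧ Conn G R ∧ (∃ p ∈ A, p ∈ R) ∧ ∃ q ∈ C, q ∈ R)
    ⟨Y, Subset.rfl, hY, ⟨a, ha, haY⟩, c, hc, hcY⟩
  obtain ⟨hRY, hRc, ⟨p, hpA, hpR⟩, q, hqC, hqR⟩ := hR.prop
  have key : ∀ R' ⊆ R, Conn G R' → (∃ p ∈ A, p ∈ R') → (∃ q ∈ C, q ∈ R') → R ⊆ R' :=
    fun R' h h1 h2 h3 => hR.le_of_le ⟨h.trans hRY, h1, h2, h3⟩ h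
  obtain ⟨W, hW, hWR⟩ := hRc.exists_isPath hpR hqR
  -- By minimality `R` is the vertex set of a path from `p` to `q`. Another vertex of `A` or `C` on
  -- it would allow the path to be shortened.
  have hRW : ∀ z ∈ R, z ∈ W.support :=
    key {z | z ∈ W.support} hWR (conn_walk_support W) ⟨p, hpA, W.start_mem_support⟩
      ⟨q, hqC, W.end_mem_support⟩
  refine ⟨R, hRY, hRc, p, q, hpA, hpR, hqC, hqR, ?_, ?_⟩
  · intro z hz hzA
    obtain ⟨A₁, A₂, -, h₂, hp, -, hzA₂, hq, hsub, hdisj⟩ := exists_conn_of_isPath hW (hRW z hz)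
    have := key A₂ (fun v hv => hWR v (hsub v (.inr hv))) h₂ ⟨z, hzA, hzA₂⟩ ⟨q, hqC, hq⟩ hpR
    exact (hdisj p hp this).symm
  · intro z hz hzC
    obtain ⟨A₁, A₂, h₁, -, hp, hzA₁, -, hq, hsub, hdisj⟩ := exists_conn_of_isPath hW (hRW z hz)
    have := key A₁ (fun v hv => hWR v (hsub v (.inl hv))) h₁ ⟨p, hpA, hp⟩ ⟨z, hzC, hzA₁⟩ hqR
    exact (hdisj q this hq).symm

/-- A path is divided by one of its vertices, so that the first part is not a single vertex, after
a suitable choice of the direction. -/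
theorem exists_ends_of_isPath (hab : a ≠ b) (ha : G.Adj h a) (hb : G.Adj h b) {W : G.Walk a b}
    (hW : W.IsPath) (hp : p ∈ W.support) :
    ∃ (A₁ A₂ : Set V) (a b : V), Conn G A₁ ∧ Conn G A₂ ∧ a ∈ A₁ ∧ p ∈ A₁ ∧ p ∈ A₂ ∧ b ∈ A₂ ∧
      (∀ z ∈ A₁ ∪ A₂, z ∈ W.support) ∧ (∀ z ∈ A₁, z ∈ A₂ → z = p) ∧ a ≠ p ∧ G.Adj h a ∧
      G.Adj h b := by
  obtain ⟨A₁, A₂, h₁, h₂, haA, hpA₁, hpA₂, hbA, hsub, hd⟩ := exists_conn_of_isPath hW hp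
  by_cases hap : a = p
  · exact ⟨A₂, A₁, b, a, h₂, h₁, hbA, hpA₂, hpA₁, haA, fun z hz => hsub z hz.symm,
      fun z hz hz' => hd z hz' hz, fun e => hab (hap.trans e.symm), hb, ha⟩
  · exact ⟨A₁, A₂, a, b, h₁, h₂, haA, hpA₁, hpA₂, hbA, hsub, hd, hap, ha, hb⟩

/-- Each wing contains a path between its two neighbours of `h`. As `G - h` is connected, a minimal
connected set `R` joins the two paths and meets them only in `p` and `q`. The ends of each path are
distinct, so its direction can be chosen such that it does not start in `p` or `q`, respectively. -/
theorem Bicon.isTopologicalMinor_of_butterfly [Finite V] (hG : Bicon G X) (hh : Butterfly G h) :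
    IsTopologicalMinor (fan 4) G := by
  obtain ⟨P, Q, hP, hQ, hPQ, hhP, hhQ, ⟨a, ha, b, hb, hab, hha, hhb⟩,
    ⟨c, hc, d, hd, hcd, hhc, hhd⟩⟩ := hh
  obtain ⟨W₁, hW₁, hWP⟩ := hP.exists_isPath ha hb
  obtain ⟨W₂, hW₂, hWQ⟩ := hQ.exists_isPath hc hd
  obtain ⟨R, hRY, hR, p, q, hpA, hpR, hqC, hqR, hRA, hRC⟩ := (hG.conn_diff h).exists_bridge
    (A := {z | z ∈ W₁.support}) (C := {z | z ∈ W₂.support}) W₁.start_mem_support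
    ⟨hG.mem_right hha, hha.ne'⟩ W₂.start_mem_support ⟨hG.mem_right hhc, hhc.ne'⟩
  obtain ⟨A₁, A₂, a, b, h₁, h₂, haA, hpA₁, hpA₂, hbA, hsub, hA, hap, hha, hhb⟩ :=
    exists_ends_of_isPath hab hha hhb hW₁ hpA
  obtain ⟨C₁, C₂, c, d, h₁', h₂', hcC, hqC₁, hqC₂, hdC, hsub', hC, hcq, hhc, hhd⟩ :=
    exists_ends_of_isPath hcd hhc hhd hW₂ hqC
  exact isTopologicalMinor_fan_of_conn h₁ h₂ h₁' h₂' hR haA hpA₁ hpA₂ hbA hcC hqC₁ hqC₂ hdC hpR hqR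
    hA hC (fun z hz hz' => hRA z hz (hsub z hz')) (fun z hz hz' => hRC z hz (hsub' z hz'))
    (fun z hz hz' => disjoint_left.1 hPQ (hWP z (hsub z hz)) (hWQ z (hsub' z hz')))
    (fun e => hhP (hWP h (hsub h e))) (fun e => hhQ (hWQ h (hsub' h e))) (fun e => (hRY e).2 rfl)
    hha hhb hhc hhd hap hcq

theorem IsTopologicalMinor.map {W : Type*} {V' : Type*} {H : SimpleGraph W} {G' : SimpleGraph V'}
    (hH : IsTopologicalMinor H G) (f : G →g G') (hf : Function.Injective f) :
    IsTopologicalMinor H G' := by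
  obtain ⟨M⟩ := hH
  refine ⟨⟨f ∘ M.branch, hf.comp M.branch_injective, fun a b h => (M.path a b h).map f, ?_, ?_, ?_,
    ?_⟩⟩
  · exact fun a b h => (M.path_isPath a b h).map hf
  · intro a b h
    rw [M.path_symm a b h, SimpleGraph.Walk.reverse_map]
  · intro a b h c hc
    rw [SimpleGraph.Walk.support_map, List.mem_map] at hc
    obtain ⟨x, hx, e⟩ := hc
    exact M.branch_mem_path a b h c (hf e ▸ hx)
  · intro a b h a' b' h' hne x hx hx'
    rw [SimpleGraph.Walk.support_map, List.mem_map] at hx hx'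
    obtain ⟨x, hx, rfl⟩ := hx
    obtain ⟨x', hx', e⟩ := hx'
    obtain ⟨c, rfl⟩ := M.path_disjoint a b h a' b' h' hne x hx (hf e ▸ hx')
    exact ⟨c, rfl⟩

end GemSPQR

namespace GemSPQR
open Set

universe u

/-! ### From topological minors to butterflies -/

section bicon

variable {V : Type u} {G : SimpleGraph V}

/-- A proper closed part `Z` of `G - c` gives the separation of `Z ∪ {c}` from the complement of `Z
\ {c}`, of order at most one. Conversely, the at most one vertex shared by a separation is deleted.
-/
theorem isKConnected_two_iff [Finite V] : IsKConnected 2 G ↔ Bicon G univ := by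
  have hcard : (2 : ℕ∞) < ENat.card V ↔ 3 ≤ (univ : Set V).ncard := by
    rw [← encard_univ, ← Set.Finite.cast_ncard_eq (toFinite _)]
    norm_cast
  constructor
  · rintro ⟨h2, hG⟩
    refine ⟨hcard.1 h2, fun _ => trivial, ?_⟩
    rintro c Z ⟨u, hu, huZ⟩ hcl w hw
    by_contra hwZ
    have := hG (insert c Z) (Z \ {c})ᶜ ⟨?_, ?_⟩ (fun h => h (.inr huZ) ⟨huZ, hu.2⟩)
      (fun h => (h fun h => hwZ h.1).elim hw.2 hwZ)
    · have hle : insert c Z ∩ (Z \ {c})ᶜ ⊆ {c} := by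
        rintro z ⟨rfl | hz, hz'⟩
        · rfl
        · by_contra h
          exact hz' ⟨hz, h⟩
      have := this.trans (encard_le_encard hle)
      rw [encard_singleton] at this
      exact absurd this (by decide)
    · ext z
      by_cases hz : z = c <;> by_cases hz' : z ∈ Z <;> simp [hz, hz']
    · rintro x ⟨-, hx⟩ y ⟨-, hy⟩ hxy
      have hx' := not_not.1 hx
      rw [mem_insert_iff, not_or] at hy
      exact hy.2 (hcl x ⟨trivial, hx'.2⟩ hx'.1 y ⟨trivial, hy.1⟩ hxy)
  · intro hG
    refine ⟨hcard.2 hG.three_le, ?_⟩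
    rintro A B ⟨hAB, hsep⟩ hA hB
    by_contra hlt
    obtain ⟨u, huA, huB⟩ := not_subset.1 hA
    obtain ⟨w, hwB, hwA⟩ := not_subset.1 hB
    have h1 : (A ∩ B).Subsingleton := by
      rw [← encard_le_one_iff_subsingleton]
      exact Order.le_of_lt_add_one (not_le.1 hlt)
    obtain ⟨c, hc, hcu, hcw⟩ : ∃ c, A ∩ B ⊆ {c} ∧ c ≠ u ∧ c ≠ w := by
      rcases (A ∩ B).eq_empty_or_nonempty with h | ⟨c, hc⟩
      -- For a separation of order zero, any third vertex can be deleted.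
      · obtain ⟨c, -, hc⟩ := exists_mem_notMem_of_ncard_lt_ncard (s := {u, w}) (t := univ)
          ((ncard_insert_le _ _).trans_lt (by
            rw [ncard_singleton]
            have := hG.three_le
            omega)) (toFinite _)
        simp only [mem_insert_iff, mem_singleton_iff, not_or] at hc
        exact ⟨c, by simp [h], hc⟩
      · exact ⟨c, fun z hz => h1 hz hc, fun e => huB (e ▸ hc.2), fun e => hwA (e ▸ hc.1)⟩
    refine hwA (hG.conn_diff c A ⟨u, ⟨trivial, hcu.symm⟩, huA⟩ ?_ ⟨trivial, hcw.symm⟩)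
    intro a ha haA b hb hab
    by_contra hbA
    have haB : a ∉ B := fun haB => ha.2 (hc ⟨haA, haB⟩)
    have hbB : b ∈ B := (hAB.symm.subset (mem_univ b)).resolve_left hbA
    exact hsep a ⟨haA, haB⟩ b ⟨hbB, hbA⟩ hab

theorem Conn.preimage_coe {D : G.Subgraph} {Y : Set V} (hY : Conn G Y) (hYD : Y ⊆ D.verts)
    (h : ∀ u ∈ Y, ∀ w ∈ Y, G.Adj u w → D.Adj u w) : Conn D.coe (Subtype.val ⁻¹' Y) := by
  rintro Z ⟨u, hu, huZ⟩ hcl w hw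
  have := hY {z | ∃ hz : z ∈ D.verts, (⟨z, hz⟩ : D.verts) ∈ Z} ⟨u, hu, u.2, huZ⟩ ?_ hw
  · exact this.2
  · rintro a ha ⟨ha', haZ⟩ b hb hab
    exact ⟨hYD hb, hcl ⟨a, ha'⟩ ha haZ ⟨b, hYD hb⟩ hb (h a ha b hb hab)⟩

end bicon

section joined

variable {V : Type u} {G : SimpleGraph V} {Y : Set V} {u v w : V}

/-- Two vertices lie in a connected subset of `Y`. -/
def Joined (G : SimpleGraph V) (Y : Set V) (u w : V) : Prop :=
  ∃ S ⊆ Y, Conn G S ∧ u ∈ S ∧ w ∈ S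

theorem Joined.symm (h : Joined G Y u w) : Joined G Y w u := by
  obtain ⟨S, hS, hc, hu, hw⟩ := h
  exact ⟨S, hS, hc, hw, hu⟩

theorem Joined.trans (h : Joined G Y u v) (h' : Joined G Y v w) : Joined G Y u w := by
  obtain ⟨S, hS, hc, hu, hv⟩ := h
  obtain ⟨S', hS', hc', hv', hw⟩ := h'
  exact ⟨S ∪ S', union_subset hS hS', hc.union hc' hv hv', .inl hu, .inr hw⟩

theorem conn_of_joined (v : V) (h : ∀ u ∈ Y, Joined G Y u v) : Conn G Y := by
  rintro Z ⟨u, hu, huZ⟩ hcl w hw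
  obtain ⟨S, hS, hc, huS, hwS⟩ := (h u hu).trans (h w hw).symm
  exact hc Z ⟨u, huS, huZ⟩ (fun a ha haZ b hb hab => hcl a (hS ha) haZ b (hS hb) hab) hwS

end joined

namespace TopologicalMinorModel

variable {W : Type*} {V : Type u} {H : SimpleGraph W} {G : SimpleGraph V}
  (M : TopologicalMinorModel H G) {i j k : W} {c z : V}

/-- The vertices of a subdivision. -/
def verts : Set V := {z | ∃ i j, ∃ h : H.Adj i j, z ∈ (M.path i j h).support}

theorem mem_verts (h : H.Adj i j) (hz : z ∈ (M.path i j h).support) : z ∈ M.verts := ⟨i, j, h, hz⟩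

theorem exists_branch_of_mem {i' j' : W} (h : H.Adj i j) (h' : H.Adj i' j')
    (hne : s(i, j) ≠ s(i', j')) (hz : z ∈ (M.path i j h).support)
    (hz' : z ∈ (M.path i' j' h').support) :
    ∃ k, z = M.branch k ∧ (k = i ∨ k = j) ∧ (k = i' ∨ k = j') := by
  obtain ⟨k, rfl⟩ := M.path_disjoint i j h i' j' h' hne z hz hz'
  exact ⟨k, rfl, M.branch_mem_path i j h k hz, M.branch_mem_path i' j' h' k hz'⟩

theorem joined (h : H.Adj i j) (hc : c ∉ (M.path i j h).support) :
    Joined G (M.verts \ {c}) (M.branch i) (M.branch j) :=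
  ⟨_, fun _ hz => ⟨M.mem_verts h hz, fun e => hc (e ▸ hz)⟩, conn_walk_support (M.path i j h),
    SimpleGraph.Walk.start_mem_support _, SimpleGraph.Walk.end_mem_support _⟩

theorem joined_of_branch (h : H.Adj i j) (hi : i ≠ k) (hj : j ≠ k) :
    Joined G (M.verts \ {M.branch k}) (M.branch i) (M.branch j) :=
  M.joined h fun hk => (M.branch_mem_path i j h k hk).elim hi.symm hj.symm

theorem exists_joined (h : H.Adj i j) (hz : z ∈ (M.path i j h).support) (hzc : z ≠ c) :
    ∃ k, M.branch k ≠ c ∧ Joined G (M.verts \ {c}) z (M.branch k) := by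
  obtain ⟨A₁, A₂, h₁, h₂, hi, hz₁, hz₂, hj, hsub, hd⟩ := exists_conn_of_isPath (M.path_isPath i j h) hz
  by_cases hc : c ∈ A₁
  · have hc₂ : c ∉ A₂ := fun hc₂ => hzc (hd c hc hc₂).symm
    exact ⟨j, fun e => hc₂ (e ▸ hj), A₂,
      fun v hv => ⟨M.mem_verts h (hsub v (.inr hv)), fun e => hc₂ (e ▸ hv)⟩, h₂, hz₂, hj⟩
  · exact ⟨i, fun e => hc (e ▸ hi), A₁,
      fun v hv => ⟨M.mem_verts h (hsub v (.inl hv)), fun e => hc (e ▸ hv)⟩, h₁, hz₁, hi⟩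

/-- A path of a subdivision without its first vertex. -/
theorem exists_conn_adj (h : H.Adj i j) : ∃ (a : V) (S : Set V), Conn G S ∧ a ∈ S ∧
    M.branch j ∈ S ∧ M.branch i ∉ S ∧ (∀ z ∈ S, z ∈ (M.path i j h).support) ∧
    G.Adj (M.branch i) a := by
  have hne : M.branch i ≠ M.branch j := fun e => h.ne (M.branch_injective e)
  have key : ∀ (u w : V) (P : G.Walk u w), u ≠ w → P.IsPath → ∃ (a : V) (S : Set V), Conn G S ∧
      a ∈ S ∧ w ∈ S ∧ u ∉ S ∧ (∀ z ∈ S, z ∈ P.support) ∧ G.Adj u a := by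
    intro u w P hne hP
    cases P with
    | nil => exact absurd rfl hne
    | @cons _ a _ hua P =>
      rw [SimpleGraph.Walk.cons_isPath_iff] at hP
      refine ⟨a, _, conn_walk_support P, P.start_mem_support, P.end_mem_support, hP.2,
        fun z hz => ?_, hua⟩
      rw [SimpleGraph.Walk.support_cons]
      exact List.mem_cons_of_mem _ hz
  exact key _ _ _ hne (M.path_isPath i j h)

end TopologicalMinorModel

section fan

variable {V : Type u} {G : SimpleGraph V} (M : TopologicalMinorModel (fan 4) G)

theorem fan_adj_succ (i : Fin 3) : (fan 4).Adj (some i.castSucc) (some i.succ) := by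
  change (SimpleGraph.pathGraph 4).Adj _ _
  rw [SimpleGraph.pathGraph_adj]
  exact .inl rfl

theorem fan_adj_none (i : Fin 4) : (fan 4).Adj none (some i) := trivial

/-- A subdivision of the gem is `2`-connected. -/
theorem TopologicalMinorModel.conn_verts_diff (c : V) : Conn G (M.verts \ {c}) := by
  by_cases hc : M.branch none = c
  · subst hc
    have h01 := M.joined_of_branch (k := none) (fan_adj_succ 0) nofun nofun
    have h12 := M.joined_of_branch (k := none) (fan_adj_succ 1) nofun nofun
    have h23 := M.joined_of_branch (k := none) (fan_adj_succ 2) nofun nofun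
    refine conn_of_joined (M.branch (some 1)) ?_
    rintro z ⟨⟨i, j, h, hz⟩, hzc⟩
    obtain ⟨k, hk, hzk⟩ := M.exists_joined h hz hzc
    refine hzk.trans ?_
    have hall : k = none ∨ k = some 0 ∨ k = some 1 ∨ k = some 2 ∨ k = some (3 : Fin 4) := by
      clear * -
      revert k
      decide
    rcases hall with rfl | rfl | rfl | rfl | rfl
    exacts [absurd rfl hk, h01, h12.trans h12.symm, h12.symm, h23.symm.trans h12.symm]
  · have key : ∀ i, M.branch (some i) ≠ c →
        Joined G (M.verts \ {c}) (M.branch (some i)) (M.branch none) := by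
      intro i hi
      -- If `c` blocks the spoke to `i`, it lies on no other path; the rim path to a neighbouring
      -- branch vertex and the spoke from there are free.
      by_cases hci : c ∈ (M.path none (some i) (fan_adj_none i)).support
      · have hother : ∀ i' j' (h : (fan 4).Adj i' j'), s(none, some i) ≠ s(i', j') →
            c ∉ (M.path i' j' h).support := by
          intro i' j' h hne hc'
          obtain ⟨k, rfl, rfl | rfl, -⟩ := M.exists_branch_of_mem _ h hne hci hc'
          exacts [hc rfl, hi rfl]
        obtain ⟨j, hij, hne⟩ : ∃ j, (fan 4).Adj (some i) (some j) ∧ i ≠ j := by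
          have hall : i = 0 ∨ i = 1 ∨ i = 2 ∨ i = 3 := by
            clear * -
            revert i
            decide
          rcases hall with rfl | rfl | rfl | rfl
          exacts [⟨1, fan_adj_succ 0, by decide⟩, ⟨2, fan_adj_succ 1, by decide⟩,
            ⟨3, fan_adj_succ 2, by decide⟩, ⟨2, (fan_adj_succ 2).symm, by decide⟩]
        refine (M.joined hij (hother _ _ _ (by simp))).trans
          (M.joined (fan_adj_none j) (hother _ _ _ (by simpa using hne))).symm
      · exact (M.joined (fan_adj_none i) hci).symm
    refine conn_of_joined (M.branch none) ?_
    rintro z ⟨⟨i, j, h, hz⟩, hzc⟩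
    obtain ⟨k, hk, hzk⟩ := M.exists_joined h hz hzc
    refine hzk.trans ?_
    rcases k with _ | k
    · exact hzk.symm.trans hzk
    · exact key k hk

theorem eq_none_of_halves : ∀ k : Option (Fin 4), (k = none ∨ k = some 0 ∨ k = some 1) →
    (k = none ∨ k = some 2 ∨ k = some 3) → k = none := by
  decide

/-- The two halves of a subdivision of the gem. -/
theorem TopologicalMinorModel.exists_half (i j : Fin 4) (hij : (fan 4).Adj (some i) (some j)) :
    ∃ P : Set V, Conn G P ∧ M.branch none ∉ P ∧
      (∃ a ∈ P, ∃ b ∈ P, a ≠ b ∧ G.Adj (M.branch none) a ∧ G.Adj (M.branch none) b) ∧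
      ∀ z ∈ P, ∃ (i' j' : Option (Fin 4)) (h : (fan 4).Adj i' j'),
        z ∈ (M.path i' j' h).support ∧ (i' = none ∨ i' = some i ∨ i' = some j) ∧
        (j' = some i ∨ j' = some j) := by
  obtain ⟨a, A, hA, haA, hiA, hA', hAs, ha⟩ := M.exists_conn_adj (fan_adj_none i)
  obtain ⟨b, B, hB, hbB, hjB, hB', hBs, hb⟩ := M.exists_conn_adj (fan_adj_none j)
  have hne : i ≠ j := fun e => hij.ne (congrArg some e)
  have hR := conn_walk_support (M.path _ _ hij)
  refine ⟨A ∪ ({z | z ∈ (M.path _ _ hij).support} ∪ B), ?_, ?_, ⟨a, .inl haA, b, .inr (.inr hbB),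
    ?_, ha, hb⟩, ?_⟩
  · exact hA.union (hR.union hB (SimpleGraph.Walk.end_mem_support _) hjB) hiA
      (.inl (SimpleGraph.Walk.start_mem_support _))
  · rintro (h | h | h)
    · exact hA' h
    · rcases M.branch_mem_path _ _ hij none h with h | h <;> cases h
    · exact hB' h
  · rintro rfl
    obtain ⟨k, rfl, hk, hk'⟩ := M.exists_branch_of_mem _ _ (by simpa using hne) (hAs _ haA) (hBs _ hbB)
    have : k = none := by
      rcases hk with rfl | rfl
      · rfl
      · simp [hne] at hk'
    exact hA' (this ▸ haA)
  · rintro z (h | h | h)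
    exacts [⟨_, _, _, hAs z h, .inl rfl, .inl rfl⟩, ⟨_, _, _, h, .inr (.inl rfl), .inr rfl⟩,
      ⟨_, _, _, hBs z h, .inl rfl, .inr rfl⟩]

/-- A graph with the gem as a topological minor has a `2`-connected component with a butterfly. -/
theorem TopologicalMinorModel.exists_butterfly [Finite V] (M : TopologicalMinorModel (fan 4) G) :
    ∃ C : G.Subgraph, IsTwoConnectedComponent G C ∧ ∃ h : C.verts, Butterfly C.coe h := by
  -- The vertices of the subdivision induce a 2-connected subgraph; the component is a maximal one
  -- containing it.
  set D : G.Subgraph := (⊤ : G.Subgraph).induce M.verts with hD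
  have hDadj : ∀ u ∈ M.verts, ∀ w ∈ M.verts, G.Adj u w → D.Adj u w := fun u hu w hw huw =>
    ⟨hu, hw, huw⟩
  have hDb : IsKConnected 2 D.coe := by
    rw [isKConnected_two_iff]
    refine ⟨?_, fun _ => trivial, fun c => ?_⟩
    · rw [← ncard_image_of_injective _ Subtype.val_injective, image_univ, Subtype.range_coe]
      have hne : ∀ {k l}, k ≠ l → M.branch k ≠ M.branch l := fun h => M.branch_injective.ne h
      rw [← ncard_eq_three.2 ⟨M.branch none, M.branch (some 0), M.branch (some 1), hne (by decide),
        hne (by decide), hne (by decide), rfl⟩]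
      refine ncard_le_ncard ?_ (toFinite _)
      rintro z (rfl | rfl | rfl)
      exacts [M.mem_verts (fan_adj_none 0) (SimpleGraph.Walk.start_mem_support _),
        M.mem_verts (fan_adj_none 0) (SimpleGraph.Walk.end_mem_support _),
        M.mem_verts (fan_adj_none 1) (SimpleGraph.Walk.end_mem_support _)]
    · convert (M.conn_verts_diff c.1).preimage_coe (D := D) sdiff_subset
        fun u hu w hw => hDadj u hu.1 w hw.1
      ext z
      simp only [mem_sdiff, mem_univ, true_and, mem_singleton_iff, mem_preimage]
      exact ⟨fun h => ⟨z.2, fun e => h (Subtype.ext e)⟩, fun h e => h.2 (congrArg _ e)⟩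
  obtain ⟨C, hDC, hC⟩ := Finite.exists_le_maximal
    (p := fun D : G.Subgraph => IsKConnected 2 D.coe) hDb
  have hh : M.branch none ∈ C.verts :=
    hDC.1 (M.mem_verts (fan_adj_none 0) (SimpleGraph.Walk.start_mem_support _))
  obtain ⟨P, hP, hhP, ⟨a, ha, b, hb, hab, hha, hhb⟩, hP'⟩ := M.exists_half 0 1 (fan_adj_succ 0)
  obtain ⟨Q, hQ, hhQ, ⟨c, hc, d, hd, hcd, hhc, hhd⟩, hQ'⟩ := M.exists_half 2 3 (fan_adj_succ 2)
  have hPv : P ⊆ M.verts := fun z hz => by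
    obtain ⟨i, j, h, hz, -⟩ := hP' z hz
    exact ⟨i, j, h, hz⟩
  have hQv : Q ⊆ M.verts := fun z hz => by
    obtain ⟨i, j, h, hz, -⟩ := hQ' z hz
    exact ⟨i, j, h, hz⟩
  have hCadj : ∀ u ∈ M.verts, ∀ w ∈ M.verts, G.Adj u w → C.Adj u w := fun u hu w hw huw =>
    hDC.2 (hDadj u hu w hw huw)
  have hhv : M.branch none ∈ M.verts :=
    M.mem_verts (fan_adj_none 0) (SimpleGraph.Walk.start_mem_support _)
  refine ⟨C, hC, ⟨M.branch none, hh⟩, Subtype.val ⁻¹' P, Subtype.val ⁻¹' Q,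
    hP.preimage_coe (hPv.trans hDC.1) fun u hu w hw => hCadj u (hPv hu) w (hPv hw),
    hQ.preimage_coe (hQv.trans hDC.1) fun u hu w hw => hCadj u (hQv hu) w (hQv hw), ?_, hhP, hhQ,
    ⟨⟨a, hDC.1 (hPv ha)⟩, ha, ⟨b, hDC.1 (hPv hb)⟩, hb, by simpa using hab, ?_, ?_⟩,
    ⟨⟨c, hDC.1 (hQv hc)⟩, hc, ⟨d, hDC.1 (hQv hd)⟩, hd, by simpa using hcd, ?_, ?_⟩⟩
  · rw [disjoint_left]
    intro z hzP hzQ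
    obtain ⟨i, j, h, hz, hi, hj⟩ := hP' z hzP
    obtain ⟨i', j', h', hz', hi', hj'⟩ := hQ' z hzQ
    have hmem : ∀ k, k = i ∨ k = j → k = none ∨ k = some 0 ∨ k = some 1 := fun k hk =>
      hk.elim (fun e => e ▸ hi) fun e => .inr (e ▸ hj)
    have hmem' : ∀ k, k = i' ∨ k = j' → k = none ∨ k = some 2 ∨ k = some 3 := fun k hk =>
      hk.elim (fun e => e ▸ hi') fun e => .inr (e ▸ hj')
    -- Paths from different halves belong to different edges of the gem, so they meet only in a
    -- branch vertex common to both halves. That can only be the hub, which the wings avoid.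
    have hne : s(i, j) ≠ s(i', j') := by
      intro e
      have hji : j ∈ s(i', j') := e ▸ Sym2.mem_mk_right i j
      have := eq_none_of_halves j (hmem j (.inr rfl)) (hmem' j (Sym2.mem_iff.1 hji))
      rcases hj with h | h <;> cases h.symm.trans this
    obtain ⟨k, hk, hk1, hk2⟩ := M.exists_branch_of_mem h h' hne hz hz'
    have := eq_none_of_halves k (hmem k hk1) (hmem' k hk2)
    exact hhP (this ▸ hk ▸ hzP)
  exacts [hCadj _ hhv _ (hPv ha) hha, hCadj _ hhv _ (hPv hb) hhb, hCadj _ hhv _ (hQv hc) hhc,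
    hCadj _ hhv _ (hQv hd) hhd]

end fan

end GemSPQR

namespace GemSPQR
open Set
open scoped Graph

universe u

/-! ### Butterflies and SPQR trees -/

theorem IsCycleLabel.false_of_adj {V : Type u} {E : Type*} {M : Graph V E} {a b c h : V}
    (hM : IsCycleLabel M) (ha : M.Adj h a) (hb : M.Adj h b) (hc : M.Adj h c) (hab : a ≠ b)
    (hac : a ≠ c) (hbc : b ≠ c) : False := by
  have := hM.1
  obtain ⟨-, n, hn, ⟨f⟩⟩ := hM
  let h' : V(M) := ⟨h, ha.left_mem⟩
  have h2 : (M.toSimpleGraph.neighborSet h').encard = 2 := by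
    rw [encard_congr (f.mapNeighborSet h'), ← Set.Finite.cast_ncard_eq (toFinite _),
      ncard_neighborSet_cycleGraph hn]
    rfl
  have key : ∀ z (hz : M.Adj h z), (⟨z, hz.right_mem⟩ : V(M)) ∈ M.toSimpleGraph.neighborSet h' :=
    fun z hz => (Graph.toSimpleGraph_adj_iff h' _).2 hz
  have h3 : (3 : ℕ∞) ≤ (M.toSimpleGraph.neighborSet h').encard := by
    rw [← encard_eq_three.2 ⟨(⟨a, ha.right_mem⟩ : V(M)), ⟨b, hb.right_mem⟩, ⟨c, hc.right_mem⟩,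
      by simpa using hab, by simpa using hac, by simpa using hbc, rfl⟩]
    refine encard_le_encard ?_
    rintro z (rfl | rfl | rfl)
    exacts [key a ha, key b hb, key c hc]
  rw [h2] at h3
  exact absurd h3 (by decide)

namespace SPQRTree

variable {V : Type u} {G : SimpleGraph V} (T : SPQRTree G) {P Q : Set V} {a b c d h p q v x y z : V}
  {s t : T.Node}

theorem conn (x : V) : Conn T.tree {t | x ∈ V(T.label t)} :=
  conn_iff_induce_preconnected.2 (T.vertex_subtree x).preconnected

theorem exists_isLink_real (hpq : G.Adj p q) :
    ∃ t, (T.label t).IsLink (.inl s(p, q)) p q := by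
  obtain ⟨t, ht, -⟩ := T.real_unique s(p, q) hpq
  obtain ⟨x, y, h⟩ := ((T.label t).edge_mem_iff_exists_isLink _).1 ht
  refine ⟨t, ?_⟩
  rcases Sym2.eq_iff.1 (T.real_ends t _ x y h) with ⟨rfl, rfl⟩ | ⟨rfl, rfl⟩
  exacts [h, h.symm]

theorem exists_isLink_virtual (hst : T.tree.Adj s t) (hs : h ∈ V(T.label s))
    (ht : h ∈ V(T.label t)) : ∃ y, (T.label s).IsLink (.inr t) h y := by
  obtain ⟨x, y, hxy⟩ := ((T.label s).edge_mem_iff_exists_isLink _).1 ((T.virtual_mem s t).2 hst)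
  have : h ∈ ({x, y} : Set V) := T.adhesion s t x y hxy ▸ ⟨hs, ht⟩
  rcases this with rfl | rfl
  exacts [⟨y, hxy⟩, ⟨x, hxy.symm⟩]

/-- In a graph with at least three vertices there are no nodes with a single real edge. -/
theorem label_type_of_ne (hab : a ≠ b) (hac : a ≠ c) (hbc : b ≠ c) (t : T.Node) :
    IsCycleLabel (T.label t) ∨ T.IsPNode t ∨ T.IsRNode t := by
  rcases T.label_type t with h | h | h | ⟨x, y, -, ht⟩
  · exact .inl h
  · exact .inr (.inl h)
  · exact .inr (.inr h)
  · exfalso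
    -- A node whose label is a single real edge has no virtual edge. So it is the only node, and `G`
    -- has just two vertices.
    have hadj : ∀ s, ¬ T.tree.Adj t s := by
      intro s hs
      have := (T.virtual_mem t s).2 hs
      rw [ht] at this
      exact Sum.inr_ne_inl this
    have hall : ∀ s, s = t := fun s => conn_univ_of_isTree T.isTree {t} ⟨t, trivial, rfl⟩
      (fun u _ hu w _ huw => absurd (hu ▸ huw) (hadj w)) (mem_univ s)
    have hv : ∀ v, v = x ∨ v = y := by
      intro v
      obtain ⟨s, hs⟩ := (T.vertex_subtree v).nonempty
      rw [hall s, mem_ofPred_eq, ht] at hs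
      exact hs
    have ha := hv a
    have hb := hv b
    have hc := hv c
    grind

variable {T}

/-- If `h` lies in a dipole with ends `h` and `y`, then a connected set avoiding `h` and `y` meets
only one of the other labels next to it. -/
theorem eq_of_conn {s₁ s₂ : T.Node} (h₁ : T.tree.Adj s₁ t) (h₂ : T.tree.Adj s₂ t)
    (hi₁ : V(T.label s₁) ∩ V(T.label t) ⊆ {h, y}) (hi₂ : V(T.label s₂) ∩ V(T.label t) ⊆ {h, y})
    (hP : Conn G P) (hh : h ∉ P) (hy : y ∉ P) (ha : a ∈ P) (hb : b ∈ P)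
    (ha' : a ∈ V(T.label s₁)) (hb' : b ∈ V(T.label s₂)) : s₁ = s₂ := by
  by_contra hne
  obtain ⟨Z, hs₁Z, htZ, hZ⟩ := exists_cut_of_isAcyclic T.isTree.isAcyclic h₁
  have hs₂Z : s₂ ∉ Z := fun hs₂ => hne (hZ s₂ hs₂ t htZ h₂).1.symm
  -- A vertex that occurs on both sides of the tree edge from `s₁` to `t` lies in both labels at
  -- this edge, hence is `h` or `y`.
  have hcross : ∀ v n m, n ∈ Z → m ∉ Z → v ∈ V(T.label n) → v ∈ V(T.label m) → v = h ∨ v = y := by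
    intro v n m hn hm hvn hvm
    obtain ⟨p, hp, q, hq, hpZ, hqZ, hpq⟩ : ∃ p ∈ {n | v ∈ V(T.label n)},
        ∃ q ∈ {n | v ∈ V(T.label n)}, p ∈ Z ∧ q ∉ Z ∧ T.tree.Adj p q := by
      have := (T.conn v).exists_adj (Z := Z) hvn hn hvm hm
      grind
    obtain ⟨rfl, rfl⟩ := hZ p hpZ q hqZ hpq
    exact hi₁ ⟨hp, hq⟩
  -- Each edge within `P` is real in some label, so a connected set avoiding `h` and `y` cannot
  -- leave the side of `s₁`.
  have hPZ := hP {v | ∃ n ∈ Z, v ∈ V(T.label n)} ⟨a, ha, s₁, hs₁Z, ha'⟩ ?_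
  · obtain ⟨n, hn, hbn⟩ := hPZ hb
    rcases hcross b n s₂ hn hs₂Z hbn hb' with rfl | rfl
    exacts [hh hb, hy hb]
  · rintro u hu ⟨n, hn, hun⟩ w hw huw
    obtain ⟨m, hm⟩ := T.exists_isLink_real huw
    refine ⟨m, ?_, hm.right_mem⟩
    by_contra hmZ
    rcases hcross u n m hn hmZ hun hm.left_mem with rfl | rfl
    exacts [hh hu, hy hu]

/-- The nodes at `h` are a single S-node, or one P- or R-node `t` together with S-nodes adjacent to
it. Each edge at `h` then shows up at `t`, as itself or as the virtual edge to the S-node that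
contains it, and different edges show up differently. Four edges at `h` are too many for a cycle and
for an R-node; at a P-node, a wing avoiding the other end is confined to one branch. -/
theorem not_butterfly (hR : ∀ t : T.Node, T.IsRNode t →
      ∀ x ∈ (T.label t).vertexSet, {y | (T.label t).Adj x y}.encard ≤ 3)
    (hPR : ∀ u : V, ¬ ∃ s t : T.Node, s ≠ t ∧
      (T.IsPNode s ∨ T.IsRNode s) ∧ (T.IsPNode t ∨ T.IsRNode t) ∧
      u ∈ (T.label s).vertexSet ∧ u ∈ (T.label t).vertexSet) : ¬ Butterfly G h := by
  rintro ⟨P, Q, hP, hQ, hPQ, hhP, hhQ, ⟨a, ha, b, hb, hab, hha, hhb⟩,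
    ⟨c, hc, d, hd, hcd, hhc, hhd⟩⟩
  have hac : a ≠ c := fun e => disjoint_left.1 hPQ ha (e ▸ hc)
  have had : a ≠ d := fun e => disjoint_left.1 hPQ ha (e ▸ hd)
  have hbc : b ≠ c := fun e => disjoint_left.1 hPQ hb (e ▸ hc)
  have hbd : b ≠ d := fun e => disjoint_left.1 hPQ hb (e ▸ hd)
  have htype := T.label_type_of_ne hab hac hbc
  have := T.isTree.connected.nonempty
  choose! σ hσ using fun z (hz : G.Adj h z) => T.exists_isLink_real hz
  by_cases hex : ∃ t, (T.IsPNode t ∨ T.IsRNode t) ∧ h ∈ V(T.label t)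
  swap
  · push Not at hex
    have hS : ∀ t, h ∈ V(T.label t) → IsCycleLabel (T.label t) := fun t ht =>
      (htype t).resolve_right fun h' => hex t h' ht
    -- The nodes containing `h` form a subtree consisting of S-nodes, no two of which are adjacent,
    -- so there is only one.
    have heq : ∀ s t, h ∈ V(T.label s) → h ∈ V(T.label t) → t = s := fun s t hs ht =>
      T.conn h {s} ⟨s, hs, rfl⟩ (fun u hu hus w hw huw =>
        absurd ⟨hS u hu, hS w hw⟩ (T.not_adj_S u w huw)) ht
    have hlink : ∀ z, G.Adj h z → (T.label (σ a)).Adj h z := by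
      intro z hz
      rw [heq (σ z) (σ a) (hσ z hz).left_mem (hσ a hha).left_mem]
      exact ⟨_, hσ z hz⟩
    exact (hS _ (hσ a hha).left_mem).false_of_adj (hlink a hha) (hlink b hhb) (hlink c hhc)
      hab hac hbc
  obtain ⟨t, ht, hht⟩ := hex
  have huniq : ∀ s, (T.IsPNode s ∨ T.IsRNode s) → h ∈ V(T.label s) → s = t := by
    intro s hs hhs
    by_contra hne
    exact hPR h ⟨s, t, hne, hs, ht, hhs, hht⟩
  have hS : ∀ s, h ∈ V(T.label s) → s ≠ t → IsCycleLabel (T.label s) := fun s hs hst =>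
    (htype s).resolve_right fun h' => hst (huniq s h' hs)
  -- A node of the subtree at distance two from `t` would be an S-node adjacent to an S-node.
  have hnear : ∀ s, h ∈ V(T.label s) → s = t ∨ T.tree.Adj s t := fun s hs =>
    T.conn h {s | s = t ∨ T.tree.Adj s t} ⟨t, hht, .inl rfl⟩ (by
      rintro u hu (rfl | hut) w hw huw
      · exact .inr huw.symm
      · left
        by_contra hwt
        exact T.not_adj_S u w huw ⟨hS u hu hut.ne, hS w hw hwt⟩) hs
  have hnear' : ∀ z, G.Adj h z → σ z ≠ t → T.tree.Adj (σ z) t := fun z hz hne =>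
    (hnear _ (hσ z hz).left_mem).resolve_left hne
  -- An S-node next to `t` has two edges at `h`, one of them the virtual edge to `t`. It has no room
  -- for two real edges at `h`.
  have hinj : ∀ z w, G.Adj h z → G.Adj h w → z ≠ w → σ z = σ w → σ z = t := by
    intro z w hz hw hzw he
    by_contra hne
    have h1 := hσ z hz
    have h2 := hσ w hw
    rw [← he] at h2
    obtain ⟨y, h3⟩ := T.exists_isLink_virtual (hnear' z hz hne) h1.left_mem hht
    have hc := hS _ h1.left_mem hne
    refine hc.false_of_adj ⟨_, h1⟩ ⟨_, h2⟩ ⟨_, h3⟩ hzw ?_ ?_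
    · rintro rfl
      exact Sum.inl_ne_inr (hc.1.eq_of_isLink h1 h3)
    · rintro rfl
      exact Sum.inl_ne_inr (hc.1.eq_of_isLink h2 h3)
  have hedge : ∀ z, G.Adj h z → ∃ w e, (T.label t).IsLink e h w ∧
      ((σ z = t ∧ e = .inl s(h, z)) ∨ (σ z ≠ t ∧ e = .inr (σ z))) := by
    intro z hz
    by_cases hst : σ z = t
    · exact ⟨z, _, hst ▸ hσ z hz, .inl ⟨hst, rfl⟩⟩
    · obtain ⟨w, hw⟩ := T.exists_isLink_virtual (hnear' z hz hst).symm hht (hσ z hz).left_mem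
      exact ⟨w, _, hw, .inr ⟨hst, rfl⟩⟩
  rcases ht with ht | ht
  · obtain ⟨x, y, F, hxy, -, hF⟩ := ht
    obtain ⟨y, hyt⟩ : ∃ y, V(T.label t) = {h, y} := by
      rw [hF] at hht ⊢
      rcases hht with rfl | rfl
      exacts [⟨y, rfl⟩, ⟨x, pair_comm _ _⟩]
    -- Neighbours of `h` in a wing that avoids `y` are outside the label of `t`. By `eq_of_conn` the
    -- real edges to them lie in the same S-node, which `hinj` rules out.
    have key : ∀ R : Set V, Conn G R → h ∉ R → y ∉ R → ∀ p ∈ R, ∀ q ∈ R, p ≠ q → G.Adj h p →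
        G.Adj h q → False := by
      intro R hR hhR hyR p hp q hq hpq hhp hhq
      have hne : ∀ z, z ∈ R → G.Adj h z → σ z ≠ t := by
        intro z hz hhz e
        have : z ∈ V(T.label t) := e ▸ (hσ z hhz).right_mem
        rw [hyt] at this
        rcases this with rfl | rfl
        exacts [hhR hz, hyR hz]
      have hi : ∀ s, V(T.label s) ∩ V(T.label t) ⊆ {h, y} := fun s => hyt ▸ inter_subset_right
      have := eq_of_conn (hnear' p hhp (hne p hp hhp)) (hnear' q hhq (hne q hq hhq)) (hi _) (hi _)
        hR hhR hyR hp hq (hσ p hhp).right_mem (hσ q hhq).right_mem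
      exact hne p hp hhp (hinj p q hhp hhq hpq this)
    by_cases hyP : y ∈ P
    · exact key Q hQ hhQ (disjoint_left.1 hPQ hyP) c hc d hd hcd hhc hhd
    · exact key P hP hhP hyP a ha b hb hab hha hhb
  · have : Nonempty V := ⟨h⟩
    choose! w e hwe using hedge
    -- The label of an R-node is simple, so different edges at `h` lead to different neighbours. The
    -- four edges of the butterfly would give `h` degree at least four in it.
    have hw : ∀ z z', G.Adj h z → G.Adj h z' → z ≠ z' → w z ≠ w z' := by
      intro z z' hz hz' hne he
      obtain ⟨h1, h2⟩ := hwe z hz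
      obtain ⟨h1', h2'⟩ := hwe z' hz'
      rw [he] at h1
      have hee := ht.1.eq_of_isLink h1 h1'
      rcases h2 with ⟨h3, h4⟩ | ⟨h3, h4⟩ <;> rcases h2' with ⟨h3', h4'⟩ | ⟨h3', h4'⟩
      · rw [h4, h4'] at hee
        have := Sum.inl_injective hee
        exact hne (by rcases Sym2.eq_iff.1 this with h | h; exacts [h.2, h.2.trans h.1])
      · rw [h4, h4'] at hee
        exact Sum.inl_ne_inr hee
      · rw [h4, h4'] at hee
        exact Sum.inr_ne_inl hee
      · rw [h4, h4'] at hee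
        exact h3 (hinj z z' hz hz' hne (Sum.inr_injective hee))
    have h4 : ({w a, w b, w c, w d} : Set V).encard = 4 := by
      have h1 := hw a b hha hhb hab
      have h2 := hw a c hha hhc hac
      have h3 := hw a d hha hhd had
      have h4 := hw b c hhb hhc hbc
      have h5 := hw b d hhb hhd hbd
      have h6 := hw c d hhc hhd hcd
      rw [encard_insert_of_notMem (by simp [h1, h2, h3]), encard_eq_three.2 ⟨_, _, _, h4, h5, h6, rfl⟩]
      rfl
    have hsub : ({w a, w b, w c, w d} : Set V) ⊆ {y | (T.label t).Adj h y} := by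
      rintro z (rfl | rfl | rfl | rfl)
      exacts [⟨_, (hwe a hha).1⟩, ⟨_, (hwe b hhb).1⟩, ⟨_, (hwe c hhc).1⟩, ⟨_, (hwe d hhd).1⟩]
    have := (encard_le_encard hsub).trans (hR t ht h hht)
    rw [h4] at this
    exact absurd this (by decide)

end SPQRTree

end GemSPQR

theorem theorem3p2 {V : Type*} [Finite V] (G : SimpleGraph V) :
    ¬ GemSPQR.IsTopologicalMinor (GemSPQR.fan 4) G ↔
      ∀ C : G.Subgraph, GemSPQR.IsTwoConnectedComponent G C →
        ∃ T : GemSPQR.SPQRTree C.coe,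
          (∀ t : T.Node, T.IsRNode t →
            ∀ x ∈ (T.label t).vertexSet, {y | (T.label t).Adj x y}.encard ≤ 3) ∧
          (∀ u : C.verts, ¬ ∃ s t : T.Node, s ≠ t ∧
            (T.IsPNode s ∨ T.IsRNode s) ∧ (T.IsPNode t ∨ T.IsRNode t) ∧
            u ∈ (T.label s).vertexSet ∧ u ∈ (T.label t).vertexSet) := by
  constructor
  · intro hG C hC
    have hb := GemSPQR.isKConnected_two_iff.1 hC.prop
    exact GemSPQR.exists_sPQRTree hb fun h hh =>
      hG ((hb.isTopologicalMinor_of_butterfly hh).map C.hom C.hom_injective)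
  · rintro hT ⟨M⟩
    obtain ⟨C, hC, h, hh⟩ := M.exists_butterfly
    obtain ⟨T, hR, hPR⟩ := hT C hC
    exact T.not_butterfly hR hPR hh
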